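/- Let $\omega=\{0,1,2,\dots\}$ and let $a_0,a_1,\dots$ be attributes. A decision rule $r$ is an expression $(a_{i_1}=\delta_1)\wedge\cdots\wedge(a_{i_m}=\delta_m)\to\sigma$ with pairwise different attributes and $\delta_j,\sigma\in\omega$, $m\ge 0$; $m$ is its length, $\sigma$ its right-hand side, and $K(r)=\{a_{i_1}=\delta_1,\dots,a_{i_m}=\delta_m\}$. Rules with the same $K(r)$ and the same right-hand side are equal. A decision rule system is a finite nonempty set $S$ of decision rules; $A(S)$ is the set of attributes that occur in it, $V_S(a)$ is the set of values $\delta$ such that $a=\delta$ occurs in a rule of $S$, $EV_S(a)=V_S(a)\cup\{\ast\}$, $k(S)=\max_{a\in A(S)}|V_S(a)|$ ($0$ if $A(S)=\emptyset$), and $d(S)$ is the maximum length of a rule of $S$. For $k,d\ge 1$ put $\Sigma(k,d)=\{S: k(S)=k,\ d(S)=d\}$. The size of $S$ is the length of the word over $\{(,),a,=,\wedge,\to,0,1,;\}$ that represents $S$, with numbers written in binary and rules separated by ";". An acyclic decision graph over $S$ is a finite labeled directed graph without directed cycles, with exactly one node without entering edges (the root), in which every node with leaving edges is labeled with an attribute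 $a\in A(S)$, its leaving edges being labeled bijectively with the elements of $V_S(a)$ (ordinary graph) or of $EV_S(a)$ (extended graph), and every terminal node (node without leaving edges) is labeled with a subset of $S$. For a complete path $\xi$ from the root to a terminal node, $K(\xi)$ is the set of equations $a=\delta$ met along $\xi$ and $\tau(\xi)$ is the label of its last node. A set of equations is consistent if it does not contain $a=\delta$ and $a=\delta'$ with $\delta\ne\delta'$. An ordinary graph solves the problem $AR(S)$, $AD(S)$ or $SR(S)$, and an extended graph solves $EAR(S)$, $EAD(S)$ or $ESR(S)$, if every complete path $\xi$ with consistent $K(\xi)$ satisfies $K(r)\subseteq K(\xi)$ for all $r\in\tau(\xi)$ and, respectively: - (All Rules: $AR$, $EAR$) $K(r)\cup K(\xi)$ is inconsistent for every $r\in S\setminus\tau(\xi)$; - (All Decisions: $AD$, $EAD$) $K(r)\cup K(\xi)$ is inconsistent for every $r\in S\setminus\tau(\xi)$ whose right-hand side is not the right-hand side of a rule in $\tau(\xi)$; - (Some Rules: $SR$, $ESR$) if $\tau(\xi)=\emptyset$, then $K(r)\cup K(\xi)$ is inconsistent for every $r\in S$. For $C\in\{SR,ESR,AD,EAD,AR,EAR\}$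 let $P_{DG}(C)$ be the set of pairs $(k,d)$ of positive integers for which there is a (sequential) algorithm that, for every $S\in\Sigma(k,d)$, constructs an acyclic decision graph solving the problem $C(S)$, in time polynomial in the size of $S$. **Theorem 2.** (a) $P_{DG}(SR)=P_{DG}(ESR)=(\omega\setminus\{0\})^2$. (b) $P_{DG}(AD)=P_{DG}(AR)=\{(1,d): d\in\omega\setminus\{0\}\}$. (c) $P_{DG}(EAD)=P_{DG}(EAR)=\emptyset$. -/

import Mathlib

namespace DecisionRules

/-! ### Decision rule systems -/

/-- A decision rule `(a_{i₁} = δ₁) ∧ ⋯ ∧ (a_{iₘ} = δₘ) → σ`, up to the order of the equations.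
The attribute `a_i` is given by its index `i`, and the pair `(i, δ)` is the equation `a_i = δ`. -/
structure Rule where
  /-- the set `K(r)` of equations of the left-hand side -/
  K : Finset (ℕ × ℕ)
  /-- the attributes of the left-hand side are pairwise different -/
  distinct : ∀ p ∈ K, ∀ q ∈ K, p.1 = q.1 → p = q
  /-- the right-hand side -/
  rhs : ℕ
  deriving DecidableEq

/-- The length of a rule, i.e. the number of equations in its left-hand side. -/
def Rule.length (r : Rule) : ℕ := r.K.card

/-- The set `A(S)` of (indices of) attributes of the rules from `S`. -/
def attrs (S : Finset Rule) : Finset ℕ := S.biUnion fun r => r.K.image Prod.fst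

/-- `V_S(a)`: the values `δ` such that `a = δ` occurs in a rule from `S`. -/
def values (S : Finset Rule) (a : ℕ) : Finset ℕ :=
  ((S.biUnion Rule.K).filter fun p => p.1 = a).image Prod.snd

/-- `k(S)`: the maximum number of values of an attribute (`0` if there are no attributes). -/
def maxValues (S : Finset Rule) : ℕ := (attrs S).sup fun a => (values S a).card

/-- `d(S)`: the maximum length of a rule from `S`. -/
def maxLength (S : Finset Rule) : ℕ := S.sup Rule.length

/-- `D(Z)`: the set of right-hand sides of the rules from `Z`. -/
def decisions (Z : Finset Rule) : Finset ℕ := Z.image Rule.rhs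

/-- `Σ(k,d)`: the decision rule systems (finite nonempty sets of rules) `S` with `k(S) = k` and
`d(S) = d`. -/
def Sigma (k d : ℕ) : Set (Finset Rule) :=
  {S | S.Nonempty ∧ maxValues S = k ∧ maxLength S = d}

/-! ### Systems of equations

The value of an attribute in an input is an element of `Option ℕ`, where `none` is the symbol `∗`
(a value that does not occur in the rule system). -/

/-- The set of equations `K(r)`, among equations whose right-hand sides may be `∗`. -/
def Rule.eqs (r : Rule) : Finset (ℕ × Option ℕ) := r.K.image fun p => (p.1, some p.2)

/-- A system of equations is consistent if it does not contain two equations with the same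
attribute and different values. -/
def Consistent (E : Finset (ℕ × Option ℕ)) : Prop :=
  ∀ p ∈ E, ∀ q ∈ E, p.1 = q.1 → p.2 = q.2

/-! ### The six problems -/

/-- All Rules, All Decisions, Some Rules, and their extended variants. -/
inductive Problem
  | AR | EAR | AD | EAD | SR | ESR

/-- The variants in which an attribute can have any value. -/
def Problem.Extended : Problem → Prop
  | .EAR | .EAD | .ESR => True
  | .AR | .AD | .SR => False

open Classical in
/-- `V_S^C(a)`: this is `V_S(a)` for the ordinary problems and `EV_S(a) = V_S(a) ∪ {∗}` for the
extended ones. -/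
noncomputable def problemValues (C : Problem) (S : Finset Rule) (a : ℕ) : Finset (Option ℕ) :=
  if C.Extended then insert none ((values S a).image some) else (values S a).image some

/-- `τ` (the label of a terminal node) is an admissible answer on a path with the system of
equations `E`, for the problem `C` and the rule system `S`. -/
def Answers (C : Problem) (S τ : Finset Rule) (E : Finset (ℕ × Option ℕ)) : Prop :=
  (∀ r ∈ τ, r.eqs ⊆ E) ∧
    match C with
    | .AR | .EAR => ∀ r ∈ S \ τ, ¬ Consistent (r.eqs ∪ E)
    | .AD | .EAD => ∀ r ∈ S \ τ, r.rhs ∉ decisions τ → ¬ Consistent (r.eqs ∪ E)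
    | .SR | .ESR => τ = ∅ → ∀ r ∈ S, ¬ Consistent (r.eqs ∪ E)

/-! ### Acyclic decision graphs -/

/-- Labels of nodes: an attribute or a set of rules. -/
inductive NodeLabel
  | attr (a : ℕ)
  | rules (Z : Finset Rule)

/-- A finite directed labeled graph; its nodes are natural numbers. The triple `(u, δ, v)` is an
edge that leaves `u`, enters `v` and is labeled with `δ`. Only the labels of elements of `nodes`
matter. -/
structure LabeledGraph where
  /-- the set of nodes -/
  nodes : Finset ℕ
  /-- the set of labeled edges -/
  edges : Finset (ℕ × Option ℕ × ℕ)
  /-- the labels of the nodes -/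
  label : ℕ → NodeLabel

namespace LabeledGraph

variable (G : LabeledGraph)

/-- There is an edge from `u` to `v`. -/
def Adj (u v : ℕ) : Prop := ∃ δ, (u, δ, v) ∈ G.edges

/-- `v` is a node without entering edges. -/
def IsSource (v : ℕ) : Prop := v ∈ G.nodes ∧ ∀ u, ¬ G.Adj u v

/-- `v` is a node without leaving edges. -/
def IsTerminal (v : ℕ) : Prop := v ∈ G.nodes ∧ ∀ u, ¬ G.Adj v u

/-- `G` is an acyclic decision graph over `S`, of the type that fits the problem `C` (ordinary or
extended). The root is the only node without entering edges. -/
structure IsDecisionGraph (C : Problem) (S : Finset Rule) : Prop where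
  edges_nodes : ∀ u δ v, (u, δ, v) ∈ G.edges → u ∈ G.nodes ∧ v ∈ G.nodes
  root : ∃! v, G.IsSource v
  acyclic : ∀ v, ¬ Relation.TransGen G.Adj v v
  /-- A working node is labeled with an attribute `a ∈ A(S)`, and the edges leaving it are labeled
  with pairwise different elements, namely those of `V_S^C(a)`. -/
  working : ∀ u ∈ G.nodes, ¬ G.IsTerminal u → ∃ a ∈ attrs S, G.label u = .attr a ∧
    (∀ δ, (∃ v, (u, δ, v) ∈ G.edges) ↔ δ ∈ problemValues C S a) ∧
    (∀ δ v w, (u, δ, v) ∈ G.edges → (u, δ, w) ∈ G.edges → v = w)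
  /-- A terminal node is labeled with a subset of `S`. -/
  terminal : ∀ u, G.IsTerminal u → ∃ Z ⊆ S, G.label u = .rules Z

/-- `G.Path u E v`: there is a directed path from `u` to `v` along which the equations in the list
`E` are met. -/
inductive Path : ℕ → List (ℕ × Option ℕ) → ℕ → Prop
  | nil (u : ℕ) : Path u [] u
  | cons {u v w a : ℕ} {δ : Option ℕ} {E : List (ℕ × Option ℕ)} :
      G.label u = .attr a → (u, δ, v) ∈ G.edges → Path v E w → Path u ((a, δ) :: E) w

/-- The acyclic decision graph `G` over `S` solves the problem `C(S)`: on any complete path (from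
the root to a terminal node) with a consistent system of equations, the answer is admissible. -/
def Solves (C : Problem) (S : Finset Rule) : Prop :=
  G.IsDecisionGraph C S ∧
    ∀ u E v τ, G.IsSource u → G.Path u E v → G.IsTerminal v → G.label v = .rules τ →
      Consistent E.toFinset → Answers C S τ E.toFinset

end LabeledGraph

/-! ### Words that represent rule systems and graphs -/

/-- The alphabet `{(, ), a, =, ∧, →, 0, 1, ;}`. -/
inductive Letter
  | lpar | rpar | a | eq | and | arrow | zero | one | semicolon
  deriving DecidableEq

instance : Fintype Letter where
  elems := {.lpar, .rpar, .a, .eq, .and, .arrow, .zero, .one, .semicolon}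
  complete x := by cases x <;> decide

/-- The binary representation of a natural number, most significant digit first. -/
def binary (n : ℕ) : List Letter :=
  if n = 0 then [.zero] else n.bits.reverse.map fun b => if b then .one else .zero

/-- The word `(ai=δ)`. -/
def eqnWord (p : ℕ × ℕ) : List Letter :=
  [.lpar, .a] ++ binary p.1 ++ [.eq] ++ binary p.2 ++ [.rpar]

/-- `w` is a word `(ai₁=δ₁)∧⋯∧(aiₘ=δₘ)→σ` that represents the rule `r`; the equations of `K(r)` are
listed without repetitions in some order. -/
def RuleWord (r : Rule) (w : List Letter) : Prop :=
  ∃ l : List (ℕ × ℕ), l.Nodup ∧ l.toFinset = r.K ∧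
    w = [Letter.and].intercalate (l.map eqnWord) ++ [.arrow] ++ binary r.rhs

/-- `w` represents the finite set `S` of rules: words for the rules from `S`, listed without
repetitions in some order and separated by semicolons. All words that represent `S` have the same
length, which is the size of `S`. -/
def SystemWord (S : Finset Rule) (w : List Letter) : Prop :=
  ∃ (l : List Rule) (ws : List (List Letter)), l.Nodup ∧ l.toFinset = S ∧
    List.Forall₂ RuleWord l ws ∧ w = [Letter.semicolon].intercalate ws

/-- The alphabet for graphs: the alphabet for rule systems and `∗`, a mark for the beginning of a
node, a mark for the beginning of an edge, and a colon. -/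
inductive GLetter
  | sym (s : Letter) | star | node | edge | colon
  deriving DecidableEq, Fintype

/-- The binary representation in the alphabet for graphs. -/
def gbinary (n : ℕ) : List GLetter := (binary n).map .sym

/-- The word for the label of an edge. -/
def valueWord : Option ℕ → List GLetter
  | none => [.star]
  | some δ => gbinary δ

/-- The word for an edge, given by its label and by the node that it enters. -/
def edgeWord (e : Option ℕ × ℕ) : List GLetter :=
  [.edge] ++ valueWord e.1 ++ [.colon] ++ gbinary e.2

/-- `w` describes the node `u` of `G`: it gives the name of `u`, and then either the attribute and
the leaving edges (listed without repetitions in some order), or the set of rules in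
parentheses. -/
def NodeWord (G : LabeledGraph) (u : ℕ) (w : List GLetter) : Prop :=
  match G.label u with
  | .attr a => ∃ es : List (Option ℕ × ℕ), es.Nodup ∧
      (∀ δ v, (δ, v) ∈ es ↔ (u, δ, v) ∈ G.edges) ∧
      w = [.node] ++ gbinary u ++ [.sym .a] ++ gbinary a ++ (es.map edgeWord).flatten
  | .rules Z => ∃ z : List Letter, SystemWord Z z ∧
      w = [.node] ++ gbinary u ++ [.sym .lpar] ++ z.map .sym ++ [.sym .rpar]

/-- `w` represents the graph `G`: descriptions of its nodes, listed without repetitions in some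
order. -/
def GraphWord (G : LabeledGraph) (w : List GLetter) : Prop :=
  ∃ (l : List ℕ) (ws : List (List GLetter)), l.Nodup ∧ l.toFinset = G.nodes ∧
    List.Forall₂ (NodeWord G) l ws ∧ w = ws.flatten

/-! ### Construction in polynomial time -/

/-- The words that represent the systems from `Σ(k,d)`. -/
abbrev InputWord (k d : ℕ) : Type := {w : List Letter // ∃ S ∈ Sigma k d, SystemWord S w}

/-- There is a polynomial time algorithm (a Turing machine with several stacks over finite
alphabets) that, given any word representing a system `S ∈ Σ(k,d)`, writes a word representing an
acyclic decision graph that solves the problem `C(S)`. The time is bounded by a polynomial in the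
length of the input word, i.e. in the size of `S`. -/
def PolyTimeConstructible (C : Problem) (k d : ℕ) : Prop :=
  ∃ f : InputWord k d → List GLetter,
    (∃ M : Turing.TM2ComputableInPolyTime (Subtype.val : InputWord k d → List Letter) id f,
      ∀ i, Finite (M.tm.Γ i)) ∧
    ∀ (S : Finset Rule) (hS : S ∈ Sigma k d) (w : List Letter) (hw : SystemWord S w),
      ∃ G : LabeledGraph, GraphWord G (f ⟨w, S, hS, hw⟩) ∧ G.Solves C S

/-- The set `P_DG(C)`. -/
def PDG (C : Problem) : Set (ℕ × ℕ) :=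
  {p | 0 < p.1 ∧ 0 < p.2 ∧ PolyTimeConstructible C p.1 p.2}

end DecisionRules

/-! For `SR` and `ESR` the rules are tried one after the other. The equations of a rule are tested
in turn; the value demanded by the rule leads to its next equation, any other value to the first
node of the next rule. When all equations of a rule have been confirmed, the answer is that rule
alone; when every rule has failed, the answer is the empty set. There is at most one node for each
occurrence of an equation and for each rule, and one more, so the graph is small. Since the root
must be the only source, the construction stops after a rule that cannot fail: an empty rule, or,
for ordinary graphs, one whose attributes all have a single value.

For `AD` and `AR` with one value per attribute, an ordinary graph cannot branch: a single path tests
all equations and ends with the label `S`.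

In the remaining cases every attribute of `largeSystem k d n` can take a value other than `0`,
namely `1` or `∗`. There the decision `i + 1` comes only from the rule `(a_i = 0) → i + 1`, so `2 ^
n` tuples of values have pairwise different sets of true decisions. By
`LabeledGraph.Solves.exists_terminal` each tuple reaches a terminal node whose label has exactly the
decisions true for the tuple; hence there are at least `2 ^ n` nodes, while the size of the system
is polynomial in `n`. A polynomial time machine writes only polynomially many letters
(`exists_length_output_le`), and each node costs at least one letter.

The positive results also need actual machines. Programs of a small loop language compile to stack
machines without loss of time (`Exec.stepsTo`), and the functions computed by such programs in
polynomial time (`Comp`) are closed under structural recursion on words with polynomially bounded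
values (`Comp.recursion`). The output words `rulesWord` and `chainWord` are defined by recursions of
this kind. A node is named after the length of a suffix of the input, so edges lead to shorter
suffixes and acyclicity is automatic; `solves_graphOf` then reduces correctness to an invariant
relating nodes to the equations met before them. -/

namespace DecisionRules

section Machines

open Turing Function

/-! ### A loop language for stack machines -/

/-- Programs that act on stacks `0, 1, 2, …` over the alphabet `A`. The program `loop k f` pops
symbols from the stack `k` until it is empty, and runs `f c` after popping the symbol `c`. -/
inductive Prog (A : Type)
  | skip
  | push (k : ℕ) (c : A)
  | seq (p q : Prog A)
  | loop (k : ℕ) (f : A → Prog A)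

/-- The contents of the stacks. -/
abbrev Store (A : Type) : Type := ℕ → List A

section Prog

variable {A : Type}

/-- `Exec p s s' t`: the program `p` transforms `s` into `s'` in `t` steps. -/
inductive Exec : Prog A → Store A → Store A → ℕ → Prop
  | skip (s : Store A) : Exec .skip s s 1
  | push (k : ℕ) (c : A) (s : Store A) : Exec (.push k c) s (update s k (c :: s k)) 1
  | seq {p q : Prog A} {s s' s'' : Store A} {t t' : ℕ} :
      Exec p s s' t → Exec q s' s'' t' → Exec (.seq p q) s s'' (t + t')
  | loop_nil {k : ℕ} {f : A → Prog A} {s : Store A} : s k = [] → Exec (.loop k f) s s 1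
  | loop_cons {k : ℕ} {f : A → Prog A} {s s' s'' : Store A} {c : A} {l : List A} {t t' : ℕ} :
      s k = c :: l → Exec (f c) (update s k l) s' t → Exec (.loop k f) s' s'' t' →
      Exec (.loop k f) s s'' (1 + (t + t'))

/-- The program uses only stacks with numbers at most `N`. -/
def Prog.Below (N : ℕ) : Prog A → Prop
  | .skip => True
  | .push k _ => k ≤ N
  | .seq p q => p.Below N ∧ q.Below N
  | .loop k f => k ≤ N ∧ ∀ c, (f c).Below N

theorem Prog.Below.mono {N N' : ℕ} (h : N ≤ N') : ∀ {p : Prog A}, p.Below N → p.Below N'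
  | .skip, _ => trivial
  | .push _ _, hp => le_trans hp h
  | .seq _ _, hp => ⟨hp.1.mono h, hp.2.mono h⟩
  | .loop _ _, hp => ⟨le_trans hp.1 h, fun c => (hp.2 c).mono h⟩

theorem Prog.exists_below [Finite A] (p : Prog A) : ∃ N, p.Below N := by
  induction p with
  | skip => exact ⟨0, trivial⟩
  | push k c => exact ⟨k, le_rfl⟩
  | seq p q hp hq =>
    obtain ⟨N, hN⟩ := hp
    obtain ⟨N', hN'⟩ := hq
    exact ⟨max N N', hN.mono (le_max_left _ _), hN'.mono (le_max_right _ _)⟩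
  | loop k f hf =>
    choose N hN using hf
    obtain ⟨B, hB⟩ := (Set.finite_range N).bddAbove
    exact ⟨max k B, le_max_left _ _, fun c =>
      (hN c).mono ((hB ⟨c, rfl⟩).trans (le_max_right _ _))⟩

/-- The labels of the machine that runs a program. -/
def Prog.Lab : Prog A → Type
  | .skip => Unit
  | .push _ _ => Unit
  | .seq p q => p.Lab ⊕ q.Lab
  | .loop _ f => Option (Σ c, (f c).Lab)

theorem Prog.finite_lab [Finite A] : ∀ p : Prog A, Finite p.Lab
  | .skip => inferInstanceAs (Finite Unit)
  | .push _ _ => inferInstanceAs (Finite Unit)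
  | .seq p q => by
    have := p.finite_lab
    have := q.finite_lab
    exact inferInstanceAs (Finite (p.Lab ⊕ q.Lab))
  | .loop _ f => by
    have := fun c => (f c).finite_lab
    exact inferInstanceAs (Finite (Option (Σ c, (f c).Lab)))

/-- The label at which a program begins. -/
def Prog.entry : (p : Prog A) → p.Lab
  | .skip => ()
  | .push _ _ => ()
  | .seq p _ => .inl p.entry
  | .loop _ _ => (none : Option _)

/-- The alphabets of the stacks: there is an input stack over `I` and there are `N + 1` work stacks
over `A`. -/
def StackAlphabet (I A : Type) (N : ℕ) : Option (Fin (N + 1)) → Type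
  | none => I
  | some _ => A

variable {I : Type} {N : ℕ}

/-- The statements of the machine that runs a program, embedded into a machine with the set of
labels `Λ` by `emb`, so that `exit` is the label that follows. -/
def Prog.code {Λ : Type} : (p : Prog A) → (p.Lab → Λ) → Λ → p.Lab →
    TM2.Stmt (StackAlphabet I A N) Λ (Option A)
  | .skip, _, exit => fun _ => .goto fun _ => exit
  | .push k c, _, exit => fun _ => .push (some (Fin.ofNat (N + 1) k)) (fun _ => c) <|
      .goto fun _ => exit
  | .seq p q, emb, exit => Sum.elim (p.code (fun l => emb (.inl l)) (emb (.inr q.entry)))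
      (q.code (fun l => emb (.inr l)) exit)
  | .loop k f, emb, exit => fun l => Option.elim (α := Σ c, (f c).Lab) l
      (.pop (some (Fin.ofNat (N + 1) k)) (fun _ (o : Option A) => o) <|
        .goto fun v => v.elim exit fun c => emb (some ⟨c, (f c).entry⟩ : Option (Σ c, (f c).Lab)))
      fun x => (f x.1).code (fun l => emb (some ⟨x.1, l⟩ : Option (Σ c, (f c).Lab)))
        (emb (none : Option (Σ c, (f c).Lab))) x.2

/-- The stacks of a machine hold the store `s`, and the input stack is empty. -/
def Holds (S : ∀ k, List (StackAlphabet I A N k)) (s : Store A) : Prop :=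
  S none = [] ∧ ∀ j : Fin (N + 1), S (some j) = s j

theorem Holds.update {S : ∀ k, List (StackAlphabet I A N k)} {s : Store A} (h : Holds S s) {k : ℕ}
    (hk : k ≤ N) (l : List A) :
    Holds (Function.update S (some (Fin.ofNat (N + 1) k)) l) (Function.update s k l) := by
  refine ⟨by simpa [Function.update] using h.1, fun j => ?_⟩
  have hk' : (Fin.ofNat (N + 1) k : ℕ) = k := Nat.mod_eq_of_lt (by omega)
  by_cases hj : (j : ℕ) = k
  · obtain rfl : j = Fin.ofNat (N + 1) k := Fin.ext (by omega)
    refine (Function.update_self (β := fun k => List (StackAlphabet I A N k)) _ _ _).trans ?_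
    rw [hk', Function.update_self]
  · have : (some j : Option (Fin (N + 1))) ≠ some (Fin.ofNat (N + 1) k) := by
      intro e
      rw [Option.some.injEq] at e
      exact hj (by rw [e, hk'])
    refine (Function.update_of_ne (β := fun k => List (StackAlphabet I A N k)) this _ _).trans ?_
    rw [Function.update_of_ne hj]
    exact h.2 j

theorem Holds.get {S : ∀ k, List (StackAlphabet I A N k)} {s : Store A} (h : Holds S s) {k : ℕ}
    (hk : k ≤ N) : S (some (Fin.ofNat (N + 1) k)) = s k := by
  have hk' : (Fin.ofNat (N + 1) k : ℕ) = k := Nat.mod_eq_of_lt (by omega)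
  rw [h.2, hk']

/-- The configuration `c` goes to `c'` in `t` steps. -/
def StepsTo {C : Type} (step : C → Option C) (t : ℕ) (c c' : C) : Prop :=
  (flip bind step)^[t] (some c) = some c'

theorem StepsTo.trans {C : Type} {step : C → Option C} {t t' : ℕ} {c c' c'' : C}
    (h : StepsTo step t c c') (h' : StepsTo step t' c' c'') : StepsTo step (t + t') c c'' := by
  unfold StepsTo at *
  rw [add_comm, Function.iterate_add_apply, h, h']

theorem StepsTo.single {C : Type} {step : C → Option C} {c c' : C} (h : step c = some c') :
    StepsTo step 1 c c' := h

/-- Induction on the execution: the step count of `Exec` is chosen so that every primitive action is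
one machine step. The labels of a subprogram form only a part of those of the machine, hence the
arbitrary `emb` and `exit`; the body of a loop exits to the label that pops the next symbol. -/
theorem Exec.stepsTo {Λ : Type} {M : Λ → TM2.Stmt (StackAlphabet I A N) Λ (Option A)}
    {p : Prog A} {s s' : Store A} {t : ℕ} (h : Exec p s s' t) (hp : p.Below N)
    (emb : p.Lab → Λ) (exit : Λ) (hM : ∀ l, M (emb l) = p.code emb exit l) (v : Option A)
    (S : ∀ k, List (StackAlphabet I A N k)) (hS : Holds S s) :
    ∃ v' S', Holds S' s' ∧
      StepsTo (TM2.step M) t ⟨some (emb p.entry), v, S⟩ ⟨some exit, v', S'⟩ := by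
  induction h generalizing v S exit with
  | skip s =>
    refine ⟨v, S, hS, .single ?_⟩
    rw [TM2.step, hM]
    rfl
  | push k c s =>
    refine ⟨v, _, hS.update hp _, .single ?_⟩
    rw [TM2.step, hM, ← hS.get hp]
    rfl
  | seq h₁ h₂ ih₁ ih₂ =>
    obtain ⟨v₁, S₁, hS₁, e₁⟩ := ih₁ hp.1 (fun l => emb (.inl l)) _ (fun l => hM (.inl l)) v S hS
    obtain ⟨v₂, S₂, hS₂, e₂⟩ := ih₂ hp.2 (fun l => emb (.inr l)) _ (fun l => hM (.inr l)) v₁ S₁ hS₁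
    exact ⟨v₂, S₂, hS₂, e₁.trans e₂⟩
  | @loop_nil k f s hk =>
    refine ⟨none, S, hS, .single ?_⟩
    have e := hS.get hp.1
    rw [hk] at e
    have e' : update S (some (Fin.ofNat (N + 1) k)) (S (some (Fin.ofNat (N + 1) k))).tail = S := by
      refine Function.update_eq_self_iff.2 ?_
      rw [e]
      rfl
    refine congrArg some ((congrArg (fun q => TM2.stepAux q v S) (hM _)).trans ?_)
    refine (congrArg (TM2.stepAux (.goto fun v => _) _) e').trans ?_
    rw [e]
    rfl
  | @loop_cons k f s s' s'' c l t t' hk h₁ h₂ ih₁ ih₂ =>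
    have e := hS.get hp.1
    rw [hk] at e
    have hM' : ∀ l, M (emb (some ⟨c, l⟩ : Option (Σ c, (f c).Lab))) =
        (f c).code (fun l => emb (some ⟨c, l⟩ : Option (Σ c, (f c).Lab)))
          (emb (none : Option (Σ c, (f c).Lab))) l :=
      fun l => hM (some ⟨c, l⟩ : Option (Σ c, (f c).Lab))
    obtain ⟨v₁, S₁, hS₁, e₁⟩ := ih₁ (hp.2 c) _ _ hM' (some c) _ (hS.update hp.1 l)
    obtain ⟨v₂, S₂, hS₂, e₂⟩ := ih₂ hp emb exit hM v₁ S₁ hS₁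
    refine ⟨v₂, S₂, hS₂, StepsTo.trans (.single ?_) (e₁.trans e₂)⟩
    refine congrArg some ((congrArg (fun q => TM2.stepAux q v S) (hM _)).trans ?_)
    have e' : update S (some (Fin.ofNat (N + 1) k)) (S (some (Fin.ofNat (N + 1) k))).tail =
        update S (some (Fin.ofNat (N + 1) k)) l := by rw [e]; rfl
    refine (congrArg (TM2.stepAux (.goto fun v => _) _) e').trans ?_
    rw [e]
    rfl

/-- The program `p` transforms `s` into `s'` in at most `T` steps. -/
def Runs (p : Prog A) (s s' : Store A) (T : ℕ) : Prop := ∃ t ≤ T, Exec p s s' t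

theorem Runs.mono {p : Prog A} {s s' : Store A} {T T' : ℕ} (h : Runs p s s' T) (hT : T ≤ T') :
    Runs p s s' T' := by
  obtain ⟨t, ht, e⟩ := h
  exact ⟨t, ht.trans hT, e⟩

theorem Runs.seq {p q : Prog A} {s s' s'' : Store A} {T T' : ℕ} (h : Runs p s s' T)
    (h' : Runs q s' s'' T') : Runs (.seq p q) s s'' (T + T') := by
  obtain ⟨t, ht, e⟩ := h
  obtain ⟨t', ht', e'⟩ := h'
  exact ⟨t + t', by omega, e.seq e'⟩

theorem Runs.push (k : ℕ) (c : A) (s : Store A) :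
    Runs (.push k c) s (update s k (c :: s k)) 1 := ⟨1, le_rfl, .push k c s⟩

theorem Runs.skip (s : Store A) : Runs .skip s s 1 := ⟨1, le_rfl, .skip s⟩

/-- A loop, described by the contents `F m l` of the stacks after the word `m.reverse` has been
consumed and `l` remains. -/
theorem Runs.loop {k : ℕ} {f : A → Prog A} (F : List A → List A → Store A) {T : ℕ}
    (hk : ∀ m l, F m l k = l) (l m : List A)
    (hf : ∀ c m' l', m'.reverse ++ c :: l' = m.reverse ++ l →
      Runs (f c) (update (F m' (c :: l')) k l') (F (c :: m') l') T) :
    Runs (.loop k f) (F m l) (F (l.reverse ++ m) []) (l.length * (T + 1) + 1) := by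
  induction l generalizing m with
  | nil => exact ⟨1, by simp, .loop_nil (hk _ _)⟩
  | cons c l ih =>
    obtain ⟨t, ht, e⟩ := hf c m l rfl
    obtain ⟨t', ht', e'⟩ := ih (c :: m) (fun c' m' l' h => hf c' m' l' (by simpa using h))
    have := Exec.loop_cons (hk m (c :: l)) e e'
    refine ⟨_, ?_, by simpa using this⟩
    rw [List.length_cons, add_mul]
    omega

/-- Empty the stack `k`. -/
def Prog.clear (k : ℕ) : Prog A := .loop k fun _ => .skip

theorem Runs.clear (k : ℕ) (s : Store A) :
    Runs (Prog.clear k) s (update s k []) ((s k).length * 2 + 1) := by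
  have := Runs.loop (k := k) (f := fun _ => (Prog.skip : Prog A)) (fun _ l => update s k l)
    (T := 1) (by simp) (s k) [] (fun c m l _ => by simpa using Runs.skip _)
  simpa [Prog.clear] using this

/-- Move the stack `k`, reversed, to the stack `j`. -/
def Prog.moveRev (k j : ℕ) : Prog A := .loop k fun c => .push j c

theorem Runs.moveRev {k j : ℕ} (h : k ≠ j) (s : Store A) :
    Runs (Prog.moveRev k j) s (update (update s k []) j ((s k).reverse ++ s j))
      ((s k).length * 2 + 1) := by
  have := Runs.loop (k := k) (f := fun c => (Prog.push j c : Prog A))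
    (fun m l => update (update s k l) j (m ++ s j)) (T := 1) (by simp [h]) (s k) []
    (fun c m l _ => by
      convert Runs.push _ _ _ using 1
      funext i
      by_cases hj : i = j
      · subst hj
        simp [h.symm]
      · by_cases hk : i = k
        · subst hk
          simp [hj]
        · simp [hj, hk])
  have e : update (update s k (s k)) j ([] ++ s j) = s := by simp
  rw [e] at this
  simpa [Prog.moveRev] using this

/-- Copy the stack `k` to the stack `j`, by means of the stack `i`. -/
def Prog.copy (k j i : ℕ) : Prog A :=
  .seq (.moveRev k i) (.loop i fun c => .seq (.push k c) (.push j c))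

theorem Runs.copy {k j i : ℕ} (hkj : k ≠ j) (hki : k ≠ i) (hji : j ≠ i) (s : Store A)
    (hi : s i = []) :
    Runs (Prog.copy k j i) s (update s j (s k ++ s j)) ((s k).length * 5 + 2) := by
  have h₂ := Runs.loop (k := i) (f := fun c => (.seq (.push k c) (.push j c) : Prog A))
    (fun m l => update (update (update s i l) k m) j (m ++ s j)) (T := 2)
    (by simp [hki.symm, hji.symm]) (s k).reverse []
    (fun c m l _ => by
      convert Runs.seq (Runs.push _ _ _) (Runs.push _ _ _) using 1
      funext x
      by_cases hj : x = j
      · subst hj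
        simp [hkj.symm, hji]
      · by_cases hk : x = k
        · subst hk
          simp [hkj, hki]
        · by_cases hi : x = i
          · subst hi
            simp [hki.symm, hji.symm]
          · simp [hj, hk, hi])
  have h₁ := Runs.moveRev hki s
  have e : update (update s k []) i ((s k).reverse ++ s i)
      = update (update (update s i (s k).reverse) k []) j ([] ++ s j) := by
    funext x
    by_cases hj : x = j
    · subst hj
      simp [hkj.symm, hji]
    · by_cases hk : x = k
      · subst hk
        simp [hkj, hki]
      · by_cases hi' : x = i
        · subst hi'
          simp [hki.symm, hji.symm, hi]
        · simp [hj, hk, hi']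
  rw [e] at h₁
  have e' : update (update (update s i []) k ((s k).reverse.reverse ++ [])) j
      ((s k).reverse.reverse ++ [] ++ s j) = update s j (s k ++ s j) := by
    funext x
    by_cases hj : x = j
    · subst hj
      simp
    · by_cases hk : x = k
      · subst hk
        simp [hkj]
      · by_cases hi' : x = i
        · subst hi'
          simp [hki.symm, hji.symm, hi]
        · simp [hj, hk, hi']
  rw [e'] at h₂
  refine (h₁.seq h₂).mono ?_
  rw [List.length_reverse]
  omega

end Prog

/-! ### Polynomial time functions of several words -/

theorem eval_monotone (P : Polynomial ℕ) : Monotone fun n => P.eval n := by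
  intro m n h
  simp only [Polynomial.eval_eq_sum, Polynomial.sum]
  gcongr

section Comp

variable {A α β : Type}

/-- The total length of the words `b a` for `b ∈ bs`. -/
def inputSize (bs : List (α → List A)) (a : α) : ℕ := (bs.map fun b => (b a).length).sum

theorem length_le_inputSize {bs : List (α → List A)} {b : α → List A} (h : b ∈ bs) (a : α) :
    (b a).length ≤ inputSize bs a :=
  List.single_le_sum (by simp) _ (List.mem_map_of_mem h)

@[simp]
theorem inputSize_cons (b : α → List A) (bs : List (α → List A)) (a : α) :
    inputSize (b :: bs) a = (b a).length + inputSize bs a := by simp [inputSize]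

@[simp]
theorem inputSize_map (bs : List (α → List A)) (φ : β → α) (y : β) :
    inputSize (bs.map fun b y => b (φ y)) y = inputSize bs (φ y) := by
  simp [inputSize, Function.comp_def]

/-- The stacks `loc 0, loc 1, …` hold the words `b a` for `b ∈ bs`, the stack `out` is empty, and
so are the stacks from `base` on. -/
structure Ready (bs : List (α → List A)) (a : α) (loc : ℕ → ℕ) (out base : ℕ) (s : Store A) :
    Prop where
  loc_lt : ∀ i < bs.length, loc i < base
  out_lt : out < base
  loc_ne : ∀ i < bs.length, loc i ≠ out
  get : ∀ i (h : i < bs.length), s (loc i) = bs[i] a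
  fresh : ∀ j, base ≤ j → s j = []
  out_nil : s out = []

/-- `f` can be computed from the words `b a` for `b ∈ bs` in time that is polynomial in the total
length of these words. -/
def Comp (bs : List (α → List A)) (f : α → List A) : Prop :=
  ∃ (P : Polynomial ℕ) (prog : (ℕ → ℕ) → ℕ → ℕ → Prog A),
    (∀ a, (f a).length ≤ P.eval (inputSize bs a)) ∧
    ∀ loc out base a s, Ready bs a loc out base s →
      Runs (prog loc out base) s (update s out (f a)) (P.eval (inputSize bs a))

variable {bs : List (α → List A)}

theorem Comp.length_le {f : α → List A} (h : Comp bs f) :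
    ∃ P : Polynomial ℕ, ∀ a, (f a).length ≤ P.eval (inputSize bs a) :=
  let ⟨P, _, hP, _⟩ := h
  ⟨P, hP⟩

theorem Comp.of_mem {f : α → List A} (h : f ∈ bs) : Comp bs f := by
  obtain ⟨i, hi, rfl⟩ := List.getElem_of_mem h
  -- The polynomial is the cost of `Prog.copy`, with the fresh stack `base` as its auxiliary stack.
  refine ⟨5 * .X + 2, fun loc out base => .copy (loc i) out base, fun a => ?_,
    fun loc out base a s hs => ?_⟩
  · have := length_le_inputSize h a
    simp
    omega
  · have h₁ := hs.loc_lt i hi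
    have h₂ := hs.out_lt
    have := Runs.copy (hs.loc_ne i hi) h₁.ne h₂.ne s (hs.fresh base le_rfl)
    rw [hs.out_nil, List.append_nil, hs.get i hi] at this
    refine this.mono ?_
    have := length_le_inputSize h a
    simp
    omega

theorem Comp.nil : Comp bs fun _ => [] := by
  refine ⟨1, fun _ _ _ => .skip, fun a => by simp, fun loc out base a s hs => ?_⟩
  have e : update s out [] = s := by rw [← hs.out_nil, update_eq_self]
  rw [e]
  exact (Runs.skip s).mono (by simp)

theorem Comp.cons (c : A) {f : α → List A} (h : Comp bs f) : Comp bs fun a => c :: f a := by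
  obtain ⟨P, prog, hP, hf⟩ := h
  refine ⟨P + 1, fun loc out base => .seq (prog loc out base) (.push out c), fun a => ?_,
    fun loc out base a s hs => ?_⟩
  · simpa using hP a
  · have := (hf loc out base a s hs).seq (Runs.push out c _)
    simpa using this

theorem inputSize_le_mul {bs' : List (β → List A)} (φ : β → α)
    (hφ : ∀ b ∈ bs, (fun y => b (φ y)) ∈ bs') (y : β) :
    inputSize bs (φ y) ≤ bs.length * inputSize bs' y := by
  have := List.sum_le_card_nsmul (bs.map fun b => (b (φ y)).length) (inputSize bs' y) (by
    intro n hn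
    obtain ⟨b, hb, rfl⟩ := List.mem_map.1 hn
    exact length_le_inputSize (hφ b hb) y)
  simpa [inputSize] using this

/-- The same program works after its input stacks are renamed: each input of `f` is found at some
position `g i` among the new inputs. Several old inputs may share one new input, so the size can
shrink by a factor of at most `bs.length`. -/
theorem Comp.weaken {bs' : List (β → List A)} {f : α → List A} (h : Comp bs f) (φ : β → α)
    (hφ : ∀ b ∈ bs, (fun y => b (φ y)) ∈ bs') : Comp bs' fun y => f (φ y) := by
  obtain ⟨P, prog, hP, hf⟩ := h
  have hi : ∀ i, ∃ j, i < bs.length → ∃ h' : j < bs'.length,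
      ∀ y, ∀ h : i < bs.length, bs'[j] y = bs[i] (φ y) := by
    intro i
    by_cases h : i < bs.length
    · obtain ⟨j, hj, e⟩ := List.getElem_of_mem (hφ _ (List.getElem_mem h))
      exact ⟨j, fun _ => ⟨hj, fun y _ => congrFun e y⟩⟩
    · exact ⟨0, fun h' => absurd h' h⟩
  choose g hg using hi
  obtain ⟨Q, hQ⟩ : ∃ Q : Polynomial ℕ, ∀ y, P.eval (inputSize bs (φ y)) ≤
      Q.eval (inputSize bs' y) := by
    refine ⟨P.comp (.C bs.length * .X), fun y => ?_⟩
    rw [Polynomial.eval_comp, Polynomial.eval_mul, Polynomial.eval_C, Polynomial.eval_X]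
    exact eval_monotone P (inputSize_le_mul φ hφ y)
  refine ⟨Q, fun loc out base => prog (fun i => loc (g i)) out base,
    fun y => (hP _).trans (hQ y), fun loc out base y s hs => ?_⟩
  refine (hf _ out base (φ y) s ⟨fun i hi => hs.loc_lt _ (hg i hi).1, hs.out_lt,
    fun i hi => hs.loc_ne _ (hg i hi).1, fun i hi => ?_, hs.fresh, hs.out_nil⟩).mono (hQ y)
  obtain ⟨h', e⟩ := hg i hi
  rw [hs.get _ h', e]

theorem Comp.lift {f : α → List A} (h : Comp bs f) (φ : β → α) (cs : List (β → List A)) :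
    Comp (cs ++ bs.map fun b y => b (φ y)) fun y => f (φ y) :=
  h.weaken φ fun b hb => List.mem_append_right _ (List.mem_map.2 ⟨b, hb, rfl⟩)

/-- The store `s` with the words `A₀, …, A₄` on five stacks. -/
def frame (s : Store A) (base : ℕ) (A₀ A₁ A₂ A₃ A₄ : List A) : Store A :=
  update (update (update (update (update s base A₀) (base + 1) A₁) (base + 2) A₂) (base + 3) A₃)
    (base + 4) A₄

section frame

variable (s : Store A) (base : ℕ) (A₀ A₁ A₂ A₃ A₄ l : List A)

@[simp] theorem frame_get₀ : frame s base A₀ A₁ A₂ A₃ A₄ base = A₀ := by simp [frame]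
@[simp] theorem frame_get₁ : frame s base A₀ A₁ A₂ A₃ A₄ (base + 1) = A₁ := by simp [frame]
@[simp] theorem frame_get₂ : frame s base A₀ A₁ A₂ A₃ A₄ (base + 2) = A₂ := by simp [frame]
@[simp] theorem frame_get₃ : frame s base A₀ A₁ A₂ A₃ A₄ (base + 3) = A₃ := by simp [frame]
@[simp] theorem frame_get₄ : frame s base A₀ A₁ A₂ A₃ A₄ (base + 4) = A₄ := by simp [frame]

theorem frame_get_lt {j : ℕ} (h : j < base) : frame s base A₀ A₁ A₂ A₃ A₄ j = s j := by
  simp [frame, h.ne, show j ≠ base + 1 by omega, show j ≠ base + 2 by omega,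
    show j ≠ base + 3 by omega, show j ≠ base + 4 by omega]

theorem frame_get_ge {j : ℕ} (h : base + 5 ≤ j) : frame s base A₀ A₁ A₂ A₃ A₄ j = s j := by
  simp [frame, show j ≠ base by omega, show j ≠ base + 1 by omega, show j ≠ base + 2 by omega,
    show j ≠ base + 3 by omega, show j ≠ base + 4 by omega]

theorem frame_cases (j : ℕ) : j = base ∨ j = base + 1 ∨ j = base + 2 ∨ j = base + 3 ∨
    j = base + 4 ∨ (j ≠ base ∧ j ≠ base + 1 ∧ j ≠ base + 2 ∧ j ≠ base + 3 ∧ j ≠ base + 4) := by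
  omega

@[simp] theorem update_frame₀ :
    update (frame s base A₀ A₁ A₂ A₃ A₄) base l = frame s base l A₁ A₂ A₃ A₄ := by
  funext j
  rcases frame_cases base j with h | h | h | h | h | h
  iterate 5 subst h; simp [frame]
  simp [frame, h]

@[simp] theorem update_frame₁ :
    update (frame s base A₀ A₁ A₂ A₃ A₄) (base + 1) l = frame s base A₀ l A₂ A₃ A₄ := by
  funext j
  rcases frame_cases base j with h | h | h | h | h | h
  iterate 5 subst h; simp [frame]
  simp [frame, h]

@[simp] theorem update_frame₂ :
    update (frame s base A₀ A₁ A₂ A₃ A₄) (base + 2) l = frame s base A₀ A₁ l A₃ A₄ := by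
  funext j
  rcases frame_cases base j with h | h | h | h | h | h
  iterate 5 subst h; simp [frame]
  simp [frame, h]

@[simp] theorem update_frame₃ :
    update (frame s base A₀ A₁ A₂ A₃ A₄) (base + 3) l = frame s base A₀ A₁ A₂ l A₄ := by
  funext j
  rcases frame_cases base j with h | h | h | h | h | h
  iterate 5 subst h; simp [frame]
  simp [frame, h]

@[simp] theorem update_frame₄ :
    update (frame s base A₀ A₁ A₂ A₃ A₄) (base + 4) l = frame s base A₀ A₁ A₂ A₃ l := by
  simp [frame]

theorem frame_nil (h : ∀ j, base ≤ j → s j = []) : frame s base [] [] [] [] [] = s := by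
  funext j
  rcases frame_cases base j with h' | h' | h' | h' | h' | h'
  iterate 5 subst h'; simp [frame, h]
  simp [frame, h']

end frame

/-- Structural recursion on words, under a polynomial bound on the length of the values. -/
theorem Comp.recursion [Finite A] {x g : α → List A} {h : A → List A × List A × α → List A}
    {F : List A → α → List A} (hx : Comp bs x) (hg : Comp bs g)
    (hh : ∀ c, Comp (Prod.fst :: (fun y => y.2.1) :: bs.map fun b y => b y.2.2) (h c))
    (nil : ∀ a, F [] a = g a) (cons : ∀ c l a, F (c :: l) a = h c (l, F l a, a))
    (hF : ∃ P : Polynomial ℕ, ∀ l a, (F l a).length ≤ P.eval (l.length + inputSize bs a)) :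
    Comp bs fun a => F (x a) a := by
  classical
  have := Fintype.ofFinite A
  obtain ⟨Px, px, hPx, hx⟩ := hx
  obtain ⟨Pg, pg, -, hg⟩ := hg
  choose Ph ph hPh hh using hh
  obtain ⟨PF, hF⟩ := hF
  obtain ⟨Pb, hPb⟩ : ∃ Pb : Polynomial ℕ, ∀ a m, m.length ≤ (x a).length →
      (F m a).length ≤ Pb.eval (inputSize bs a) := by
    refine ⟨PF.comp (Px + .X), fun a m hm => (hF m a).trans ?_⟩
    rw [Polynomial.eval_comp, Polynomial.eval_add, Polynomial.eval_X]
    exact eval_monotone PF (Nat.add_le_add_right (hm.trans (hPx a)) _)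
  set bs' : List (List A × List A × α → List A) :=
    Prod.fst :: (fun y => y.2.1) :: bs.map fun b y => b y.2.2 with hbs'
  have hlen' : bs'.length = bs.length + 2 := by simp [hbs']
  -- The inputs of `h c` are the tail, the previous value and the old inputs, of total length at
  -- most `Px + Pb + X`. The sum over the finite alphabet makes the bound independent of `c`.
  obtain ⟨Pt, hPt⟩ : ∃ Pt : Polynomial ℕ, ∀ a m c, m.length ≤ (x a).length →
      (Ph c).eval (inputSize bs' (m, F m a, a)) ≤ Pt.eval (inputSize bs a) := by
    refine ⟨(∑ c, Ph c).comp (Px + Pb + .X), fun a m c hm => ?_⟩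
    have hsz : inputSize bs' (m, F m a, a) ≤
        Px.eval (inputSize bs a) + Pb.eval (inputSize bs a) + inputSize bs a := by
      have h₁ := hPb a m hm
      have h₂ := hPx a
      simp only [hbs', inputSize_cons, inputSize_map bs (fun y : List A × List A × α => y.2.2)]
      omega
    refine (eval_monotone (Ph c) hsz).trans ?_
    rw [Polynomial.eval_comp, Polynomial.eval_add, Polynomial.eval_add, Polynomial.eval_X,
      Polynomial.eval_finsetSum]
    exact Finset.single_le_sum (f := fun c => (Ph c).eval
      (Px.eval (inputSize bs a) + Pb.eval (inputSize bs a) + inputSize bs a))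
      (fun _ _ => Nat.zero_le _) (Finset.mem_univ c)
  -- The summands of `P₁` and `P₂` are the costs of the successive pieces of the loop body and of
  -- the whole program below.
  let P₁ : Polynomial ℕ := Pt + (Pb * 2 + 1) + (Pt * 2 + 1) + (Pt * 2 + 1) + 1
  let P₂ : Polynomial ℕ := Px + (Px * 2 + 1) + Pg + (Px * (P₁ + 1) + 1) + (Px * 2 + 1) +
    (Pb * 2 + 1) + (Pb * 2 + 1)
  -- Counted from `base`, stack 0 holds the current value `F m a`, stack 1 receives the next value,
  -- stack 2 holds the letters still to be processed, stack 3 the tail `m` already processed, and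
  -- stack 4 serves for reversals.
  let loc' : (ℕ → ℕ) → ℕ → ℕ → ℕ := fun loc base i =>
    match i with | 0 => base + 3 | 1 => base | i + 2 => loc i
  let body : (ℕ → ℕ) → ℕ → A → Prog A := fun loc base c => .seq (.seq (.seq (.seq
    (ph c (loc' loc base) (base + 1) (base + 5)) (.clear base)) (.moveRev (base + 1) (base + 4)))
    (.moveRev (base + 4) base)) (.push (base + 3) c)
  -- The recursion unfolds from the end of the word, so `x a` is reversed on its way to stack 2
  -- before the loop pops its letters.
  refine ⟨P₂, fun loc out base =>
      .seq (.seq (.seq (.seq (.seq (.seq (px loc (base + 4) (base + 5))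
        (.moveRev (base + 4) (base + 2))) (pg loc base (base + 5)))
        (.loop (base + 2) (body loc base))) (.clear (base + 3))) (.moveRev base (base + 4)))
        (.moveRev (base + 4) out),
      fun a => ?_, fun loc out base a s hs => ?_⟩
  · have := hPb a _ le_rfl
    simp only [P₂, Polynomial.eval_add, Polynomial.eval_mul, Polynomial.eval_ofNat,
      Polynomial.eval_one]
    omega
  have hready : ∀ (j : ℕ), j < 5 → ∀ A₀ A₁ A₂ A₃ A₄ : List A,
      frame s base A₀ A₁ A₂ A₃ A₄ (base + j) = [] →
      Ready bs a loc (base + j) (base + 5) (frame s base A₀ A₁ A₂ A₃ A₄) := by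
    intro j hj A₀ A₁ A₂ A₃ A₄ e
    refine ⟨fun i hi => ?_, by omega, fun i hi => ?_, fun i hi => ?_, fun i hi => ?_, e⟩
    · have := hs.loc_lt i hi
      omega
    · have := hs.loc_lt i hi
      omega
    · rw [frame_get_lt _ _ _ _ _ _ _ (hs.loc_lt i hi), hs.get]
    · rw [frame_get_ge _ _ _ _ _ _ _ hi, hs.fresh _ (by omega)]
  have hs₀ : frame s base [] [] [] [] [] = s := frame_nil _ _ hs.fresh
  have r₁ : Runs (px loc (base + 4) (base + 5)) s (frame s base [] [] [] [] (x a)) (Px.eval (inputSize bs a)) := by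
    have := hx loc _ _ a _ (hready 4 (by omega) [] [] [] [] [] (by simp))
    rwa [update_frame₄, hs₀] at this
  have r₂ : Runs (.moveRev (base + 4) (base + 2)) (frame s base [] [] [] [] (x a))
      (frame s base [] [] (x a).reverse [] []) (Px.eval (inputSize bs a) * 2 + 1) := by
    have := Runs.moveRev (show base + 4 ≠ base + 2 by omega) (frame s base [] [] [] [] (x a))
    simp only [frame_get₄, frame_get₂, update_frame₂, update_frame₄, List.append_nil] at this
    have hPx := hPx a
    exact this.mono (by omega)
  have r₃ : Runs (pg loc base (base + 5)) (frame s base [] [] (x a).reverse [] [])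
      (frame s base (F [] a) [] (x a).reverse [] []) (Pg.eval (inputSize bs a)) := by
    have := hg loc _ _ a _ (hready 0 (by omega) [] [] (x a).reverse [] [] (by simp))
    rw [Nat.add_zero, update_frame₀] at this
    rwa [nil]
  have r₄ : Runs (.loop (base + 2) (body loc base)) (frame s base (F [] a) [] (x a).reverse [] [])
      (frame s base (F (x a) a) [] [] (x a) []) (Px.eval (inputSize bs a) * (P₁.eval (inputSize bs a) + 1) + 1) := by
    have := Runs.loop (k := base + 2) (f := body loc base)
      (fun m l => frame s base (F m a) [] l m []) (T := P₁.eval (inputSize bs a)) (by simp) (x a).reverse [] ?_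
    · simp only [List.reverse_reverse, List.append_nil, List.length_reverse] at this
      exact this.mono (by gcongr; exact hPx a)
    intro c m l e
    have hm : m.length + 1 ≤ (x a).length := by
      have := congrArg List.length e
      simp at this
      omega
    have hFc : F (c :: m) a = h c (m, F m a, a) := cons c m a
    have hF₀ := hPb a m (by omega)
    have hF₁ : (F (c :: m) a).length ≤ Pt.eval (inputSize bs a) := by
      rw [hFc]
      exact (hPh c _).trans (hPt a m c (by omega))
    have q₁ : Runs (ph c (loc' loc base) (base + 1) (base + 5)) (frame s base (F m a) [] l m [])
        (frame s base (F m a) (F (c :: m) a) l m []) (Pt.eval (inputSize bs a)) := by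
      have := hh c (loc' loc base) (base + 1) (base + 5) (m, F m a, a)
        (frame s base (F m a) [] l m []) ⟨?_, by omega, ?_, ?_, ?_, by simp⟩
      · rw [update_frame₁, ← hFc] at this
        exact this.mono (hPt a m c (by omega))
      · rintro (_ | _ | i) hi
        · simp [loc']
        · simp [loc']
        · have := hs.loc_lt i (by omega)
          simp only [loc']
          omega
      · rintro (_ | _ | i) hi
        · simp [loc']
        · simp [loc']
        · have := hs.loc_lt i (by omega)
          simp only [loc']
          omega
      · rintro (_ | _ | i) hi
        · simp [loc', bs']
        · simp [loc', bs']
        · have hi' : i < bs.length := by omega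
          simp [loc', bs', frame_get_lt _ _ _ _ _ _ _ (hs.loc_lt i hi'), hs.get i hi']
      · intro i hi
        rw [frame_get_ge _ _ _ _ _ _ _ hi, hs.fresh _ (by omega)]
    have q₂ := Runs.clear base (frame s base (F m a) (F (c :: m) a) l m [])
    have q₃ := Runs.moveRev (show base + 1 ≠ base + 4 by omega)
      (frame s base [] (F (c :: m) a) l m [])
    have q₄ := Runs.moveRev (show base + 4 ≠ base by omega)
      (frame s base [] [] l m (F (c :: m) a).reverse)
    have q₅ := Runs.push (base + 3) c (frame s base (F (c :: m) a) [] l m [])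
    simp only [frame_get₀, frame_get₁, frame_get₃, frame_get₄, update_frame₀, update_frame₁,
      update_frame₃, update_frame₄, List.append_nil, List.reverse_reverse] at q₂ q₃ q₄ q₅
    rw [update_frame₂]
    refine ((((q₁.seq q₂).seq q₃).seq q₄).seq q₅).mono ?_
    simp only [P₁, Polynomial.eval_add, Polynomial.eval_mul, Polynomial.eval_ofNat,
      Polynomial.eval_one, List.length_reverse]
    omega
  have r₅ := Runs.clear (base + 3) (frame s base (F (x a) a) [] [] (x a) [])
  have r₆ := Runs.moveRev (show base ≠ base + 4 by omega) (frame s base (F (x a) a) [] [] [] [])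
  have hout : out < base := hs.out_lt
  have r₇ := Runs.moveRev (show base + 4 ≠ out by omega)
    (frame s base [] [] [] [] (F (x a) a).reverse)
  simp only [frame_get₀, frame_get₃, frame_get₄, update_frame₀, update_frame₃, update_frame₄,
    List.append_nil, List.reverse_reverse, frame_get_lt _ _ _ _ _ _ _ hout, hs.out_nil]
    at r₅ r₆ r₇
  rw [hs₀] at r₇
  refine ((((((r₁.seq r₂).seq r₃).seq r₄).seq r₅).seq r₆).seq r₇).mono ?_
  have h₁ := hPx a
  have h₂ := hPb a _ le_rfl
  simp only [P₂, Polynomial.eval_add, Polynomial.eval_mul, Polynomial.eval_ofNat,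
    Polynomial.eval_one, List.length_reverse]
  omega

end Comp

/-! ### From programs to Turing machines -/

section Machine

variable {I A : Type} {N : ℕ}

/-- The statement that moves one symbol from the input stack to the work stack `0`. -/
def readStmt [Inhabited A] {Λ : Type} (e : I → A) (again done : Λ) :
    TM2.Stmt (StackAlphabet I A N) Λ (Option A) :=
  .pop none (fun _ (o : Option I) => o.map e) <|
    .branch Option.isSome
      (.push (some (Fin.ofNat (N + 1) 0)) (fun v => v.getD default) <| .goto fun _ => again)
      (.goto fun _ => done)

theorem readStmt_stepsTo [Inhabited A] {Λ : Type} {e : I → A} {again done : Λ}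
    {M : Λ → TM2.Stmt (StackAlphabet I A N) Λ (Option A)} (hM : M again = readStmt e again done)
    (l : List I) (m : List A) (v : Option A) (S : ∀ k, List (StackAlphabet I A N k))
    (hS : S none = l) (hS' : ∀ j : Fin (N + 1), S (some j) = if (j : ℕ) = 0 then m else []) :
    ∃ v' S', Holds S' (update (fun _ => []) 0 ((l.map e).reverse ++ m)) ∧
      StepsTo (TM2.step M) (l.length + 1) ⟨some again, v, S⟩ ⟨some done, v', S'⟩ := by
  induction l generalizing m v S with
  | nil =>
    refine ⟨none, S, ⟨hS, fun j => ?_⟩, .single ?_⟩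
    · rw [hS' j]
      by_cases hj : (j : ℕ) = 0
      · rw [if_pos hj, hj]
        simp only [List.map_nil, List.reverse_nil, List.nil_append, update_self]
        rfl
      · rw [if_neg hj, update_of_ne hj]
    · have e' : update S none (S none).tail = S := by
        refine Function.update_eq_self_iff.2 ?_
        rw [hS]
        rfl
      refine congrArg some ((congrArg (fun q => TM2.stepAux q v S) hM).trans ?_)
      refine (congrArg (TM2.stepAux (.branch _ _ _) _) e').trans ?_
      rw [hS]
      rfl
  | cons c l ih =>
    have hn : S (some (Fin.ofNat (N + 1) 0)) = m :=
      (hS' _).trans (if_pos (Nat.zero_mod _))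
    obtain ⟨v', S', h₁, h₂⟩ := ih (e c :: m) (some (e c))
      (update (update S none l) (some (Fin.ofNat (N + 1) 0)) (e c :: m : List A))
      ((Function.update_of_ne (β := fun k => List (StackAlphabet I A N k)) (by simp) _ _).trans
        (Function.update_self (β := fun k => List (StackAlphabet I A N k)) _ _ _))
      (fun j => by
        by_cases hj : (j : ℕ) = 0
        · obtain rfl : j = Fin.ofNat (N + 1) 0 := Fin.ext (by simp [hj])
          rw [if_pos hj]
          exact Function.update_self (β := fun k => List (StackAlphabet I A N k)) _ _ _
        · rw [if_neg hj]
          have : (some j : Option (Fin (N + 1))) ≠ some (Fin.ofNat (N + 1) 0) := by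
            intro h
            rw [Option.some.injEq] at h
            exact hj (by simp [h])
          refine (Function.update_of_ne (β := fun k => List (StackAlphabet I A N k)) this _ _).trans
            ?_
          refine (Function.update_of_ne (β := fun k => List (StackAlphabet I A N k)) (by simp) _
            _).trans ?_
          rw [hS', if_neg hj])
    refine ⟨v', S', by simpa using h₁, ?_⟩
    rw [show (c :: l).length + 1 = 1 + (l.length + 1) by rw [List.length_cons, add_comm]]
    refine StepsTo.trans (.single ?_) h₂
    refine congrArg some ((congrArg (fun q => TM2.stepAux q v S) hM).trans ?_)
    have e' : update S none (S none).tail = update S none l := by rw [hS]; rfl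
    refine (congrArg (TM2.stepAux (.branch _ _ _) _) e').trans ?_
    rw [hS, ← hn]
    rfl

/-- The machine that reads the input, runs the program `p` and stops. -/
noncomputable def machine [Finite I] [Finite A] [Inhabited A] (e : I → A) (p : Prog A) (N : ℕ)
    (out : Fin (N + 1)) : FinTM2 :=
  letI := Fintype.ofFinite A
  letI := Fintype.ofFinite I
  letI : Finite p.Lab := p.finite_lab
  letI : Fintype p.Lab := Fintype.ofFinite _
  { K := Option (Fin (N + 1))
    k₀ := none
    k₁ := some out
    Γ := StackAlphabet I A N
    Λ := Option (Option p.Lab)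
    main := none
    σ := Option A
    initialState := none
    Γk₀Fin := ‹Fintype I›
    m := fun l => match l with
      | none => readStmt e none (some (some p.entry))
      | some none => .load (fun _ => none) .halt
      | some (some l) => p.code (fun l => some (some l)) (some none) l }

/-- The term `+ 2` counts the step that finds the input exhausted and the halting step. A halting
configuration must carry the initial internal state, hence the final `load`, and all its stacks
except the output stack must be empty, hence the form required of the final store. -/
theorem machine_outputs [Finite I] [Finite A] [Inhabited A] (e : I → A) {p : Prog A} {N : ℕ}
    (hp : p.Below N) (out : Fin (N + 1)) (l : List I) (l' : List A) {T : ℕ}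
    (h : Runs p (update (fun _ => []) 0 (l.map e).reverse) (update (fun _ => []) (out : ℕ) l') T) :
    Nonempty (TM2OutputsInTime (machine e p N out) l (some l') (l.length + T + 2)) := by
  obtain ⟨t, ht, h⟩ := h
  obtain ⟨v₁, S₁, hS₁, e₁⟩ := readStmt_stepsTo (M := (machine e p N out).m) (e := e)
    (again := (none : Option (Option p.Lab))) (done := some (some p.entry)) rfl l [] none
    (initList (machine e p N out) l).stk rfl (fun j => by
      rw [ite_self]
      rfl)
  rw [List.append_nil] at hS₁
  obtain ⟨v₂, S₂, hS₂, e₂⟩ := h.stepsTo (M := (machine e p N out).m) hp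
    (fun l => some (some l)) (some none) (fun _ => rfl) v₁ S₁ hS₁
  have e₃ : StepsTo (TM2.step (machine e p N out).m) 1 ⟨some (some none), v₂, S₂⟩
      (haltList (machine e p N out) l') := by
    refine .single (congrArg some ?_)
    refine congrArg (TM2.Cfg.mk none (none : Option A)) ?_
    funext k
    match k with
    | none => exact hS₂.1
    | some j =>
      refine (hS₂.2 j).trans ?_
      by_cases hj : j = out
      · subst hj
        rw [update_self]
        symm
        exact dif_pos rfl
      · rw [update_of_ne (fun h => hj (Fin.ext h))]
        symm
        exact dif_neg fun h => hj (Option.some.inj h)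
  exact ⟨⟨⟨_, (e₁.trans e₂).trans e₃⟩, show l.length + 1 + t + 1 ≤ l.length + T + 2 by omega⟩⟩

theorem Comp.exists_machine {α : Type} [Finite I] [Finite A] [Inhabited A] {v : α → List I}
    {e : I → A} {f : α → List A} (h : Comp [fun a => (v a).map e] f) :
    ∃ M : TM2ComputableInPolyTime v (id : List A → List A) f, ∀ i, Finite (M.tm.Γ i) := by
  obtain ⟨P, prog, -, hf⟩ := h
  -- Reading leaves the input reversed on stack 0, and moving it to stack 1 restores the order.
  -- Stack 1 is cleared at the end because only the output stack 2 may remain nonempty.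
  let p : Prog A := .seq (.seq (.moveRev 0 1) (prog (fun _ => 1) 2 3)) (.clear 1)
  obtain ⟨N, hN⟩ := p.exists_below
  have hN' : p.Below (N + 2) := hN.mono (by omega)
  -- With `n` input letters, reading and halting cost `n + 2`, and the initial reversal and the
  -- final clearing cost `2 * n + 1` each.
  have key : ∀ a, Nonempty (TM2OutputsInTime (machine e p (N + 2) (Fin.ofNat _ 2)) (v a)
      (some (f a)) ((.X * 5 + P + 4 : Polynomial ℕ).eval (v a).length)) := by
    intro a
    have r₁ := Runs.moveRev (show (0 : ℕ) ≠ 1 by omega)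
      (update (fun _ => []) 0 ((v a).map e).reverse)
    have r₂ := hf (fun _ => 1) 2 3 a (update (fun _ => []) 1 ((v a).map e))
      ⟨by simp, by simp, by simp, by simp, by
        intro j hj
        rw [update_of_ne (by omega)], by simp⟩
    have r₃ := Runs.clear 1 (update (update (fun _ => []) 1 ((v a).map e)) 2 (f a))
    have e₁ : update (update (update (fun _ => []) 0 ((v a).map e).reverse) 0 []) 1
        ((update (fun _ => []) 0 ((v a).map e).reverse 0).reverse ++
        update (fun _ => []) 0 ((v a).map e).reverse 1) =
        update (fun _ => []) 1 ((v a).map e) := by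
      funext j
      simp [update_apply]
    have e₂ : update (update (update (fun _ => []) 1 ((v a).map e)) 2 (f a)) 1 [] =
        update (fun _ => []) 2 (f a) := by
      funext j
      simp only [update_apply]
      split_ifs <;> simp_all
    rw [e₁] at r₁
    rw [e₂] at r₃
    have hout : ((Fin.ofNat (N + 2 + 1) 2 : Fin (N + 2 + 1)) : ℕ) = 2 :=
      Nat.mod_eq_of_lt (by omega)
    obtain ⟨h⟩ := machine_outputs e hN' (Fin.ofNat _ 2) (v a) (f a) (by
      rw [hout]
      exact (r₁.seq r₂).seq r₃)
    refine ⟨⟨h.toEvalsTo, h.steps_le_m.trans ?_⟩⟩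
    simp [inputSize]
    omega
  refine ⟨{ tm := machine e p (N + 2) (Fin.ofNat _ 2)
            inputAlphabet := Equiv.refl I
            outputAlphabet := Equiv.refl A
            time := .X * 5 + P + 4
            outputsFun := fun a => ?_ }, fun i => ?_⟩
  · have h := (key a).some
    have e₁ : (v a).map (Equiv.refl I).invFun = v a := List.map_id _
    have e₂ : (id (f a)).map (Equiv.refl A).invFun = f a := List.map_id _
    rw [← e₁, ← e₂] at h
    have e₃ : ((v a).map (Equiv.refl I).invFun).length = (v a).length := by simp
    rw [e₃] at h
    exact h
  · match i with
    | none => exact ‹Finite I›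
    | some _ => exact ‹Finite A›

end Machine

end Machines

/-! ### Closure properties of polynomial time functions -/

section Combinators

variable {A α β : Type} {bs : List (α → List A)}

theorem Comp.tl {f : α → List A} (h : Comp bs f) :
    Comp (Prod.fst :: bs.map fun b (y : List A × α) => b y.2) fun y => f y.2 :=
  h.lift (fun y : List A × α => y.2) [Prod.fst]

theorem Comp.fst : Comp (Prod.fst :: bs.map fun b (y : List A × α) => b y.2) Prod.fst :=
  .of_mem List.mem_cons_self

theorem Comp.fst₃ : Comp (Prod.fst :: (fun y => y.2.1) ::
    bs.map fun b (y : List A × List A × α) => b y.2.2) fun y => y.1 :=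
  .of_mem List.mem_cons_self

theorem Comp.snd₃ : Comp (Prod.fst :: (fun y => y.2.1) ::
    bs.map fun b (y : List A × List A × α) => b y.2.2) fun y => y.2.1 :=
  .of_mem (List.mem_cons_of_mem _ List.mem_cons_self)

/-- A function of the head and the tail of a word, in the context of a recursion. -/
theorem Comp.fst_tl {h : List A × α → List A}
    (hh : Comp (Prod.fst :: bs.map fun b (y : List A × α) => b y.2) h) :
    Comp (Prod.fst :: (fun y => y.2.1) :: bs.map fun b (y : List A × List A × α) => b y.2.2)
      fun y => h (y.1, y.2.2) := by
  refine hh.weaken (fun y : List A × List A × α => (y.1, y.2.2)) fun b hb => ?_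
  rcases List.mem_cons.1 hb with rfl | hb
  · exact List.mem_cons_self
  · obtain ⟨d, hd, rfl⟩ := List.mem_map.1 hb
    exact List.mem_cons_of_mem _ (List.mem_cons_of_mem _ (List.mem_map.2 ⟨d, hd, rfl⟩))

theorem Comp.congr {f g : α → List A} (h : Comp bs f) (e : ∀ a, f a = g a) : Comp bs g :=
  (funext e : f = g) ▸ h

theorem Comp.const (l : List A) : Comp bs fun _ => l := by
  induction l with
  | nil => exact .nil
  | cons c l ih => exact ih.cons c

/-- Delete the first letter of `l.tail` if it is `c`; otherwise return the empty word. -/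
def strip [DecidableEq A] [Inhabited A] (c : A) (l : List A) : List A :=
  if l.tail.head? = some c then default :: l.tail.tail else []

/-- The dummy letter in front keeps the word nonempty as long as the match succeeds, even when
nothing of `y` is left; the empty word means failure and is never left again. Folding over
`x.reverse` from the right consumes `x` from its first letter. This turns the prefix test into a
structural recursion with words as values. -/
theorem foldr_strip_reverse [DecidableEq A] [Inhabited A] (x y : List A) :
    x.reverse.foldr strip (default :: y) ≠ [] ↔ x <+: y := by
  have h : ∀ l : List A, l.foldr strip [] = [] := by
    intro l
    induction l with
    | nil => rfl
    | cons c l ih => simp [ih, strip]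
  induction x generalizing y with
  | nil => simp
  | cons c x ih =>
    rw [List.reverse_cons, List.foldr_append]
    rcases y with - | ⟨d, y⟩
    · simp [strip, h]
    · by_cases hd : d = c
      · subst hd
        simpa [strip] using ih y
      · simp [strip, hd, h, Ne.symm hd]

variable [Finite A]

/-- Structural recursion on words, where one step increases the length at most polynomially. -/
theorem Comp.recursion_of_le {x g : α → List A} {F : List A → α → List A}
    (h : A → List A × List A × α → List A) (hx : Comp bs x) (hg : Comp bs g)
    (hh : ∀ c, Comp (Prod.fst :: (fun y => y.2.1) :: bs.map fun b y => b y.2.2) (h c))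
    (nil : ∀ a, F [] a = g a) (cons : ∀ c l a, F (c :: l) a = h c (l, F l a, a))
    (hF : ∃ P : Polynomial ℕ, ∀ c l a,
      (F (c :: l) a).length ≤ (F l a).length + P.eval (l.length + inputSize bs a)) :
    Comp bs fun a => F (x a) a := by
  obtain ⟨P, hF⟩ := hF
  obtain ⟨Pg, hPg⟩ := hg.length_le
  -- The initial value is bounded by `Pg`, and each of the `l.length` increments by the value of `P`
  -- at the full length, since `P` is monotone.
  refine .recursion hx hg hh nil cons ⟨Pg + .X * P, fun l a => ?_⟩
  have key : (F l a).length ≤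
      Pg.eval (inputSize bs a) + l.length * P.eval (l.length + inputSize bs a) := by
    induction l with
    | nil => simpa [nil] using hPg a
    | cons c l ih =>
      refine (hF c l a).trans ?_
      have h₁ : P.eval (l.length + inputSize bs a) ≤
          P.eval ((c :: l).length + inputSize bs a) := eval_monotone P (by simp)
      have h₂ := Nat.mul_le_mul_left l.length h₁
      rw [List.length_cons] at h₁ h₂ ⊢
      rw [add_mul, one_mul]
      omega
  refine key.trans ?_
  rw [Polynomial.eval_add, Polynomial.eval_mul, Polynomial.eval_X]
  have h₁ : Pg.eval (inputSize bs a) ≤ Pg.eval (l.length + inputSize bs a) :=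
    eval_monotone Pg (by omega)
  have h₂ : l.length * P.eval (l.length + inputSize bs a) ≤
      (l.length + inputSize bs a) * P.eval (l.length + inputSize bs a) :=
    Nat.mul_le_mul_right _ (by omega)
  omega

/-- Case distinction on whether a word is empty, with access to head and tail. -/
theorem Comp.cases {x g : α → List A} {F : List A → α → List A} (h : A → List A × α → List A)
    (hx : Comp bs x) (hg : Comp bs g) (hh : ∀ c, Comp (Prod.fst :: bs.map fun b y => b y.2) (h c))
    (nil : ∀ a, F [] a = g a) (cons : ∀ c l a, F (c :: l) a = h c (l, a)) :
    Comp bs fun a => F (x a) a := by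
  have := Fintype.ofFinite A
  choose P hP using fun c => (hh c).length_le
  refine .recursion_of_le (fun c y => h c (y.1, y.2.2)) hx hg (fun c => (hh c).fst_tl) nil cons
    ⟨∑ c, P c, fun c l a => ?_⟩
  rw [cons, Polynomial.eval_finsetSum]
  refine (hP c _).trans ?_
  have e : inputSize (Prod.fst :: bs.map fun b (y : List A × α) => b y.2) (l, a) =
      l.length + inputSize bs a := by
    simp only [inputSize_cons, inputSize_map bs (fun y : List A × α => y.2)]
  rw [e]
  have := Finset.single_le_sum (f := fun c => (P c).eval (l.length + inputSize bs a))
    (fun _ _ => Nat.zero_le _) (Finset.mem_univ c)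
  exact this.trans (Nat.le_add_left _ _)

theorem Comp.append {f g : α → List A} (hf : Comp bs f) (hg : Comp bs g) :
    Comp bs fun a => f a ++ g a :=
  .recursion_of_le (F := fun l a => l ++ g a) (fun c y => c :: y.2.1) hf hg
    (fun c => Comp.snd₃.cons c) (fun _ => rfl) (fun _ _ _ => rfl) ⟨1, fun c l a => by simp⟩

theorem Comp.tail {f : α → List A} (hf : Comp bs f) : Comp bs fun a => (f a).tail :=
  .cases (F := fun l _ => l.tail) (fun _ y => y.1) hf .nil (fun _ => .fst) (fun _ => rfl)
    fun _ _ _ => rfl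

theorem Comp.reverse {f : α → List A} (hf : Comp bs f) : Comp bs fun a => (f a).reverse :=
  .recursion_of_le (F := fun l _ => l.reverse) (fun c y => y.2.1 ++ [c]) hf .nil
    (fun c => Comp.snd₃.append (.const [c])) (fun _ => rfl) (fun _ _ _ => List.reverse_cons)
    ⟨1, fun c l a => by simp⟩

theorem Comp.replicate {f : α → List A} (c : A) (hf : Comp bs f) :
    Comp bs fun a => List.replicate (f a).length c :=
  .recursion_of_le (F := fun l _ => List.replicate l.length c) (fun _ y => c :: y.2.1) hf .nil
    (fun _ => Comp.snd₃.cons c) (fun _ => rfl) (fun _ _ _ => rfl) ⟨1, fun c l a => by simp⟩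

theorem Comp.takeWhile {f : α → List A} (p : A → Bool) (hf : Comp bs f) :
    Comp bs fun a => (f a).takeWhile p :=
  .recursion_of_le (F := fun l _ => l.takeWhile p) (fun c y => if p c then c :: y.2.1 else []) hf
    .nil (fun c => by split_ifs; exacts [Comp.snd₃.cons c, .nil]) (fun _ => rfl)
    (fun c l a => by rw [List.takeWhile_cons])
    ⟨1, fun c l a => by rw [List.takeWhile_cons]; split_ifs <;> simp⟩

theorem Comp.dropWhile {f : α → List A} (p : A → Bool) (hf : Comp bs f) :
    Comp bs fun a => (f a).dropWhile p :=
  .recursion_of_le (F := fun l _ => l.dropWhile p) (fun c y => if p c then y.2.1 else c :: y.1) hf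
    .nil (fun c => by split_ifs; exacts [Comp.snd₃, Comp.fst₃.cons c]) (fun _ => rfl)
    (fun c l a => by rw [List.dropWhile_cons])
    ⟨.X + 1, fun c l a => by
      rw [List.dropWhile_cons]
      split_ifs <;> simp
      omega⟩

end Combinators

/-! ### Polynomial time predicates -/

section CompPred

variable {A α : Type} {bs : List (α → List A)} [Inhabited A]

open Classical in
/-- The truth value of `p a` can be computed in polynomial time. -/
def CompPred (bs : List (α → List A)) (p : α → Prop) : Prop :=
  Comp bs fun a => if p a then [default] else []

theorem CompPred.intro {p : α → Prop} [DecidablePred p]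
    (h : Comp bs fun a => if p a then [default] else []) : CompPred bs p :=
  h.congr fun a => by congr

theorem CompPred.const (p : Prop) : CompPred bs fun _ => p := by
  by_cases h : p
  · exact (Comp.const [default]).congr fun a => by simp [h]
  · exact (Comp.const []).congr fun a => by simp [h]

variable [Finite A]

theorem Comp.ite {p : α → Prop} [DecidablePred p] {f g : α → List A} (hp : CompPred bs p)
    (hf : Comp bs f) (hg : Comp bs g) : Comp bs fun a => if p a then f a else g a := by
  classical
  have := Comp.cases (F := fun l a => if l = [] then g a else f a) (fun _ y => f y.2) hp hg
    (fun _ => hf.tl) (fun _ => by simp) (fun _ _ _ => by simp)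
  convert this using 2 with a
  by_cases h : p a <;> simp [h]

theorem CompPred.ofComp {f : α → List A} (hf : Comp bs f) : CompPred bs fun a => f a ≠ [] := by
  classical
  exact .intro <| .cases (F := fun l _ => if l ≠ [] then [default] else [])
    (fun _ _ => [default]) hf .nil (fun _ => .const _) (fun _ => by simp) fun _ _ _ => by simp

theorem CompPred.and {p q : α → Prop} (hp : CompPred bs p) (hq : CompPred bs q) :
    CompPred bs fun a => p a ∧ q a := by
  classical
  refine (Comp.ite hp hq .nil).congr fun a => ?_
  by_cases h : p a <;> simp [h]

theorem CompPred.not {p : α → Prop} (hp : CompPred bs p) : CompPred bs fun a => ¬ p a := by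
  classical
  refine (Comp.ite hp .nil (.const [default])).congr fun a => ?_
  by_cases h : p a <;> simp [h]

theorem CompPred.or {p q : α → Prop} (hp : CompPred bs p) (hq : CompPred bs q) :
    CompPred bs fun a => p a ∨ q a := by
  classical
  refine (Comp.ite hp (.const [default]) hq).congr fun a => ?_
  by_cases h : p a <;> simp [h]

theorem CompPred.head {f : α → List A} (c : A) (hf : Comp bs f) :
    CompPred bs fun a => (f a).head? = some c := by
  classical
  exact .intro <| .cases (F := fun l _ => if l.head? = some c then [default] else [])
    (fun d _ => if d = c then [default] else []) hf .nil (fun _ => .const _)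
    (fun _ => by simp) fun _ _ _ => by simp

/-- A predicate on words that is defined by structural recursion. -/
theorem CompPred.recursion {x : α → List A} {F : List A → α → Prop} (G : A → List A × α → Prop)
    (K : A → Prop) (hx : Comp bs x)
    (hG : ∀ c, CompPred (Prod.fst :: bs.map fun b (y : List A × α) => b y.2) (G c))
    (nil : ∀ a, ¬ F [] a) (cons : ∀ c l a, F (c :: l) a ↔ G c (l, a) ∨ (K c ∧ F l a)) :
    CompPred bs fun a => F (x a) a := by
  classical
  refine .intro <| .recursion_of_le (F := fun l a => if F l a then [default] else [])
    (fun c y => if G c (y.1, y.2.2) then [default] else if K c then y.2.1 else []) hx .nil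
    (fun c => Comp.ite (hG c).fst_tl (.const _)
      (.ite (.const _) .snd₃ .nil)) (fun a => by simp [nil]) (fun c l a => ?_) ⟨1, fun c l a => ?_⟩
  · by_cases h₁ : G c (l, a) <;> by_cases h₂ : K c <;> by_cases h₃ : F l a <;>
      simp [cons, h₁, h₂, h₃]
  · split_ifs <;> simp

theorem CompPred.isPrefix {f g : α → List A} (hf : Comp bs f) (hg : Comp bs g) :
    CompPred bs fun a => f a <+: g a := by
  classical
  have h : Comp bs fun a => (f a).reverse.foldr strip (default :: g a) :=
    .recursion_of_le (F := fun l a => l.foldr strip (default :: g a)) (fun c y => strip c y.2.1)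
      hf.reverse (hg.cons _)
      (fun c => .ite (.head c (.tail .snd₃)) (.cons _ (.tail (.tail .snd₃))) .nil)
      (fun _ => rfl) (fun _ _ _ => rfl) ⟨1, fun c l a => by
        rw [List.foldr_cons, strip]
        split_ifs <;> simp
        omega⟩
  simpa only [foldr_strip_reverse] using CompPred.ofComp h

/-- Structural recursion on words, where the values are concatenations of pieces. -/
theorem Comp.recursion_append {x g : α → List A} {F : List A → α → List A}
    (piece : A → List A × α → List A) (G : A → List A × α → Prop) [∀ c, DecidablePred (G c)]
    (hx : Comp bs x) (hg : Comp bs g)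
    (hpiece : ∀ c, Comp (Prod.fst :: bs.map fun b (y : List A × α) => b y.2) (piece c))
    (hG : ∀ c, CompPred (Prod.fst :: bs.map fun b (y : List A × α) => b y.2) (G c))
    (nil : ∀ a, F [] a = g a)
    (cons : ∀ c l a, F (c :: l) a = piece c (l, a) ++ if G c (l, a) then F l a else []) :
    Comp bs fun a => F (x a) a := by
  have := Fintype.ofFinite A
  choose P hP using fun c => (hpiece c).length_le
  refine .recursion_of_le
    (fun c y => piece c (y.1, y.2.2) ++ if G c (y.1, y.2.2) then y.2.1 else []) hx hg
    (fun c => (hpiece c).fst_tl.append (.ite (hG c).fst_tl .snd₃ .nil)) nil cons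
    ⟨∑ c, P c, fun c l a => ?_⟩
  have h := hP c (l, a)
  have e : inputSize (Prod.fst :: bs.map fun b (u : List A × α) => b u.2) (l, a) =
      l.length + inputSize bs a := by
    simp only [inputSize_cons, inputSize_map bs (fun u : List A × α => u.2)]
  rw [e] at h
  have h' := Finset.single_le_sum (f := fun c => (P c).eval (l.length + inputSize bs a))
    (fun _ _ => Nat.zero_le _) (Finset.mem_univ c)
  rw [cons, List.length_append, Polynomial.eval_finsetSum, add_comm]
  refine Nat.add_le_add ?_ (h.trans h')
  split_ifs <;> simp

end CompPred

/-- The choice of the letter is immaterial: it serves only as a mark that makes a word nonempty. -/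
instance : Inhabited GLetter := ⟨.star⟩

/-! ### The algorithms, as functions on words

A node of the graph is named by a suffix of the input word, at which a description of an equation
or of a decision begins. -/

/-- The part of a word before the first letter `c`. -/
def upTo (c : GLetter) (l : List GLetter) : List GLetter := l.takeWhile (· ≠ c)

/-- The part of a word after the first letter `c`. -/
def after (c : GLetter) (l : List GLetter) : List GLetter := (l.dropWhile (· ≠ c)).tail

/-- The name of the node at the suffix `l`. -/
def nameWord (l : List GLetter) : List GLetter := List.replicate (l.length + 1) (.sym .one)

/-- The word `ai=` at the beginning of `ai=δ)⋯`. -/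
def attrPart (l : List GLetter) : List GLetter := upTo (.sym .eq) l ++ [.sym .eq]

/-- The word `ai=δ)` at the beginning of `ai=δ)⋯`. -/
def eqnPart (l : List GLetter) : List GLetter := upTo (.sym .rpar) l ++ [.sym .rpar]

/-- The word for `i` in `ai=δ)⋯`. -/
def indexPart (l : List GLetter) : List GLetter := (upTo (.sym .eq) l).tail

/-- The word for `δ` in `ai=δ)⋯`. -/
def valuePart (l : List GLetter) : List GLetter := upTo (.sym .rpar) (after (.sym .eq) l)

/-- The equation `e` occurs in a word. -/
def OccursIn (e : List GLetter) : List GLetter → Prop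
  | [] => False
  | c :: l => (c = .sym .lpar ∧ e <+: l) ∨ OccursIn e l

/-- An equation with the same attribute as, but a different value than the equation at the
beginning of `cur` occurs in a word. -/
def OtherIn (cur : List GLetter) : List GLetter → Prop
  | [] => False
  | c :: l => (c = .sym .lpar ∧ attrPart cur <+: l ∧ ¬ eqnPart cur <+: l) ∨ OtherIn cur l

open Classical in
/-- The words for the edges that leave the node with the equation at the beginning of `cur`. The
edge labeled with the value of this equation enters `succ`, the others enter `fail`. -/
noncomputable def edgesWord (ext : Bool) (cur succ fail : List GLetter) :
    List GLetter → List GLetter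
  | [] => if ext then [.edge, .star, .colon] ++ fail else []
  -- An equation that occurs again later in the word is passed over, so that every value labels a
  -- single edge.
  | c :: l => (if c = .sym .lpar ∧ attrPart cur <+: l ∧ ¬ OccursIn (eqnPart l) l then
      [.edge] ++ valuePart l ++ [.colon] ++ (if eqnPart cur <+: l then succ else fail) else []) ++
      edgesWord ext cur succ fail l

/-- The suffix at which the node for the next equation or the decision of a rule begins. -/
def seek (l : List GLetter) : List GLetter :=
  l.dropWhile fun c => c ≠ .sym .lpar ∧ c ≠ .sym .arrow

/-- The word for the node at the suffix `(cur`. -/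
noncomputable def workingWord (ext : Bool) (w cur : List GLetter) : List GLetter :=
  [.node] ++ nameWord (.sym .lpar :: cur) ++ [.sym .a] ++ indexPart cur ++
    edgesWord ext cur (nameWord (seek cur)) (nameWord (after (.sym .semicolon) cur)) w

/-- The words for the nodes of the rule at the beginning of a word. -/
noncomputable def ruleNodesWord (ext : Bool) (w rule : List GLetter) :
    List GLetter → List GLetter
  | [] => []
  | c :: l => if c = .sym .semicolon then [] else
      (if c = .sym .lpar then workingWord ext w l else
        if c = .sym .arrow then
          [.node] ++ nameWord (c :: l) ++ [.sym .lpar] ++ rule ++ [.sym .rpar] else []) ++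
      ruleNodesWord ext w rule l

/-- In one of the nodes of the rule at the beginning of a word, the test can fail. -/
def CanFail (ext : Bool) (w : List GLetter) : List GLetter → Prop
  | [] => False
  | c :: l => c ≠ .sym .semicolon ∧ ((c = .sym .lpar ∧ (ext ∨ OtherIn l w)) ∨ CanFail ext w l)

open Classical in
/-- The words for the nodes of the rules that follow the semicolons in a word. -/
noncomputable def rulesWord (ext : Bool) (w : List GLetter) : List GLetter → List GLetter
  | [] => [.node] ++ nameWord [] ++ [.sym .lpar, .sym .rpar]
  | c :: l => if c = .sym .semicolon then
      ruleNodesWord ext w (upTo (.sym .semicolon) l) l ++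
        -- No edge would lead to the rules after a rule that cannot fail; their first node would be
        -- a second source.
        (if CanFail ext w l then rulesWord ext w l else [])
    else rulesWord ext w l

/-- The word for a graph that tests the equations one after the other, when every attribute has
only one value. -/
def chainWord (w : List GLetter) : List GLetter → List GLetter
  | [] => [.node] ++ nameWord [] ++ [.sym .lpar] ++ w ++ [.sym .rpar]
  | c :: l => (if c = .sym .lpar then
      [.node] ++ nameWord (c :: l) ++ [.sym .a] ++ indexPart l ++ [.edge] ++ valuePart l ++
        [.colon] ++ nameWord (l.dropWhile (· ≠ .sym .lpar)) else []) ++ chainWord w l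

/-! ### Polynomial time computability of the output words -/

section Complexity

variable {α : Type} {bs : List (α → List GLetter)} {f g x y z : α → List GLetter}

theorem Comp.upTo (c : GLetter) (hf : Comp bs f) : Comp bs fun a => upTo c (f a) :=
  hf.takeWhile _

theorem Comp.after (c : GLetter) (hf : Comp bs f) : Comp bs fun a => after c (f a) :=
  (hf.dropWhile _).tail

theorem Comp.nameWord (hf : Comp bs f) : Comp bs fun a => nameWord (f a) :=
  ((hf.replicate (.sym .one)).cons (.sym .one)).congr fun _ => rfl

theorem Comp.attrPart (hf : Comp bs f) : Comp bs fun a => attrPart (f a) :=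
  (hf.upTo _).append (.const _)

theorem Comp.eqnPart (hf : Comp bs f) : Comp bs fun a => eqnPart (f a) :=
  (hf.upTo _).append (.const _)

theorem Comp.indexPart (hf : Comp bs f) : Comp bs fun a => indexPart (f a) :=
  (hf.upTo _).tail

theorem Comp.valuePart (hf : Comp bs f) : Comp bs fun a => valuePart (f a) :=
  (hf.after _).upTo _

theorem CompPred.occursIn (hf : Comp bs f) (hx : Comp bs x) :
    CompPred bs fun a => OccursIn (f a) (x a) :=
  .recursion (F := fun l a => OccursIn (f a) l) (fun c y => c = .sym .lpar ∧ f y.2 <+: y.1)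
    (fun _ => True) hx (fun _ => .and (.const _) (.isPrefix hf.tl .fst)) (fun _ h => h)
    fun c l a => by simp [OccursIn]

theorem CompPred.otherIn (hf : Comp bs f) (hx : Comp bs x) :
    CompPred bs fun a => OtherIn (f a) (x a) :=
  .recursion (F := fun l a => OtherIn (f a) l)
    (fun c y => c = .sym .lpar ∧ DecisionRules.attrPart (f y.2) <+: y.1 ∧
      ¬ DecisionRules.eqnPart (f y.2) <+: y.1)
    (fun _ => True) hx
    (fun _ => .and (.const _) (.and (.isPrefix hf.tl.attrPart .fst)
      (.not (.isPrefix hf.tl.eqnPart .fst)))) (fun _ h => h)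
    fun c l a => by simp [OtherIn]

theorem Comp.edgesWord (ext : Bool) (hf : Comp bs f) (hy : Comp bs y) (hz : Comp bs z)
    (hx : Comp bs x) : Comp bs fun a => edgesWord ext (f a) (y a) (z a) (x a) := by
  classical
  refine .recursion_append (F := fun l a => DecisionRules.edgesWord ext (f a) (y a) (z a) l)
    (fun c u => if c = .sym .lpar ∧ DecisionRules.attrPart (f u.2) <+: u.1 ∧
        ¬ OccursIn (DecisionRules.eqnPart u.1) u.1 then
        [.edge] ++ DecisionRules.valuePart u.1 ++ [.colon] ++
          (if DecisionRules.eqnPart (f u.2) <+: u.1 then y u.2 else z u.2) else [])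
    (fun _ _ => True) hx (g := fun a => if ext then [.edge, .star, .colon] ++ z a else [])
    (.ite (.const _) ((Comp.const _).append hz) .nil)
    (fun c => .ite (.and (.const _) (.and (.isPrefix hf.tl.attrPart .fst)
      (.not (.occursIn (Comp.eqnPart .fst) .fst))))
      ((((Comp.const _).append (Comp.valuePart .fst)).append (.const _)).append
        (.ite (.isPrefix hf.tl.eqnPart .fst) hy.tl hz.tl)) .nil) (fun _ => .const _)
    (fun a => by simp [DecisionRules.edgesWord])
    (fun c l a => by rw [DecisionRules.edgesWord, if_pos trivial])

theorem Comp.workingWord (ext : Bool) (hx : Comp bs x) (hf : Comp bs f) :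
    Comp bs fun a => workingWord ext (x a) (f a) :=
  ((((Comp.const _).append (hf.cons _).nameWord).append (.const _)).append hf.indexPart).append
    (hf.edgesWord ext (hf.dropWhile _).nameWord (hf.after _).nameWord hx)

theorem Comp.ruleNodesWord (ext : Bool) (hx : Comp bs x) (hf : Comp bs f) (hy : Comp bs y) :
    Comp bs fun a => ruleNodesWord ext (x a) (f a) (y a) :=
  .recursion_append (F := fun l a => DecisionRules.ruleNodesWord ext (x a) (f a) l)
    (fun c u => if c = .sym .semicolon then [] else
      if c = .sym .lpar then DecisionRules.workingWord ext (x u.2) u.1 else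
        if c = .sym .arrow then [.node] ++ DecisionRules.nameWord (c :: u.1) ++ [.sym .lpar] ++
          f u.2 ++ [.sym .rpar] else [])
    (fun c _ => c ≠ .sym .semicolon) hy .nil
    (fun c => .ite (.const _) .nil <| .ite (.const _) (hx.tl.workingWord ext .fst) <|
      .ite (.const _) (((((Comp.const _).append (Comp.fst.cons c).nameWord).append
        (.const _)).append hf.tl).append (.const _)) .nil)
    (fun _ => .const _) (fun _ => rfl) fun c l a => by
      by_cases h : c = .sym .semicolon <;> simp [DecisionRules.ruleNodesWord, h]

theorem CompPred.canFail (ext : Bool) (hx : Comp bs x) (hf : Comp bs f) :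
    CompPred bs fun a => CanFail ext (x a) (f a) :=
  .recursion (F := fun l a => CanFail ext (x a) l)
    (fun c y => c ≠ .sym .semicolon ∧ c = .sym .lpar ∧ (ext = true ∨ OtherIn y.1 (x y.2)))
    (fun c => c ≠ .sym .semicolon) hf
    (fun _ => .and (.const _) (.and (.const _) (.or (.const _) (.otherIn .fst hx.tl))))
    (fun _ h => h) fun c l a => by
      simp only [CanFail]
      tauto

theorem Comp.rulesWord (ext : Bool) (hx : Comp bs x) (hf : Comp bs f) :
    Comp bs fun a => rulesWord ext (x a) (f a) := by
  classical
  exact .recursion_append (F := fun l a => DecisionRules.rulesWord ext (x a) l)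
    (fun c u => if c = .sym .semicolon then
      DecisionRules.ruleNodesWord ext (x u.2) (DecisionRules.upTo (.sym .semicolon) u.1) u.1 else [])
    (fun c u => c ≠ .sym .semicolon ∨ CanFail ext (x u.2) u.1) hf
    (.const _) (fun c => .ite (.const _) (hx.tl.ruleNodesWord ext (Comp.fst.upTo _) .fst) .nil)
    (fun c => .or (.const _) (.canFail ext hx.tl .fst)) (fun _ => rfl) fun c l a => by
      by_cases h : c = .sym .semicolon
      · simp only [DecisionRules.rulesWord, h, if_true, ne_eq, not_true, false_or]
      · simp [DecisionRules.rulesWord, h]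

theorem Comp.chainWord (hx : Comp bs x) (hf : Comp bs f) :
    Comp bs fun a => chainWord (x a) (f a) :=
  .recursion_append (F := fun l a => DecisionRules.chainWord (x a) l)
    (fun c u => if c = .sym .lpar then
      [.node] ++ DecisionRules.nameWord (c :: u.1) ++ [.sym .a] ++ DecisionRules.indexPart u.1 ++
        [.edge] ++ DecisionRules.valuePart u.1 ++ [.colon] ++
        DecisionRules.nameWord (u.1.dropWhile (· ≠ .sym .lpar)) else [])
    (fun _ _ => True) hf
    (((((Comp.const _).append (Comp.const _)).append (.const _)).append hx).append (.const _))
    (fun c => .ite (.const _) ((((((((Comp.const _).append (Comp.fst.cons c).nameWord).append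
      (.const _)).append (Comp.indexPart .fst)).append (.const _)).append (Comp.valuePart .fst)).append
      (.const _)).append (Comp.nameWord (Comp.fst.dropWhile _))) .nil)
    (fun _ => .const _) (fun _ => rfl) fun c l a => by simp [DecisionRules.chainWord]

end Complexity

/-! ### Graphs given by lists of descriptions of nodes -/

/-- A description of a node: its name, and either the attribute and the list of leaving edges, or
the set of rules and a word for it. -/
abbrev NodeDesc : Type := ℕ × ((ℕ × List (Option ℕ × ℕ)) ⊕ (Finset Rule × List Letter))

/-- The word for a description of a node. -/
def descWord : NodeDesc → List GLetter
  | (u, .inl (a, es)) =>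
    [.node] ++ gbinary u ++ [.sym .a] ++ gbinary a ++ (es.map edgeWord).flatten
  | (u, .inr (_, z)) => [.node] ++ gbinary u ++ [.sym .lpar] ++ z.map .sym ++ [.sym .rpar]

/-- The label in a description of a node. -/
def descLabel : (ℕ × List (Option ℕ × ℕ)) ⊕ (Finset Rule × List Letter) → NodeLabel
  | .inl (a, _) => .attr a
  | .inr (Z, _) => .rules Z

/-- The edges in a description of a node. -/
def descEdges : NodeDesc → List (ℕ × Option ℕ × ℕ)
  | (u, .inl (_, es)) => es.map fun e => (u, e)
  | (_, .inr _) => []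

open Classical in
/-- The graph with the given nodes. -/
noncomputable def graphOf (D : List NodeDesc) : LabeledGraph where
  nodes := (D.map Prod.fst).toFinset
  edges := (D.flatMap descEdges).toFinset
  label u := if h : ∃ x, (u, x) ∈ D then descLabel h.choose else .attr 0

section graphOf

variable {D : List NodeDesc}

theorem mem_nodes_graphOf {u : ℕ} : u ∈ (graphOf D).nodes ↔ ∃ x, (u, x) ∈ D := by
  simp [graphOf]

theorem mem_edges_graphOf {u v : ℕ} {δ : Option ℕ} :
    (u, δ, v) ∈ (graphOf D).edges ↔ ∃ a es, (u, .inl (a, es)) ∈ D ∧ (δ, v) ∈ es := by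
  simp only [graphOf, List.mem_toFinset, List.mem_flatMap]
  constructor
  · rintro ⟨⟨u', ⟨a, es⟩ | ⟨Z, z⟩⟩, h, h'⟩
    · simp only [descEdges, List.mem_map, Prod.mk.injEq] at h'
      obtain ⟨e, he, rfl, rfl⟩ := h'
      exact ⟨a, es, h, he⟩
    · simp [descEdges] at h'
  · rintro ⟨a, es, h, he⟩
    exact ⟨_, h, List.mem_map.2 ⟨_, he, rfl⟩⟩

theorem desc_unique (hD : (D.map Prod.fst).Nodup) {u : ℕ} {x y}
    (hx : (u, x) ∈ D) (hy : (u, y) ∈ D) : x = y := by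
  have := List.inj_on_of_nodup_map hD hx hy rfl
  exact (Prod.mk.inj this).2

theorem label_graphOf (hD : (D.map Prod.fst).Nodup) {u : ℕ} {x} (hx : (u, x) ∈ D) :
    (graphOf D).label u = descLabel x := by
  have h : ∃ x, (u, x) ∈ D := ⟨x, hx⟩
  simp only [graphOf, dif_pos h]
  rw [desc_unique hD h.choose_spec hx]

theorem graphWord_graphOf (hD : (D.map Prod.fst).Nodup)
    (hes : ∀ u a es, (u, .inl (a, es)) ∈ D → es.Nodup)
    (hZ : ∀ u Z z, (u, .inr (Z, z)) ∈ D → SystemWord Z z) :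
    GraphWord (graphOf D) (D.flatMap descWord) := by
  refine ⟨D.map Prod.fst, D.map descWord, hD, by simp [graphOf], ?_, by rw [List.flatMap_def]⟩
  rw [List.forall₂_map_left_iff, List.forall₂_map_right_iff, List.forall₂_same]
  rintro ⟨u, ⟨a, es⟩ | ⟨Z, z⟩⟩ h
  · simp only [NodeWord, label_graphOf hD h, descLabel]
    refine ⟨es, hes _ _ _ h, fun δ v => ?_, rfl⟩
    rw [mem_edges_graphOf]
    constructor
    · intro he
      exact ⟨a, es, h, he⟩
    · rintro ⟨a', es', h', he⟩
      have := desc_unique hD h h'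
      simp only [Sum.inl.injEq, Prod.mk.injEq] at this
      rwa [this.2]
  · simp only [NodeWord, label_graphOf hD h, descLabel]
    exact ⟨z, hZ _ _ _ h, rfl⟩

theorem mem_values {S : Finset Rule} {a δ : ℕ} : δ ∈ values S a ↔ ∃ r ∈ S, (a, δ) ∈ r.K := by
  simp only [values, Finset.mem_image, Finset.mem_filter, Finset.mem_biUnion]
  constructor
  · rintro ⟨⟨a', δ'⟩, ⟨⟨r, hr, hp⟩, rfl⟩, rfl⟩
    exact ⟨r, hr, hp⟩
  · rintro ⟨r, hr, hp⟩
    exact ⟨_, ⟨⟨r, hr, hp⟩, rfl⟩, rfl⟩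

theorem mem_attrs {S : Finset Rule} {a : ℕ} : a ∈ attrs S ↔ ∃ r ∈ S, ∃ δ, (a, δ) ∈ r.K := by
  simp [attrs]

theorem mem_problemValues {C : Problem} {S : Finset Rule} {a : ℕ} {δ : Option ℕ} :
    δ ∈ problemValues C S a ↔
      (C.Extended ∧ δ = none) ∨ ∃ r ∈ S, ∃ b, (a, b) ∈ r.K ∧ δ = some b := by
  have h : δ ∈ (values S a).image some ↔ ∃ r ∈ S, ∃ b, (a, b) ∈ r.K ∧ δ = some b := by
    simp only [Finset.mem_image, mem_values]
    constructor
    · rintro ⟨b, ⟨r, hr, hb⟩, rfl⟩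
      exact ⟨r, hr, b, hb, rfl⟩
    · rintro ⟨r, hr, b, hb, rfl⟩
      exact ⟨b, ⟨r, hr, hb⟩, rfl⟩
  unfold problemValues
  split_ifs with hC
  · rw [Finset.mem_insert, h]
    simp [hC]
  · rw [h]
    simp [hC]

theorem problemValues_nonempty {C : Problem} {S : Finset Rule} {a : ℕ} (h : a ∈ attrs S) :
    ∃ δ, δ ∈ problemValues C S a := by
  obtain ⟨r, hr, δ, hδ⟩ := mem_attrs.1 h
  exact ⟨some δ, mem_problemValues.2 (.inr ⟨r, hr, δ, hδ, rfl⟩)⟩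

/-- A list of descriptions of nodes gives a graph that solves a problem, if a suitable invariant
relates the nodes to the equations met on the paths that lead to them. -/
theorem solves_graphOf {C : Problem} {S : Finset Rule} (hD : (D.map Prod.fst).Nodup)
    (hattr : ∀ u a es, (u, .inl (a, es)) ∈ D → a ∈ attrs S)
    (hes : ∀ u a es, (u, .inl (a, es)) ∈ D → ∀ δ,
      (∃ v, (δ, v) ∈ es) ↔ δ ∈ problemValues C S a)
    (hfun : ∀ u a es, (u, .inl (a, es)) ∈ D → ∀ δ v w, (δ, v) ∈ es → (δ, w) ∈ es → v = w)
    (hlt : ∀ u a es, (u, .inl (a, es)) ∈ D → ∀ δ v, (δ, v) ∈ es → v < u ∧ ∃ x, (v, x) ∈ D)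
    (hZ : ∀ u Z z, (u, .inr (Z, z)) ∈ D → Z ⊆ S)
    (root : ℕ) (hroot : ∃ x, (root, x) ∈ D) (hle : ∀ u x, (u, x) ∈ D → u ≤ root)
    (henter : ∀ v x, (v, x) ∈ D → v ≠ root → ∃ u a es δ, (u, .inl (a, es)) ∈ D ∧ (δ, v) ∈ es)
    (Inv : ℕ → Finset (ℕ × Option ℕ) → Prop) (inv_root : Inv root ∅)
    (inv_step : ∀ u a es δ v E, (u, .inl (a, es)) ∈ D → (δ, v) ∈ es → Inv u E →
      Inv v (insert (a, δ) E))
    (inv_terminal : ∀ u Z z E, (u, .inr (Z, z)) ∈ D → Inv u E → Answers C S Z E) :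
    (graphOf D).Solves C S := by
  -- Names decrease along edges. This yields acyclicity, and it shows that no edge enters the root,
  -- whose name is the largest.
  have hadj : ∀ u v, (graphOf D).Adj u v → v < u := by
    rintro u v ⟨δ, h⟩
    obtain ⟨a, es, h, he⟩ := mem_edges_graphOf.1 h
    exact (hlt _ _ _ h _ _ he).1
  have hsource : ∀ v, (graphOf D).IsSource v ↔ v = root := by
    intro v
    constructor
    · rintro ⟨hv, h⟩
      by_contra hne
      obtain ⟨x, hx⟩ := mem_nodes_graphOf.1 hv
      obtain ⟨u, a, es, δ, hu, he⟩ := henter v x hx hne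
      exact h u ⟨δ, mem_edges_graphOf.2 ⟨a, es, hu, he⟩⟩
    · rintro rfl
      refine ⟨mem_nodes_graphOf.2 hroot, fun u h => ?_⟩
      have h₁ := hadj _ _ h
      obtain ⟨δ, h⟩ := h
      obtain ⟨a, es, h, he⟩ := mem_edges_graphOf.1 h
      have := hle _ _ h
      omega
  have hterm : ∀ u, (graphOf D).IsTerminal u → ∃ Z z, (u, .inr (Z, z)) ∈ D := by
    rintro u ⟨hu, h⟩
    obtain ⟨⟨a, es⟩ | ⟨Z, z⟩, hx⟩ := mem_nodes_graphOf.1 hu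
    -- An attribute of `S` has at least one value, so a node described by an attribute has a leaving
    -- edge.
    · obtain ⟨δ, hδ⟩ := problemValues_nonempty (C := C) (hattr _ _ _ hx)
      obtain ⟨v, hv⟩ := (hes _ _ _ hx δ).2 hδ
      exact absurd ⟨δ, mem_edges_graphOf.2 ⟨a, es, hx, hv⟩⟩ (h v)
    · exact ⟨Z, z, hx⟩
  refine ⟨⟨?_, ?_, ?_, ?_, ?_⟩, ?_⟩
  · intro u δ v h
    obtain ⟨a, es, h, he⟩ := mem_edges_graphOf.1 h
    exact ⟨mem_nodes_graphOf.2 ⟨_, h⟩, mem_nodes_graphOf.2 (hlt _ _ _ h _ _ he).2⟩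
  · exact ⟨root, (hsource _).2 rfl, fun v hv => (hsource _).1 hv⟩
  · have : ∀ u v, Relation.TransGen (graphOf D).Adj u v → v < u := by
      intro u v h
      induction h with
      | single h => exact hadj _ _ h
      | tail _ h ih => exact (hadj _ _ h).trans ih
    exact fun v h => lt_irrefl _ (this v v h)
  · intro u hu hnt
    obtain ⟨⟨a, es⟩ | ⟨Z, z⟩, hx⟩ := mem_nodes_graphOf.1 hu
    · refine ⟨a, hattr _ _ _ hx, label_graphOf hD hx, fun δ => ?_, fun δ v w hv hw => ?_⟩
      · rw [← hes _ _ _ hx]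
        refine exists_congr fun v => ?_
        rw [mem_edges_graphOf]
        constructor
        · rintro ⟨a', es', h', he⟩
          have := desc_unique hD hx h'
          simp only [Sum.inl.injEq, Prod.mk.injEq] at this
          rwa [this.2]
        · exact fun he => ⟨a, es, hx, he⟩
      · obtain ⟨a₁, es₁, h₁, hv⟩ := mem_edges_graphOf.1 hv
        obtain ⟨a₂, es₂, h₂, hw⟩ := mem_edges_graphOf.1 hw
        have := desc_unique hD h₁ h₂
        simp only [Sum.inl.injEq, Prod.mk.injEq] at this
        obtain ⟨rfl, rfl⟩ := this
        exact hfun _ _ _ h₁ _ _ _ hv hw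
    · refine absurd ⟨hu, fun v => ?_⟩ hnt
      rintro ⟨δ, h⟩
      obtain ⟨a, es, h, he⟩ := mem_edges_graphOf.1 h
      exact nomatch desc_unique hD hx h
  · intro u hu
    obtain ⟨Z, z, hx⟩ := hterm u hu
    exact ⟨Z, hZ _ _ _ hx, label_graphOf hD hx⟩
  · intro u E v τ hu hp hv hτ _
    obtain rfl := (hsource u).1 hu
    -- The equations already met are carried along as `E₀`, so that the induction applies to paths
    -- from an arbitrary node.
    have key : ∀ u E v, (graphOf D).Path u E v → ∀ E₀, Inv u E₀ → Inv v (E₀ ∪ E.toFinset) := by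
      intro u E v hp
      induction hp with
      | nil u => simp
      | @cons u v w a δ E hl he _ ih =>
        intro E₀ h₀
        obtain ⟨a', es, h, he⟩ := mem_edges_graphOf.1 he
        rw [label_graphOf hD h] at hl
        obtain rfl : a' = a := by simpa [descLabel] using hl
        have := ih _ (inv_step _ _ _ _ _ _ h he h₀)
        simpa [Finset.insert_union, Finset.union_insert] using this
    have h := key _ _ _ hp ∅ inv_root
    rw [Finset.empty_union] at h
    obtain ⟨Z, z, hx⟩ := hterm v hv
    rw [label_graphOf hD hx] at hτ
    obtain rfl : Z = τ := by simpa [descLabel] using hτ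
    exact inv_terminal _ _ _ _ hx h

end graphOf

/-! ### Words for rule systems in the alphabet for graphs -/

/-- Evaluation by Horner's rule is a left inverse. -/
theorem binary_injective : Function.Injective binary := by
  let val : List Letter → ℕ := fun l => l.foldl (fun n c => 2 * n + if c = .one then 1 else 0) 0
  have hval : ∀ n, val (binary n) = n := by
    intro n
    have h : ∀ l : List Bool, (l.reverse.map fun b => if b then Letter.one else .zero).foldl
        (fun n c => 2 * n + if c = .one then 1 else 0) 0 =
        l.foldr (fun b n => 2 * n + if b then 1 else 0) 0 := by
      intro l
      rw [List.foldl_map, List.foldl_reverse]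
      congr
      funext b n
      cases b <;> simp
    have h' : ∀ n : ℕ, n.bits.foldr (fun b n => 2 * n + if b then 1 else 0) 0 = n := by
      intro n
      induction n using Nat.binaryRec' with
      | zero => simp
      | bit b n hn ih =>
        rw [Nat.bits_append_bit _ _ hn, List.foldr_cons, ih]
        cases b <;> simp [Nat.bit]
    unfold binary
    split_ifs with hn
    · simp [val, hn]
    · simp only [val]
      rw [h, h']
  exact Function.LeftInverse.injective hval

theorem gbinary_injective : Function.Injective gbinary :=
  (List.map_injective_iff.2 fun _ _ h => GLetter.sym.inj h).comp binary_injective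

/-- A block of ones is both a unary length and a binary numeral. The algorithm can therefore name a
node by replacing every letter of a suffix by `1`, and needs no arithmetic. -/
theorem binary_two_pow_sub_one (m : ℕ) :
    binary (2 ^ (m + 1) - 1) = List.replicate (m + 1) .one := by
  have h : ∀ m, (2 ^ m - 1 : ℕ).bits = List.replicate m true := by
    intro m
    induction m with
    | zero => simp
    | succ m ih =>
      have : 2 ^ (m + 1) - 1 = 2 * (2 ^ m - 1) + 1 := by
        have := Nat.one_le_two_pow (n := m)
        rw [pow_succ]
        omega
      rw [this, Nat.bit1_bits, ih, List.replicate_succ]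
  have h₁ : 2 ^ (m + 1) - 1 ≠ 0 := by
    have := Nat.one_le_two_pow (n := m)
    rw [pow_succ]
    omega
  rw [binary, if_neg h₁, h, List.reverse_replicate, List.map_replicate]
  rfl

/-- The number of the node whose name is given by a suffix of length `m`. -/
def nodeName (m : ℕ) : ℕ := 2 ^ (m + 1) - 1

theorem nameWord_eq (l : List GLetter) : nameWord l = gbinary (nodeName l.length) := by
  rw [nameWord, gbinary, nodeName, binary_two_pow_sub_one, List.map_replicate]

theorem nodeName_strictMono : StrictMono nodeName := by
  refine strictMono_nat_of_lt_succ fun m => ?_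
  have := Nat.one_le_two_pow (n := m)
  simp only [nodeName, pow_succ]
  omega

theorem mem_binary {n : ℕ} {c : Letter} (h : c ∈ binary n) : c = .zero ∨ c = .one := by
  unfold binary at h
  split_ifs at h
  · exact .inl (List.mem_singleton.1 h)
  · simp only [List.mem_map] at h
    obtain ⟨b, -, rfl⟩ := h
    cases b <;> simp

/-- Delimiters never occur inside numerals; this is what makes cutting a word at the first delimiter
a correct parser. -/
theorem notMem_gbinary {n : ℕ} {c : GLetter} (h₀ : c ≠ .sym .zero) (h₁ : c ≠ .sym .one) :
    c ∉ gbinary n := by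
  simp only [gbinary, List.mem_map, not_exists, not_and]
  rintro d hd rfl
  rcases mem_binary hd with rfl | rfl
  · exact h₀ rfl
  · exact h₁ rfl

/-- The word `ai=δ)`. -/
def gEqn (p : ℕ × ℕ) : List GLetter :=
  .sym .a :: (gbinary p.1 ++ (.sym .eq :: (gbinary p.2 ++ [.sym .rpar])))

theorem notMem_gEqn {p : ℕ × ℕ} {c : GLetter} (h₀ : c ≠ .sym .zero) (h₁ : c ≠ .sym .one)
    (h₂ : c ≠ .sym .a) (h₃ : c ≠ .sym .eq) (h₄ : c ≠ .sym .rpar) : c ∉ gEqn p := by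
  simp [gEqn, notMem_gbinary h₀ h₁, h₂, h₃, h₄]

/-- The word for a rule with the given equations and right-hand side. -/
def gRule : List (ℕ × ℕ) → ℕ → List GLetter
  | [], σ => .sym .arrow :: gbinary σ
  | p :: q, σ => .sym .lpar :: (gEqn p ++ ((if q = [] then [] else [.sym .and]) ++ gRule q σ))

/-- The words for rules, each preceded by a semicolon. -/
def gRules : List (List (ℕ × ℕ) × Rule) → List GLetter
  | [] => []
  | x :: rs => .sym .semicolon :: (gRule x.1 x.2.rhs ++ gRules rs)

/-- The word for a rule in the alphabet for rule systems. -/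
def ruleWord (x : List (ℕ × ℕ) × Rule) : List Letter :=
  [Letter.and].intercalate (x.1.map eqnWord) ++ [.arrow] ++ binary x.2.rhs

theorem map_sym_eqnWord (p : ℕ × ℕ) :
    (eqnWord p).map GLetter.sym = .sym .lpar :: gEqn p := by
  simp [eqnWord, gEqn, gbinary]

theorem map_sym_ruleWord (x : List (ℕ × ℕ) × Rule) :
    (ruleWord x).map GLetter.sym = gRule x.1 x.2.rhs := by
  obtain ⟨q, r⟩ := x
  simp only [ruleWord]
  induction q with
  | nil => simp [gRule, gbinary]
  | cons p q ih =>
    rw [gRule, ← ih]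
    rcases q with - | ⟨p', q⟩
    · simp [List.intercalate, map_sym_eqnWord]
    · simp [List.intercalate, map_sym_eqnWord]

/-- With a semicolon put in front of the input, every rule follows a semicolon and the first one
needs no special treatment. -/
theorem map_sym_intercalate (rs : List (List (ℕ × ℕ) × Rule)) (h : rs ≠ []) :
    .sym .semicolon :: ([Letter.semicolon].intercalate (rs.map ruleWord)).map GLetter.sym =
      gRules rs := by
  induction rs with
  | nil => exact absurd rfl h
  | cons x rs ih =>
    rw [gRules]
    rcases rs with - | ⟨y, rs⟩
    · simp [List.intercalate, map_sym_ruleWord, gRules]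
    · rw [← ih (by simp)]
      simp [List.intercalate, map_sym_ruleWord]

/-- A rule system with a word is given by a list of rules with lists of their equations. -/
theorem SystemWord.exists_list {S : Finset Rule} {w : List Letter} (h : SystemWord S w) :
    ∃ rs : List (List (ℕ × ℕ) × Rule), (rs.map Prod.snd).toFinset = S ∧
      (∀ x ∈ rs, x.1.toFinset = x.2.K) ∧
      (∀ x ∈ rs, SystemWord {x.2} (ruleWord x)) ∧
      w = [Letter.semicolon].intercalate (rs.map ruleWord) := by
  obtain ⟨l, ws, -, hl, hlw, rfl⟩ := h
  have : ∃ rs : List (List (ℕ × ℕ) × Rule), rs.map Prod.snd = l ∧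
      (∀ x ∈ rs, x.1.toFinset = x.2.K) ∧ (∀ x ∈ rs, SystemWord {x.2} (ruleWord x)) ∧
      ws = rs.map ruleWord := by
    clear hl
    induction hlw with
    | nil => exact ⟨[], by simp⟩
    | @cons r w l ws hr _ ih =>
      obtain ⟨rs, h₁, h₂, h₃, h₄⟩ := ih
      obtain ⟨q, hq, hK, hw⟩ := hr
      refine ⟨(q, r) :: rs, by simp [h₁], ?_, ?_, by simp [h₄, hw, ruleWord]⟩
      · simpa [hK] using h₂
      · simp only [List.mem_cons, forall_eq_or_imp]
        refine ⟨⟨[r], [w], by simp, by simp, .cons ⟨q, hq, hK, hw⟩ .nil, ?_⟩, h₃⟩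
        simp [List.intercalate, ruleWord, hw]
  obtain ⟨rs, h₁, h₂, h₃, h₄⟩ := this
  exact ⟨rs, by rw [h₁, hl], h₂, h₃, by rw [h₄]⟩

/-! ### Scanning a word for equations -/

/-- `Scan l L`: the list `L` consists of the equations in the word `l`, each with the length of the
suffix at which it begins. -/
inductive Scan : List GLetter → List (ℕ × (ℕ × ℕ)) → Prop
  | nil : Scan [] []
  | skip {c : GLetter} {l : List GLetter} {L : List (ℕ × (ℕ × ℕ))} :
      c ≠ .sym .lpar → Scan l L → Scan (c :: l) L
  | eqn {p : ℕ × ℕ} {l l' : List GLetter} {L : List (ℕ × (ℕ × ℕ))} :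
      l = gEqn p ++ l' → Scan l L → Scan (.sym .lpar :: l) ((l.length + 1, p) :: L)

theorem Scan.append {u l : List GLetter} {L : List (ℕ × (ℕ × ℕ))} (hu : .sym .lpar ∉ u)
    (h : Scan l L) : Scan (u ++ l) L := by
  induction u with
  | nil => exact h
  | cons c u ih =>
    simp only [List.mem_cons, not_or] at hu
    exact .skip (Ne.symm hu.1) (ih hu.2)

theorem Scan.gRule {l : List GLetter} {L : List (ℕ × (ℕ × ℕ))} (h : Scan l L) (q : List (ℕ × ℕ))
    (σ : ℕ) : ∃ L', Scan (gRule q σ ++ l) L' ∧ L'.map Prod.snd = q ++ L.map Prod.snd := by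
  induction q with
  | nil => exact ⟨L, h.append (by simp [DecisionRules.gRule, notMem_gbinary]), rfl⟩
  | cons p q ih =>
    obtain ⟨L', h₁, h₂⟩ := ih
    have h₃ : Scan (gEqn p ++ ((if q = [] then [] else [.sym .and]) ++
        (DecisionRules.gRule q σ ++ l))) L' :=
      (h₁.append (by split_ifs <;> simp)).append
        (notMem_gEqn (by simp) (by simp) (by simp) (by simp) (by simp))
    refine ⟨_, by simpa [DecisionRules.gRule] using Scan.eqn rfl h₃, by simp [h₂]⟩

theorem exists_scan_gRules (rs : List (List (ℕ × ℕ) × Rule)) :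
    ∃ L, Scan (gRules rs) L ∧ L.map Prod.snd = rs.flatMap Prod.fst := by
  induction rs with
  | nil => exact ⟨[], .nil, rfl⟩
  | cons x rs ih =>
    obtain ⟨L, h₁, h₂⟩ := ih
    obtain ⟨L', h₃, h₄⟩ := h₁.gRule x.1 x.2.rhs
    exact ⟨L', .skip (by simp) h₃, by simp [h₄, h₂]⟩

theorem upTo_append {c : GLetter} {u l : List GLetter} (h : c ∉ u) : upTo c (u ++ c :: l) = u := by
  unfold upTo
  rw [List.takeWhile_append_of_pos]
  · simp
  · intro d hd
    simpa using fun e : d = c => h (e ▸ hd)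

theorem dropWhile_append_of_forall {p : GLetter → Bool} {u l : List GLetter}
    (h : ∀ d ∈ u, p d = true) : (u ++ l).dropWhile p = l.dropWhile p := by
  induction u with
  | nil => rfl
  | cons d u ih =>
    rw [List.cons_append, List.dropWhile_cons, if_pos (h d (by simp))]
    exact ih fun d hd => h d (by simp [hd])

theorem after_append {c : GLetter} {u l : List GLetter} (h : c ∉ u) :
    after c (u ++ l) = after c l := by
  unfold after
  rw [dropWhile_append_of_forall]
  intro d hd
  simpa using fun e : d = c => h (e ▸ hd)

/-- The terminator `c` occurs in neither word, so cutting both sides at the first `c` recovers `u`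
and `v`. -/
theorem append_singleton_prefix {c : GLetter} {u v l : List GLetter} (hu : c ∉ u) (hv : c ∉ v) :
    u ++ [c] <+: v ++ c :: l ↔ u = v := by
  constructor
  · rintro ⟨t, ht⟩
    rw [List.append_assoc, List.singleton_append] at ht
    rw [← upTo_append (l := t) hu, ht, upTo_append hv]
  · rintro rfl
    exact ⟨l, by simp⟩

section

variable (p : ℕ × ℕ) (l : List GLetter)

theorem attrPart_gEqn : attrPart (gEqn p ++ l) = .sym .a :: gbinary p.1 ++ [.sym .eq] := by
  have : gEqn p ++ l = (.sym .a :: gbinary p.1) ++ (.sym .eq :: (gbinary p.2 ++ .sym .rpar :: l)) :=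
    by simp [gEqn]
  rw [attrPart, this, upTo_append (by simp [notMem_gbinary])]

theorem indexPart_gEqn : indexPart (gEqn p ++ l) = gbinary p.1 := by
  have : gEqn p ++ l = (.sym .a :: gbinary p.1) ++ (.sym .eq :: (gbinary p.2 ++ .sym .rpar :: l)) :=
    by simp [gEqn]
  rw [indexPart, this, upTo_append (by simp [notMem_gbinary])]
  rfl

theorem eqnPart_gEqn : eqnPart (gEqn p ++ l) = gEqn p := by
  have : gEqn p ++ l =
      (.sym .a :: (gbinary p.1 ++ .sym .eq :: gbinary p.2)) ++ (.sym .rpar :: l) := by simp [gEqn]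
  rw [eqnPart, this, upTo_append (by simp [notMem_gbinary])]
  simp [gEqn]

theorem valuePart_gEqn : valuePart (gEqn p ++ l) = gbinary p.2 := by
  have : gEqn p ++ l = (.sym .a :: gbinary p.1) ++ (.sym .eq :: (gbinary p.2 ++ .sym .rpar :: l)) :=
    by simp [gEqn]
  rw [valuePart, this, after_append (by simp [notMem_gbinary])]
  simp only [after, ne_eq, decide_not, decide_true, Bool.not_true, Bool.false_eq_true,
    not_false_eq_true, List.dropWhile_cons_of_neg, List.tail_cons]
  exact upTo_append (notMem_gbinary (by simp) (by simp))

/-- The sign `=` at the end of `attrPart` prevents `a1` from matching the beginning of `a10`. The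
closing parenthesis plays this role for whole equations. -/
theorem attrPart_prefix (p' : ℕ × ℕ) (l' : List GLetter) :
    attrPart (gEqn p ++ l) <+: gEqn p' ++ l' ↔ p'.1 = p.1 := by
  have : gEqn p' ++ l' =
    (.sym .a :: gbinary p'.1) ++ (.sym .eq :: (gbinary p'.2 ++ .sym .rpar :: l')) := by simp [gEqn]
  rw [attrPart_gEqn, this, append_singleton_prefix (by simp [notMem_gbinary])
    (by simp [notMem_gbinary]), List.cons_inj_right, gbinary_injective.eq_iff, eq_comm]

theorem gEqn_prefix (p' : ℕ × ℕ) (l' : List GLetter) :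
    gEqn p <+: gEqn p' ++ l' ↔ p' = p := by
  constructor
  · intro h
    have h₁ : p'.1 = p.1 := by
      rw [← attrPart_prefix p [] p' l']
      refine List.IsPrefix.trans ?_ h
      rw [attrPart_gEqn]
      exact ⟨gbinary p.2 ++ [.sym .rpar], by simp [gEqn]⟩
    have e : gEqn p' ++ l' =
        (.sym .a :: (gbinary p'.1 ++ .sym .eq :: gbinary p'.2)) ++ (.sym .rpar :: l') := by
      simp [gEqn]
    have e' : gEqn p = (.sym .a :: (gbinary p.1 ++ .sym .eq :: gbinary p.2)) ++ [.sym .rpar] := by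
      simp [gEqn]
    rw [e, e', append_singleton_prefix (by simp [notMem_gbinary]) (by simp [notMem_gbinary]),
      List.cons_inj_right, h₁, List.append_cancel_left_eq, List.cons_inj_right,
      gbinary_injective.eq_iff] at h
    exact Prod.ext h₁ h.symm
  · rintro rfl
    exact ⟨l', rfl⟩

end

theorem Scan.occursIn {l : List GLetter} {L : List (ℕ × (ℕ × ℕ))} (h : Scan l L) (p : ℕ × ℕ) :
    OccursIn (gEqn p) l ↔ p ∈ L.map Prod.snd := by
  induction h with
  | nil => simp [OccursIn]
  | skip hc _ ih => simp [OccursIn, hc, ih]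
  | eqn hl _ ih =>
    subst hl
    rw [OccursIn, ih, gEqn_prefix]
    simp [eq_comm]

theorem Scan.otherIn {l : List GLetter} {L : List (ℕ × (ℕ × ℕ))} (h : Scan l L) (p : ℕ × ℕ)
    (t : List GLetter) :
    OtherIn (gEqn p ++ t) l ↔ ∃ e ∈ L.map Prod.snd, e.1 = p.1 ∧ e ≠ p := by
  induction h with
  | nil => simp [OtherIn]
  | skip hc _ ih => simp only [OtherIn, hc, ih, false_and, false_or]
  | eqn hl _ ih =>
    subst hl
    rw [OtherIn, ih, attrPart_prefix, eqnPart_gEqn, gEqn_prefix]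
    simp only [true_and, List.map_cons, List.mem_cons, exists_eq_or_imp]

/-- The edges that leave the node for the equation `p`, if the rule system has the equations in the
given list. The edge labeled with the value of this equation enters `s`, the others enter `f`. -/
def edgeList (ext : Bool) (p : ℕ × ℕ) (s f : ℕ) : List (ℕ × ℕ) → List (Option ℕ × ℕ)
  | [] => if ext then [(none, f)] else []
  | e :: es => (if e.1 = p.1 ∧ e ∉ es then [(some e.2, if e = p then s else f)] else []) ++
      edgeList ext p s f es

theorem Scan.edgesWord {l : List GLetter} {L : List (ℕ × (ℕ × ℕ))} (h : Scan l L) (ext : Bool)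
    (p : ℕ × ℕ) (t : List GLetter) (s f : ℕ) :
    edgesWord ext (gEqn p ++ t) (gbinary s) (gbinary f) l =
      ((edgeList ext p s f (L.map Prod.snd)).map edgeWord).flatten := by
  induction h with
  | nil => cases ext <;> simp [DecisionRules.edgesWord, edgeList, edgeWord, valueWord]
  | skip hc _ ih => simp [DecisionRules.edgesWord, hc, ih]
  | @eqn p' l l' L hl h ih =>
    rw [DecisionRules.edgesWord, ih, List.map_cons, edgeList, List.map_append, List.flatten_append]
    congr 1
    have h₁ : attrPart (gEqn p ++ t) <+: l ↔ p'.1 = p.1 := by rw [hl, attrPart_prefix]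
    have h₂ : eqnPart (gEqn p ++ t) <+: l ↔ p' = p := by rw [hl, eqnPart_gEqn, gEqn_prefix]
    have h₃ : OccursIn (eqnPart l) l ↔ p' ∈ L.map Prod.snd := by
      rw [← h.occursIn, hl, eqnPart_gEqn]
    have h₄ : valuePart l = gbinary p'.2 := by rw [hl, valuePart_gEqn]
    simp only [h₁, h₂, h₃, h₄, true_and]
    split_ifs <;> simp [edgeWord, valueWord]

/-- Suppressing all but the last occurrence of an equation does not change the set of edges, since
the edge depends only on the equation. -/
theorem mem_edgeList {ext : Bool} {p : ℕ × ℕ} {s f : ℕ} {es : List (ℕ × ℕ)} {δ : Option ℕ} {v : ℕ} :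
    (δ, v) ∈ edgeList ext p s f es ↔ (ext = true ∧ δ = none ∧ v = f) ∨
      ∃ e ∈ es, e.1 = p.1 ∧ δ = some e.2 ∧ v = if e = p then s else f := by
  induction es with
  | nil => cases ext <;> simp [edgeList]
  | cons e es ih =>
    rw [edgeList, List.mem_append, ih]
    by_cases h : e ∈ es
    · simp only [h, not_true, and_false, if_false, List.not_mem_nil, false_or, List.mem_cons,
        exists_eq_or_imp]
      constructor
      · exact Or.imp_right .inr
      · rintro (h' | h' | h')
        · exact .inl h'
        · exact .inr ⟨e, h, h'⟩
        · exact .inr h'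
    · by_cases h' : e.1 = p.1
      · simp only [h, h', not_false_eq_true, and_self, if_true, Prod.mk.injEq, List.not_mem_nil,
          or_false, List.mem_cons, exists_eq_or_imp, true_and]
        exact or_left_comm
      · simp [h', h]

theorem nodup_edgeList (ext : Bool) (p : ℕ × ℕ) (s f : ℕ) (es : List (ℕ × ℕ)) :
    (edgeList ext p s f es).Nodup := by
  induction es with
  | nil => cases ext <;> simp [edgeList]
  | cons e es ih =>
    rw [edgeList]
    by_cases h : e.1 = p.1 ∧ e ∉ es
    · rw [if_pos h, List.singleton_append, List.nodup_cons]
      refine ⟨fun hm => ?_, ih⟩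
      rcases mem_edgeList.1 hm with ⟨-, h', -⟩ | ⟨e', he', h₁, h₂, -⟩
      · cases h'
      · have : e = e' := Prod.ext (h.1.trans h₁.symm) (Option.some.inj h₂)
        exact h.2 (this ▸ he')
    · rwa [if_neg h]

/-! ### The graph for the problems `SR` and `ESR` -/

theorem notMem_gRule {c : GLetter} (h₀ : c ≠ .sym .zero) (h₁ : c ≠ .sym .one)
    (h₂ : c ≠ .sym .a) (h₃ : c ≠ .sym .eq) (h₄ : c ≠ .sym .rpar) (h₅ : c ≠ .sym .lpar)
    (h₆ : c ≠ .sym .and) (h₇ : c ≠ .sym .arrow) (q : List (ℕ × ℕ)) (σ : ℕ) : c ∉ gRule q σ := by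
  induction q with
  | nil => simp [gRule, notMem_gbinary h₀ h₁, h₇]
  | cons p q ih =>
    rw [gRule]
    split_ifs <;> simp [ih, notMem_gEqn h₀ h₁ h₂ h₃ h₄, h₅, h₆]

theorem semicolon_notMem_gRule (q : List (ℕ × ℕ)) (σ : ℕ) : .sym .semicolon ∉ gRule q σ :=
  notMem_gRule (by simp) (by simp) (by simp) (by simp) (by simp) (by simp) (by simp) (by simp) q σ

/-- This locates the target of a failed test: the first node of the next rule. If no rule is left,
the tail is empty and the name `nodeName 0` is that of the terminal node with the label `∅`. -/
theorem after_semicolon_gRules (rs : List (List (ℕ × ℕ) × Rule)) :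
    after (.sym .semicolon) (gRules rs) = (gRules rs).tail := by
  cases rs <;> simp [after, gRules]

/-- The separator after an equation, if the list `q` of equations follows. -/
def separator (q : List (ℕ × ℕ)) : List GLetter := if q = [] then [] else [.sym .and]

theorem gRule_cons (p : ℕ × ℕ) (q : List (ℕ × ℕ)) (σ : ℕ) :
    gRule (p :: q) σ = .sym .lpar :: (gEqn p ++ (separator q ++ gRule q σ)) := rfl

theorem notMem_separator {c : GLetter} (h : c ≠ .sym .and) (q : List (ℕ × ℕ)) :
    c ∉ separator q := by
  unfold separator
  split_ifs <;> simp [h]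

theorem seek_gRule (p : ℕ × ℕ) (q : List (ℕ × ℕ)) (σ : ℕ) (l : List GLetter) :
    seek (gEqn p ++ (separator q ++ gRule q σ) ++ l) = gRule q σ ++ l := by
  unfold seek
  rw [List.append_assoc, dropWhile_append_of_forall, List.append_assoc, dropWhile_append_of_forall]
  · cases q <;> simp [gRule]
  · intro d hd
    have h₁ : d ≠ .sym .lpar := fun e => notMem_separator (by simp) q (e ▸ hd)
    have h₂ : d ≠ .sym .arrow := fun e => notMem_separator (by simp) q (e ▸ hd)
    simp [h₁, h₂]
  · intro d hd
    have h₁ : d ≠ .sym .lpar := fun e =>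
      notMem_gEqn (by simp) (by simp) (by simp) (by simp) (by simp) (e ▸ hd)
    have h₂ : d ≠ .sym .arrow := fun e =>
      notMem_gEqn (by simp) (by simp) (by simp) (by simp) (by simp) (e ▸ hd)
    simp [h₁, h₂]

section

variable (ext : Bool) (eqs : List (ℕ × ℕ))

/-- In one of the nodes of a rule the test can fail. -/
def RuleCanFail (q : List (ℕ × ℕ)) : Prop :=
  ∃ p ∈ q, ext = true ∨ ∃ e ∈ eqs, e.1 = p.1 ∧ e ≠ p

/-- The description of the node of the rule `x` at which the equations `q` have to be tested. The
rules `rest` follow the rule `x`. -/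
def stateDesc (x : List (ℕ × ℕ) × Rule) (rest : List (List (ℕ × ℕ) × Rule)) (q : List (ℕ × ℕ)) :
    NodeDesc :=
  (nodeName (gRule q x.2.rhs ++ gRules rest).length, match q with
    | [] => .inr ({x.2}, ruleWord x)
    | p :: q => .inl (p.1, edgeList ext p (nodeName (gRule q x.2.rhs ++ gRules rest).length)
        (nodeName (gRules rest).tail.length) eqs))

/-- The descriptions of the nodes of a rule. -/
def ruleDescs (x : List (ℕ × ℕ) × Rule) (rest : List (List (ℕ × ℕ) × Rule)) :
    List (ℕ × ℕ) → List NodeDesc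
  | [] => [stateDesc ext eqs x rest []]
  | p :: q => stateDesc ext eqs x rest (p :: q) :: ruleDescs x rest q

open Classical in
/-- The descriptions of the nodes of the graph. -/
noncomputable def allDescs : List (List (ℕ × ℕ) × Rule) → List NodeDesc
  | [] => [(nodeName 0, .inr (∅, []))]
  | x :: rs => ruleDescs ext eqs x rs x.1 ++ if RuleCanFail ext eqs x.1 then allDescs rs else []

variable {ext eqs} {W : List GLetter}

theorem ruleNodesWord_append {u l rule : List GLetter} (h₁ : .sym .semicolon ∉ u)
    (h₂ : .sym .lpar ∉ u) (h₃ : .sym .arrow ∉ u) :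
    ruleNodesWord ext W rule (u ++ l) = ruleNodesWord ext W rule l := by
  induction u with
  | nil => rfl
  | cons c u ih =>
    simp only [List.mem_cons, not_or] at h₁ h₂ h₃
    simp [ruleNodesWord, Ne.symm h₁.1, Ne.symm h₂.1, Ne.symm h₃.1, ih h₁.2 h₂.2 h₃.2]

theorem ruleNodesWord_gRules (rule : List GLetter) (rs : List (List (ℕ × ℕ) × Rule)) :
    ruleNodesWord ext W rule (gRules rs) = [] := by
  cases rs <;> simp [gRules, ruleNodesWord]

theorem ruleNodesWord_gRule {L : List (ℕ × (ℕ × ℕ))} (hW : Scan W L) (hL : L.map Prod.snd = eqs)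
    (x : List (ℕ × ℕ) × Rule) (rest : List (List (ℕ × ℕ) × Rule)) (q : List (ℕ × ℕ)) :
    ruleNodesWord ext W ((ruleWord x).map .sym) (gRule q x.2.rhs ++ gRules rest) =
      (ruleDescs ext eqs x rest q).flatMap descWord := by
  induction q with
  | nil =>
    have : ruleNodesWord ext W ((ruleWord x).map .sym) (gbinary x.2.rhs ++ gRules rest) = [] := by
      rw [ruleNodesWord_append (notMem_gbinary (by simp) (by simp))
        (notMem_gbinary (by simp) (by simp)) (notMem_gbinary (by simp) (by simp)),
        ruleNodesWord_gRules]
    rw [gRule, List.cons_append, ruleNodesWord, this, nameWord_eq]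
    simp [ruleDescs, stateDesc, descWord, gRule]
  | cons p q ih =>
    have h₁ : ruleNodesWord ext W ((ruleWord x).map .sym)
        (gEqn p ++ (separator q ++ gRule q x.2.rhs) ++ gRules rest) =
        (ruleDescs ext eqs x rest q).flatMap descWord := by
      rw [List.append_assoc, ruleNodesWord_append
        (notMem_gEqn (by simp) (by simp) (by simp) (by simp) (by simp))
        (notMem_gEqn (by simp) (by simp) (by simp) (by simp) (by simp))
        (notMem_gEqn (by simp) (by simp) (by simp) (by simp) (by simp)), List.append_assoc,
        ruleNodesWord_append (notMem_separator (by simp) q) (notMem_separator (by simp) q)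
        (notMem_separator (by simp) q), ih]
    have h₂ : after (.sym .semicolon) (gEqn p ++ (separator q ++ gRule q x.2.rhs) ++ gRules rest) =
        (gRules rest).tail := by
      rw [after_append, after_semicolon_gRules]
      simp [semicolon_notMem_gRule, notMem_gEqn, notMem_separator]
    rw [gRule_cons, List.cons_append, ruleNodesWord, h₁, ruleDescs, List.flatMap_cons]
    refine congrArg (· ++ _) ?_
    simp only [reduceCtorEq, if_false, if_true, GLetter.sym.injEq]
    have e : gEqn p ++ (separator q ++ gRule q x.2.rhs) ++ gRules rest =
      gEqn p ++ (separator q ++ gRule q x.2.rhs ++ gRules rest) := List.append_assoc _ _ _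
    rw [workingWord, seek_gRule, h₂, nameWord_eq, nameWord_eq, nameWord_eq, e, hW.edgesWord,
      indexPart_gEqn, hL]
    simp only [stateDesc, descWord, gRule_cons, List.append_assoc, List.cons_append]

theorem canFail_append {u l : List GLetter} (h₁ : .sym .semicolon ∉ u) (h₂ : .sym .lpar ∉ u) :
    CanFail ext W (u ++ l) ↔ CanFail ext W l := by
  induction u with
  | nil => rfl
  | cons c u ih =>
    simp only [List.mem_cons, not_or] at h₁ h₂
    simp [CanFail, Ne.symm h₁.1, Ne.symm h₂.1, ih h₁.2 h₂.2]

theorem canFail_gRule {L : List (ℕ × (ℕ × ℕ))} (hW : Scan W L) (hL : L.map Prod.snd = eqs)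
    (rest : List (List (ℕ × ℕ) × Rule)) (q : List (ℕ × ℕ)) (σ : ℕ) :
    CanFail ext W (gRule q σ ++ gRules rest) ↔ RuleCanFail ext eqs q := by
  induction q with
  | nil =>
    rw [canFail_append (semicolon_notMem_gRule _ _) (by simp [gRule, notMem_gbinary])]
    cases rest <;> simp [gRules, CanFail, RuleCanFail]
  | cons p q ih =>
    rw [gRule_cons, List.cons_append, CanFail, List.append_assoc, hW.otherIn, canFail_append
      (notMem_gEqn (by simp) (by simp) (by simp) (by simp) (by simp))
      (notMem_gEqn (by simp) (by simp) (by simp) (by simp) (by simp)), List.append_assoc,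
      canFail_append (notMem_separator (by simp) q) (notMem_separator (by simp) q), ih, hL]
    simp [RuleCanFail]

theorem rulesWord_append {u l : List GLetter} (h : .sym .semicolon ∉ u) :
    rulesWord ext W (u ++ l) = rulesWord ext W l := by
  induction u with
  | nil => rfl
  | cons c u ih =>
    simp only [List.mem_cons, not_or] at h
    simp [rulesWord, Ne.symm h.1, ih h.2]

/-- The bridge between the string algorithm and the graph: from here on only the list `allDescs` has
to be studied. -/
theorem rulesWord_gRules {L : List (ℕ × (ℕ × ℕ))} (hW : Scan W L) (hL : L.map Prod.snd = eqs)
    (rs : List (List (ℕ × ℕ) × Rule)) :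
    rulesWord ext W (gRules rs) = (allDescs ext eqs rs).flatMap descWord := by
  induction rs with
  | nil =>
    rw [gRules, rulesWord, nameWord_eq]
    simp [allDescs, descWord]
  | cons x rs ih =>
    have h : upTo (.sym .semicolon) (gRule x.1 x.2.rhs ++ gRules rs) = gRule x.1 x.2.rhs := by
      cases rs with
      | nil =>
        rw [gRules, List.append_nil, upTo, List.takeWhile_eq_self_iff]
        intro d hd
        simpa using fun e : d = .sym .semicolon => semicolon_notMem_gRule _ _ (e ▸ hd)
      | cons y rs => exact upTo_append (semicolon_notMem_gRule _ _)
    have h' := rulesWord_append (ext := ext) (W := W) (l := gRules rs)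
      (semicolon_notMem_gRule x.1 x.2.rhs)
    rw [gRules, rulesWord, if_pos rfl, h, h', ih, canFail_gRule hW hL]
    have h'' := ruleNodesWord_gRule (ext := ext) hW hL x rs x.1
    rw [map_sym_ruleWord] at h''
    rw [h'', allDescs, List.flatMap_append]
    congr 1
    split_ifs <;> rfl

end

/-! ### Structure and correctness of the graph for `SR` and `ESR` -/

section

variable {ext : Bool} {eqs : List (ℕ × ℕ)} {x : List (ℕ × ℕ) × Rule}
  {rs rest : List (List (ℕ × ℕ) × Rule)} {q : List (ℕ × ℕ)} {d : NodeDesc}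

theorem mem_ruleDescs : d ∈ ruleDescs ext eqs x rest q ↔
    ∃ q₀ q', q = q₀ ++ q' ∧ d = stateDesc ext eqs x rest q' := by
  induction q with
  | nil => simp [ruleDescs, and_assoc]
  | cons p q ih =>
    rw [ruleDescs, List.mem_cons, ih]
    constructor
    · rintro (rfl | ⟨q₀, q', rfl, rfl⟩)
      · exact ⟨[], _, rfl, rfl⟩
      · exact ⟨p :: q₀, q', rfl, rfl⟩
    · rintro ⟨_ | ⟨p', q₀⟩, q', h, rfl⟩
      · obtain rfl : p :: q = q' := h
        exact .inl rfl
      · simp only [List.cons_append, List.cons.injEq] at h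
        exact .inr ⟨q₀, q', h.2, rfl⟩

-- A node is either a position inside a rule `x`, with the equations `q₀` tested and `q` pending, or
-- the node for failure of all rules. In both cases the preceding rules can fail, which is what
-- makes the node reachable.
open Classical in
theorem mem_allDescs : d ∈ allDescs ext eqs rs ↔
    (∃ dn x rest q₀ q, rs = dn ++ x :: rest ∧ x.1 = q₀ ++ q ∧
      (∀ y ∈ dn, RuleCanFail ext eqs y.1) ∧ d = stateDesc ext eqs x rest q) ∨
    ((∀ y ∈ rs, RuleCanFail ext eqs y.1) ∧ d = (nodeName 0, .inr (∅, []))) := by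
  induction rs with
  | nil => simp [allDescs]
  | cons x rs ih =>
    have hif : d ∈ (if RuleCanFail ext eqs x.1 then allDescs ext eqs rs else []) ↔
        RuleCanFail ext eqs x.1 ∧ d ∈ allDescs ext eqs rs := by
      split_ifs with h <;> simp [h]
    rw [allDescs, List.mem_append, mem_ruleDescs, hif, ih]
    constructor
    · rintro (⟨q₀, q', h, rfl⟩ | ⟨h, ⟨dn, y, rest, q₀, q, rfl, h₁, h₂, rfl⟩ | ⟨h₁, rfl⟩⟩)
      · exact .inl ⟨[], x, rs, q₀, q', rfl, h, by simp, rfl⟩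
      · exact .inl ⟨x :: dn, y, rest, q₀, q, rfl, h₁, List.forall_mem_cons.2 ⟨h, h₂⟩, rfl⟩
      · exact .inr ⟨List.forall_mem_cons.2 ⟨h, h₁⟩, rfl⟩
    · rintro (⟨_ | ⟨x', dn⟩, y, rest, q₀, q, h, h₁, h₂, rfl⟩ | ⟨h, rfl⟩)
      · simp only [List.nil_append, List.cons.injEq] at h
        obtain ⟨rfl, rfl⟩ := h
        exact .inl ⟨q₀, q, h₁, rfl⟩
      · simp only [List.cons_append, List.cons.injEq] at h
        obtain ⟨rfl, rfl⟩ := h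
        simp only [List.mem_cons, forall_eq_or_imp] at h₂
        exact .inr ⟨h₂.1, .inl ⟨dn, y, rest, q₀, q, rfl, h₁, h₂.2, rfl⟩⟩
      · simp only [List.mem_cons, forall_eq_or_imp] at h
        exact .inr ⟨h.1, .inr ⟨h.2, rfl⟩⟩

theorem length_gRule_pos (q : List (ℕ × ℕ)) (σ : ℕ) : 0 < (gRule q σ).length := by
  cases q <;> simp [gRule]

theorem length_gRule_lt (p : ℕ × ℕ) (q : List (ℕ × ℕ)) (σ : ℕ) :
    (gRule q σ).length < (gRule (p :: q) σ).length := by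
  simp [gRule]
  omega

/-- Each test shortens the pending suffix, so the names decrease. The bounds separate the nodes of
this rule from those of the rules in `rest`. -/
theorem ruleDescs_sorted :
    ((ruleDescs ext eqs x rest q).map Prod.fst).Pairwise (· > ·) ∧
    ∀ d ∈ ruleDescs ext eqs x rest q, nodeName (gRules rest).length < d.1 ∧
      d.1 ≤ nodeName (gRule q x.2.rhs ++ gRules rest).length := by
  induction q with
  | nil =>
    refine ⟨by simp [ruleDescs], ?_⟩
    simp only [ruleDescs, List.mem_singleton, forall_eq, stateDesc, le_refl, and_true]
    refine nodeName_strictMono ?_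
    have := length_gRule_pos [] x.2.rhs
    rw [List.length_append]
    omega
  | cons p q ih =>
    have h₁ : nodeName (gRule q x.2.rhs ++ gRules rest).length <
        nodeName (gRule (p :: q) x.2.rhs ++ gRules rest).length := by
      refine nodeName_strictMono ?_
      have := length_gRule_lt p q x.2.rhs
      simp only [List.length_append]
      omega
    rw [ruleDescs, List.map_cons, List.pairwise_cons]
    refine ⟨⟨fun n hn => ?_, ih.1⟩, fun d hd => ?_⟩
    · obtain ⟨d, hd, rfl⟩ := List.mem_map.1 hn
      exact (ih.2 d hd).2.trans_lt h₁
    · rcases List.mem_cons.1 hd with rfl | hd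
      · refine ⟨nodeName_strictMono ?_, le_rfl⟩
        have := length_gRule_pos (p :: q) x.2.rhs
        rw [List.length_append]
        omega
      · exact ⟨(ih.2 d hd).1, (ih.2 d hd).2.trans h₁.le⟩

theorem allDescs_sorted :
    ((allDescs ext eqs rs).map Prod.fst).Pairwise (· > ·) ∧
    ∀ d ∈ allDescs ext eqs rs, d.1 ≤ nodeName (gRules rs).tail.length := by
  induction rs with
  | nil => simp [allDescs, gRules]
  | cons x rs ih =>
    have h := ruleDescs_sorted (ext := ext) (eqs := eqs) (x := x) (rest := rs) (q := x.1)
    have h' : nodeName (gRules rs).tail.length ≤ nodeName (gRules rs).length :=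
      nodeName_strictMono.monotone (by simp)
    have h'' : nodeName (gRules rs).length ≤ nodeName (gRules (x :: rs)).tail.length :=
      nodeName_strictMono.monotone (by simp [gRules])
    rw [allDescs, List.map_append, List.pairwise_append]
    refine ⟨⟨h.1, ?_, fun m hm n hn => ?_⟩, fun d hd => ?_⟩
    · split_ifs
      · exact ih.1
      · simp
    · obtain ⟨d, hd, rfl⟩ := List.mem_map.1 hm
      obtain ⟨d', hd', rfl⟩ := List.mem_map.1 hn
      split_ifs at hd'
      · exact ((ih.2 d' hd').trans h').trans_lt (h.2 d hd).1
      · simp at hd'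
    · rcases List.mem_append.1 hd with hd | hd
      · simpa [gRules] using (h.2 d hd).2
      · split_ifs at hd
        · exact ((ih.2 d hd).trans h').trans h''
        · simp at hd

/-- The equations in `E` contradict the rule `r`. -/
def Falsifies (E : Finset (ℕ × Option ℕ)) (r : Rule) : Prop :=
  ∃ p ∈ r.K, ∃ δ, (p.1, δ) ∈ E ∧ δ ≠ some p.2

theorem Falsifies.not_consistent {E : Finset (ℕ × Option ℕ)} {r : Rule} (h : Falsifies E r) :
    ¬ Consistent (r.eqs ∪ E) := by
  obtain ⟨p, hp, δ, hδ, hne⟩ := h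
  intro hc
  refine hne (hc (p.1, δ) (Finset.mem_union_right _ hδ) (p.1, some p.2)
    (Finset.mem_union_left _ ?_) rfl)
  exact Finset.mem_image.2 ⟨p, hp, rfl⟩

theorem Falsifies.mono {E E' : Finset (ℕ × Option ℕ)} {r : Rule} (h : Falsifies E r)
    (hE : E ⊆ E') : Falsifies E' r := by
  obtain ⟨p, hp, δ, hδ, hne⟩ := h
  exact ⟨p, hp, δ, hE hδ, hne⟩

/-- The invariant of the graph for `SR` and `ESR`: the equations met on a path to a node contradict
the rules that have been dealt with, and contain the equations of the current rule that have been
tested. -/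
def RulesInv (ext : Bool) (eqs : List (ℕ × ℕ)) (rs : List (List (ℕ × ℕ) × Rule)) (u : ℕ)
    (E : Finset (ℕ × Option ℕ)) : Prop :=
  (∃ dn x rest q₀ q, rs = dn ++ x :: rest ∧ x.1 = q₀ ++ q ∧
      (∀ y ∈ dn, RuleCanFail ext eqs y.1) ∧ u = (stateDesc ext eqs x rest q).1 ∧
      (∀ y ∈ dn, Falsifies E y.2) ∧ ∀ p ∈ q₀, (p.1, some p.2) ∈ E) ∨
    ((∀ y ∈ rs, RuleCanFail ext eqs y.1) ∧ u = nodeName 0 ∧ ∀ y ∈ rs, Falsifies E y.2)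

theorem systemWord_empty : SystemWord ∅ [] :=
  ⟨[], [], by simp, by simp, .nil, by simp [List.intercalate]⟩

/-- The first node of the rules after a rule that can fail. -/
theorem exists_first {dn : List (List (ℕ × ℕ) × Rule)} (h : rs = dn ++ rest)
    (hdn : ∀ y ∈ dn, RuleCanFail ext eqs y.1) :
    ∃ z, (nodeName (gRules rest).tail.length, z) ∈ allDescs ext eqs rs := by
  cases rest with
  | nil =>
    rw [List.append_nil] at h
    subst h
    exact ⟨_, mem_allDescs.2 (.inr ⟨hdn, rfl⟩)⟩
  | cons y rest =>
    exact ⟨_, mem_allDescs.2 (.inl ⟨dn, y, rest, [], y.1, h, rfl, hdn, rfl⟩)⟩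

/-- `RulesInv` is preserved: the success edge adds the tested equation to those confirmed, and a
failure edge adds an equation that contradicts the current rule. At a terminal node either all
equations of one rule have been collected or every rule has been contradicted. -/
theorem solves_allDescs {C : Problem} (hC : C = .SR ∨ C = .ESR) (hext : C.Extended ↔ ext = true)
    (hK : ∀ x ∈ rs, x.1.toFinset = x.2.K) :
    (graphOf (allDescs ext (rs.flatMap Prod.fst) rs)).Solves C (rs.map Prod.snd).toFinset := by
  set S := (rs.map Prod.snd).toFinset with hS
  have hmemS : ∀ r, r ∈ S ↔ ∃ x ∈ rs, x.2 = r := by simp [hS]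
  have heqs : ∀ p, p ∈ rs.flatMap Prod.fst ↔ ∃ r ∈ S, p ∈ r.K := by
    intro p
    simp only [List.mem_flatMap, hmemS]
    constructor
    · rintro ⟨x, hx, hp⟩
      exact ⟨x.2, ⟨x, hx, rfl⟩, by rwa [← hK x hx, List.mem_toFinset]⟩
    · rintro ⟨_, ⟨x, hx, rfl⟩, hp⟩
      rw [← hK x hx, List.mem_toFinset] at hp
      exact ⟨x, hx, hp⟩
  set eqs := rs.flatMap Prod.fst with hdef
  have hnodup : ((allDescs ext eqs rs).map Prod.fst).Nodup := allDescs_sorted.1.imp fun h => h.ne'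
  -- working nodes
  have hwork : ∀ u a es, (u, Sum.inl (a, es)) ∈ allDescs ext eqs rs →
      ∃ dn x rest q₀ p q, rs = dn ++ x :: rest ∧ x.1 = q₀ ++ p :: q ∧
      (∀ y ∈ dn, RuleCanFail ext eqs y.1) ∧ u = (stateDesc ext eqs x rest (p :: q)).1 ∧
      a = p.1 ∧ es = edgeList ext p (stateDesc ext eqs x rest q).1
        (nodeName (gRules rest).tail.length) eqs ∧ p ∈ eqs := by
    intro u a es h
    rcases mem_allDescs.1 h with ⟨dn, x, rest, q₀, q, h₁, h₂, h₃, h₄⟩ | ⟨-, h⟩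
    · rcases q with - | ⟨p, q⟩
      · simp [stateDesc] at h₄
      · simp only [stateDesc, Prod.mk.injEq, Sum.inl.injEq] at h₄
        refine ⟨dn, x, rest, q₀, p, q, h₁, h₂, h₃, h₄.1, h₄.2.1, h₄.2.2, ?_⟩
        rw [hdef, h₁]
        simp [h₂]
    · simp at h
  have hroot : ∃ z, (nodeName (gRules rs).tail.length, z) ∈ allDescs ext eqs rs :=
    exists_first (dn := []) (by simp) (by simp)
  -- the edges of a working node
  have hfail : ∀ (p : ℕ × ℕ) (q : List (ℕ × ℕ)) s f δ v, p ∈ q → (δ, v) ∈ edgeList ext p s f eqs →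
      (δ = some p.2 ∧ v = s) ∨ (δ ≠ some p.2 ∧ v = f ∧ RuleCanFail ext eqs q) := by
    intro p q s f δ v hp h
    rcases mem_edgeList.1 h with ⟨h₁, rfl, rfl⟩ | ⟨e, he, h₁, rfl, h₂⟩
    · exact .inr ⟨by simp, rfl, p, hp, .inl h₁⟩
    · by_cases hep : e = p
      · subst hep
        exact .inl ⟨rfl, by simpa using h₂⟩
      · rw [if_neg hep] at h₂
        refine .inr ⟨fun h => hep (Prod.ext h₁ (Option.some.inj h)), h₂, p, hp,
          .inr ⟨e, he, h₁, hep⟩⟩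
  refine solves_graphOf hnodup ?_ ?_ ?_ ?_ ?_ (nodeName (gRules rs).tail.length) hroot
    (fun u z h => allDescs_sorted.2 _ h) ?_ (RulesInv ext eqs rs) ?_ ?_ ?_
  · intro u a es h
    obtain ⟨dn, x, rest, q₀, p, q, h₁, h₂, h₃, -, rfl, -, hp⟩ := hwork u a es h
    obtain ⟨r, hr, hpr⟩ := (heqs p).1 hp
    exact mem_attrs.2 ⟨r, hr, p.2, hpr⟩
  · intro u a es h δ
    obtain ⟨dn, x, rest, q₀, p, q, h₁, h₂, h₃, -, rfl, rfl, hp⟩ := hwork u a es h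
    rw [mem_problemValues, hext]
    simp only [mem_edgeList]
    constructor
    · rintro ⟨v, ⟨h₁, h₂, -⟩ | ⟨e, he, h₁, h₂, -⟩⟩
      · exact .inl ⟨h₁, h₂⟩
      · obtain ⟨r, hr, her⟩ := (heqs e).1 he
        exact .inr ⟨r, hr, e.2, by rwa [← h₁], h₂⟩
    · rintro (⟨h₁, h₂⟩ | ⟨r, hr, b, hb, h₂⟩)
      · exact ⟨_, .inl ⟨h₁, h₂, rfl⟩⟩
      · exact ⟨_, .inr ⟨(p.1, b), (heqs _).2 ⟨r, hr, hb⟩, rfl, h₂, rfl⟩⟩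
  · intro u a es h δ v w hv hw
    obtain ⟨dn, x, rest, q₀, p, q, h₁, h₂, h₃, -, rfl, rfl, hp⟩ := hwork u a es h
    rcases hfail p (p :: q) _ _ _ _ List.mem_cons_self hv with ⟨h₄, h₅⟩ | ⟨h₄, h₅, -⟩ <;>
    rcases hfail p (p :: q) _ _ _ _ List.mem_cons_self hw with ⟨h₆, h₇⟩ | ⟨h₆, h₇, -⟩
    · rw [h₅, h₇]
    · exact absurd h₄ h₆
    · exact absurd h₆ h₄
    · rw [h₅, h₇]
  · intro u a es h δ v hv
    obtain ⟨dn, x, rest, q₀, p, q, h₁, h₂, h₃, rfl, rfl, rfl, hp⟩ := hwork u a es h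
    have hlt := length_gRule_lt p q x.2.rhs
    rcases hfail p x.1 _ _ _ _ (by simp [h₂]) hv with ⟨-, rfl⟩ | ⟨-, rfl, hcf⟩
    · refine ⟨nodeName_strictMono ?_, _, mem_allDescs.2 (.inl ⟨dn, x, rest, q₀ ++ [p], q, h₁,
        by simp [h₂], h₃, rfl⟩)⟩
      simp only [List.length_append]
      omega
    · refine ⟨nodeName_strictMono ?_, exists_first (dn := dn ++ [x]) (by simp [h₁]) ?_⟩
      · simp only [List.length_append, List.length_tail]
        omega
      · intro y hy
        rcases List.mem_append.1 hy with hy | hy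
        · exact h₃ y hy
        · rw [List.mem_singleton.1 hy]
          exact hcf
  · intro u Z z h
    rcases mem_allDescs.1 h with ⟨dn, x, rest, q₀, q, h₁, h₂, h₃, h₄⟩ | ⟨-, h⟩
    · rcases q with - | ⟨p, q⟩
      · simp only [stateDesc, Prod.mk.injEq, Sum.inr.injEq] at h₄
        rw [h₄.2.1, Finset.singleton_subset_iff, hmemS]
        exact ⟨x, by simp [h₁], rfl⟩
      · simp [stateDesc] at h₄
    · simp only [Prod.mk.injEq, Sum.inr.injEq] at h
      simp [h.2.1]
  · intro v z h hne
    -- the node is entered from the preceding node or from the preceding rule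
    have hprev : ∀ (dn : List (List (ℕ × ℕ) × Rule)) (rest : List (List (ℕ × ℕ) × Rule)),
        rs = dn ++ rest → (∀ y ∈ dn, RuleCanFail ext eqs y.1) → dn ≠ [] →
        ∃ u a es δ, (u, Sum.inl (a, es)) ∈ allDescs ext eqs rs ∧
          (δ, nodeName (gRules rest).tail.length) ∈ es := by
      intro dn rest h₁ h₂ h₃
      obtain ⟨dn, x, rfl⟩ := List.eq_nil_or_concat' dn |>.resolve_left h₃
      obtain ⟨p, hp, hcf⟩ := h₂ x (by simp)
      obtain ⟨q₀, q, hq⟩ := List.append_of_mem hp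
      have hm : stateDesc ext eqs x rest (p :: q) ∈ allDescs ext eqs rs := mem_allDescs.2 (.inl
        ⟨dn, x, rest, q₀, p :: q, by simp [h₁], hq, fun y hy => h₂ y (by simp [hy]), rfl⟩)
      rcases hcf with hcf | ⟨e, he, h₄, h₅⟩
      · exact ⟨_, _, _, none, hm, mem_edgeList.2 (.inl ⟨hcf, rfl, rfl⟩)⟩
      · exact ⟨_, _, _, some e.2, hm, mem_edgeList.2 (.inr ⟨e, he, h₄, rfl, by rw [if_neg h₅]⟩)⟩
    rcases mem_allDescs.1 h with ⟨dn, x, rest, q₀, q, h₁, h₂, h₃, h₄⟩ | ⟨h₁, h₂⟩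
    · obtain rfl | ⟨q₀, p, rfl⟩ := List.eq_nil_or_concat' q₀
      · have hv : v = nodeName (gRules (x :: rest)).tail.length := by
          rw [List.nil_append] at h₂
          rw [gRules, List.tail_cons, h₂]
          exact congrArg Prod.fst h₄
        rw [hv]
        refine hprev dn (x :: rest) h₁ h₃ fun hdn => hne ?_
        rw [hv, h₁, hdn, List.nil_append]
      · have hp : p ∈ eqs := by
          rw [hdef, h₁]
          simp [h₂]
        have hv : v = (stateDesc ext eqs x rest q).1 := congrArg Prod.fst h₄
        exact ⟨_, _, _, some p.2, mem_allDescs.2 (.inl ⟨dn, x, rest, q₀, p :: q, h₁,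
          by simp [h₂], h₃, rfl⟩), mem_edgeList.2 (.inr ⟨p, hp, rfl, rfl, by rw [if_pos rfl, hv]; rfl⟩)⟩
    · have hv : v = nodeName (gRules []).tail.length := congrArg Prod.fst h₂
      rw [hv]
      refine hprev rs [] (by simp) h₁ fun hrs => hne ?_
      rw [hv, hrs]
  · rcases rs with - | ⟨x, rest⟩
    · exact .inr ⟨by simp, rfl, by simp⟩
    · exact .inl ⟨[], x, rest, [], x.1, rfl, rfl, by simp, rfl, by simp, by simp⟩
  · intro u a es δ v E h hv hInv
    rcases hInv with ⟨dn, x, rest, q₀, q, h₁, h₂, h₃, rfl, h₄, h₅⟩ | ⟨h₁, rfl, -⟩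
    -- Names determine descriptions, so the node `u` is the state recorded in the invariant.
    · have := desc_unique hnodup h (mem_allDescs.2 (.inl ⟨dn, x, rest, q₀, q, h₁, h₂, h₃, rfl⟩))
      rcases q with - | ⟨p, q⟩
      · simp at this
      simp only [Sum.inl.injEq, Prod.mk.injEq] at this
      obtain ⟨rfl, rfl⟩ := this
      have hx : x ∈ rs := by simp [h₁]
      have hpx : p ∈ x.1 := by simp [h₂]
      rcases hfail p x.1 _ _ _ _ hpx hv with ⟨rfl, rfl⟩ | ⟨h₆, rfl, hcf⟩
      · refine .inl ⟨dn, x, rest, q₀ ++ [p], q, h₁, by simp [h₂], h₃, rfl,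
          fun y hy => (h₄ y hy).mono (Finset.subset_insert _ _), ?_⟩
        simp only [List.mem_append, List.mem_singleton]
        rintro p' (hp' | rfl)
        · exact Finset.mem_insert_of_mem (h₅ p' hp')
        · exact Finset.mem_insert_self _ _
      · have hdn : ∀ y ∈ dn ++ [x], RuleCanFail ext eqs y.1 := by
          intro y hy
          rcases List.mem_append.1 hy with hy | hy
          · exact h₃ y hy
          · rw [List.mem_singleton.1 hy]
            exact hcf
        have hfa : ∀ y ∈ dn ++ [x], Falsifies (insert (p.1, δ) E) y.2 := by
          intro y hy
          rcases List.mem_append.1 hy with hy | hy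
          · exact (h₄ y hy).mono (Finset.subset_insert _ _)
          · rw [List.mem_singleton.1 hy]
            refine ⟨p, ?_, δ, Finset.mem_insert_self _ _, h₆⟩
            rwa [← hK x hx, List.mem_toFinset]
        -- After the last rule a failure leads to the node with the label `∅`, otherwise to the
        -- untouched next rule.
        rcases rest with - | ⟨y, rest⟩
        · rw [← h₁] at hdn hfa
          exact .inr ⟨hdn, rfl, hfa⟩
        · exact .inl ⟨dn ++ [x], y, rest, [], y.1, by simp [h₁], rfl, hdn, rfl, hfa, by simp⟩
    · simpa using desc_unique hnodup h (mem_allDescs.2 (.inr ⟨h₁, rfl⟩))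
  · intro u Z z E h hInv
    have key : (∀ r ∈ Z, r.eqs ⊆ E) ∧ (Z = ∅ → ∀ r ∈ S, ¬ Consistent (r.eqs ∪ E)) := by
      rcases hInv with ⟨dn, x, rest, q₀, q, h₁, h₂, h₃, rfl, h₄, h₅⟩ | ⟨h₁, rfl, h₂⟩
      · have := desc_unique hnodup h (mem_allDescs.2 (.inl ⟨dn, x, rest, q₀, q, h₁, h₂, h₃, rfl⟩))
        rcases q with - | ⟨p, q⟩
        · simp only [Sum.inr.injEq, Prod.mk.injEq] at this
          rw [this.1]
          refine ⟨fun r hr => ?_, fun h => absurd h (Finset.singleton_ne_empty _)⟩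
          rw [Finset.mem_singleton.1 hr]
          intro y hy
          obtain ⟨p, hp, rfl⟩ := Finset.mem_image.1 hy
          rw [← hK x (by simp [h₁]), List.mem_toFinset, h₂, List.append_nil] at hp
          exact h₅ p hp
        · simp at this
      · have := desc_unique hnodup h (mem_allDescs.2 (.inr ⟨h₁, rfl⟩))
        simp only [Sum.inr.injEq, Prod.mk.injEq] at this
        rw [this.1]
        refine ⟨by simp, fun _ r hr => ?_⟩
        obtain ⟨x, hx, rfl⟩ := (hmemS r).1 hr
        exact (h₂ x hx).not_consistent
    rcases hC with rfl | rfl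
    · exact key
    · exact key

/-- The problems `SR` and `ESR` have polynomial time algorithms. -/
theorem polyTimeConstructible_sr {C : Problem} (hC : C = .SR ∨ C = .ESR) (k d : ℕ) :
    PolyTimeConstructible C k d := by
  obtain ⟨ext, hext⟩ : ∃ ext : Bool, C.Extended ↔ ext = true := by
    classical
    exact ⟨decide C.Extended, by simp⟩
  have hin : Comp [fun i : InputWord k d => (Subtype.val i).map GLetter.sym]
      fun i => i.1.map GLetter.sym := .of_mem (by simp)
  -- The input occurs twice: once as the fixed word searched for the values of attributes, once as
  -- the word consumed by the recursion.
  refine ⟨_, ((hin.cons (.sym .semicolon)).rulesWord ext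
    (hin.cons (.sym .semicolon))).exists_machine, ?_⟩
  intro S hS w hw
  obtain ⟨rs, rfl, hK, hz, hw'⟩ := hw.exists_list
  have hne : rs ≠ [] := by
    rintro rfl
    simpa using hS.1
  have hg := map_sym_intercalate rs hne
  rw [← hw'] at hg
  refine ⟨graphOf (allDescs ext (rs.flatMap Prod.fst) rs), ?_, solves_allDescs hC hext hK⟩
  obtain ⟨L, hL, hLe⟩ := exists_scan_gRules rs
  simp only [hg]
  rw [rulesWord_gRules hL hLe]
  refine graphWord_graphOf (allDescs_sorted.1.imp fun h => h.ne') ?_ ?_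
  · intro u a es h
    rcases mem_allDescs.1 h with ⟨dn, x, rest, q₀, q, h₁, h₂, h₃, h₄⟩ | ⟨-, h⟩
    · rcases q with - | ⟨p, q⟩
      · simp [stateDesc] at h₄
      · simp only [stateDesc, Prod.mk.injEq, Sum.inl.injEq] at h₄
        rw [h₄.2.2]
        exact nodup_edgeList _ _ _ _ _
    · simp at h
  · intro u Z z h
    rcases mem_allDescs.1 h with ⟨dn, x, rest, q₀, q, h₁, h₂, h₃, h₄⟩ | ⟨-, h⟩
    · rcases q with - | ⟨p, q⟩
      · simp only [stateDesc, Prod.mk.injEq, Sum.inr.injEq] at h₄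
        rw [h₄.2.1, h₄.2.2]
        exact hz x (by simp [h₁])
      · simp [stateDesc] at h₄
    · simp only [Prod.mk.injEq, Sum.inr.injEq] at h
      rw [h.2.1, h.2.2]
      exact systemWord_empty

end

/-! ### The graph for the problems `AD` and `AR` in the case of one value per attribute -/

/-- The length of the suffix at which the first equation begins. -/
def firstPos : List (ℕ × (ℕ × ℕ)) → ℕ
  | [] => 0
  | (n, _) :: _ => n

/-- The descriptions of the nodes of the graph that tests all equations. -/
def chainDescs (S : Finset Rule) (z : List Letter) : List (ℕ × (ℕ × ℕ)) → List NodeDesc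
  | [] => [(nodeName 0, .inr (S, z))]
  | (n, e) :: L => (nodeName n, .inl (e.1, [(some e.2, nodeName (firstPos L))])) :: chainDescs S z L

theorem Scan.firstPos {l : List GLetter} {L : List (ℕ × (ℕ × ℕ))} (h : Scan l L) :
    (l.dropWhile (· ≠ .sym .lpar)).length = firstPos L := by
  induction h with
  | nil => rfl
  | skip hc _ ih =>
    rw [List.dropWhile_cons, if_pos (by simpa using hc)]
    exact ih
  | eqn hl _ ih =>
    rw [List.dropWhile_cons, if_neg (by simp)]
    rfl

theorem Scan.chainWord {l : List GLetter} {L : List (ℕ × (ℕ × ℕ))} (h : Scan l L)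
    (S : Finset Rule) (z : List Letter) :
    chainWord (z.map .sym) l = (chainDescs S z L).flatMap descWord := by
  induction h with
  | nil =>
    rw [DecisionRules.chainWord, nameWord_eq]
    simp [chainDescs, descWord]
  | skip hc _ ih => rw [DecisionRules.chainWord, if_neg hc, ih, List.nil_append]
  | @eqn p l l' L hl h ih =>
    have h₁ : indexPart l = gbinary p.1 := by rw [hl, indexPart_gEqn]
    have h₂ : valuePart l = gbinary p.2 := by rw [hl, valuePart_gEqn]
    rw [DecisionRules.chainWord, if_pos rfl, ih, h₁, h₂, nameWord_eq, nameWord_eq, h.firstPos,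
      chainDescs, List.flatMap_cons]
    refine congrArg (· ++ _) ?_
    simp only [descWord, List.map_cons, List.map_nil, List.flatten_cons, List.flatten_nil, edgeWord,
      valueWord, List.append_assoc, List.append_nil, List.length_cons]

/-- The appended `0` is the position of the terminal node; including it records that the positions
of equations are positive. -/
theorem Scan.sorted {l : List GLetter} {L : List (ℕ × (ℕ × ℕ))} (h : Scan l L) :
    (L.map Prod.fst ++ [0]).Pairwise (· > ·) ∧ ∀ n ∈ L.map Prod.fst, n ≤ l.length := by
  induction h with
  | nil => simp
  | skip _ _ ih => exact ⟨ih.1, fun n hn => (ih.2 n hn).trans (by simp)⟩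
  | eqn _ _ ih =>
    rw [List.map_cons, List.cons_append, List.pairwise_cons]
    refine ⟨⟨fun n hn => ?_, ih.1⟩, fun n hn => ?_⟩
    · rcases List.mem_append.1 hn with hn | hn
      · have := ih.2 n hn
        simp only
        omega
      · rw [List.mem_singleton.1 hn]
        simp
    · rcases List.mem_cons.1 hn with rfl | hn
      · simp
      · exact (ih.2 n hn).trans (by simp)

theorem map_fst_chainDescs (S : Finset Rule) (z : List Letter) (L : List (ℕ × (ℕ × ℕ))) :
    (chainDescs S z L).map Prod.fst = (L.map Prod.fst ++ [0]).map nodeName := by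
  induction L with
  | nil => rfl
  | cons x L ih =>
    obtain ⟨n, e⟩ := x
    rw [chainDescs, List.map_cons, ih]
    rfl

theorem mem_chainDescs {S : Finset Rule} {z : List Letter} {L : List (ℕ × (ℕ × ℕ))}
    {d : NodeDesc} : d ∈ chainDescs S z L ↔
      (∃ L₁ n e L₂, L = L₁ ++ (n, e) :: L₂ ∧
        d = (nodeName n, .inl (e.1, [(some e.2, nodeName (firstPos L₂))]))) ∨
      d = (nodeName 0, .inr (S, z)) := by
  induction L with
  | nil => simp [chainDescs]
  | cons x L ih =>
    obtain ⟨n, e⟩ := x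
    rw [chainDescs, List.mem_cons, ih]
    constructor
    · rintro (rfl | ⟨L₁, n', e', L₂, rfl, rfl⟩ | rfl)
      · exact .inl ⟨[], n, e, L, rfl, rfl⟩
      · exact .inl ⟨(n, e) :: L₁, n', e', L₂, rfl, rfl⟩
      · exact .inr rfl
    · rintro (⟨_ | ⟨y, L₁⟩, n', e', L₂, h, rfl⟩ | rfl)
      · simp only [List.nil_append, List.cons.injEq, Prod.mk.injEq] at h
        obtain ⟨⟨rfl, rfl⟩, rfl⟩ := h
        exact .inl rfl
      · simp only [List.cons_append, List.cons.injEq] at h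
        exact .inr (.inl ⟨L₁, n', e', L₂, h.2, rfl⟩)
      · exact .inr (.inr rfl)

/-- The invariant of the graph that tests all equations. -/
def ChainInv (L : List (ℕ × (ℕ × ℕ))) (u : ℕ) (E : Finset (ℕ × Option ℕ)) : Prop :=
  ∃ L₁ L₂, L = L₁ ++ L₂ ∧ u = nodeName (firstPos L₂) ∧
    ∀ x ∈ L₁, (x.2.1, some x.2.2) ∈ E

theorem exists_chainDescs {S : Finset Rule} {z : List Letter} {L₁ L₂ : List (ℕ × (ℕ × ℕ))} :
    ∃ x, (nodeName (firstPos L₂), x) ∈ chainDescs S z (L₁ ++ L₂) := by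
  rcases L₂ with - | ⟨⟨n, e⟩, L₂⟩
  · exact ⟨_, mem_chainDescs.2 (.inr rfl)⟩
  · exact ⟨_, mem_chainDescs.2 (.inl ⟨L₁, n, e, L₂, rfl, rfl⟩)⟩

theorem firstPos_lt {L₁ L₂ : List (ℕ × (ℕ × ℕ))} {n : ℕ} {e : ℕ × ℕ}
    (h : ((L₁ ++ (n, e) :: L₂).map Prod.fst ++ [0]).Pairwise (· > ·)) : firstPos L₂ < n := by
  rw [List.map_append, List.append_assoc] at h
  have h := (List.pairwise_append.1 h).2.1
  rw [List.map_cons, List.cons_append, List.pairwise_cons] at h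
  cases L₂ with
  | nil => exact h.1 0 (by simp)
  | cons y L₂ => exact h.1 _ (by simp [firstPos])

/-- Every working node has one leaving edge, labeled with the only value of its attribute. A
complete path thus meets all equations of `S`, and every rule of `S` is true. -/
theorem solves_chainDescs {C : Problem} (hC : C = .AD ∨ C = .AR) {S : Finset Rule}
    {z : List Letter} {L : List (ℕ × (ℕ × ℕ))}
    (hL : (L.map Prod.fst ++ [0]).Pairwise (· > ·))
    (heqs : ∀ p, p ∈ L.map Prod.snd ↔ ∃ r ∈ S, p ∈ r.K)
    (huniq : ∀ a, (values S a).card ≤ 1) :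
    (graphOf (chainDescs S z L)).Solves C S := by
  have hext : ¬ C.Extended := by
    rcases hC with rfl | rfl <;> simp [Problem.Extended]
  have hnodup : ((chainDescs S z L).map Prod.fst).Nodup := by
    rw [map_fst_chainDescs]
    exact List.Nodup.map nodeName_strictMono.injective (hL.imp fun h => h.ne')
  have hwork : ∀ u a es, (u, Sum.inl (a, es)) ∈ chainDescs S z L → ∃ L₁ n e L₂,
      L = L₁ ++ (n, e) :: L₂ ∧ u = nodeName n ∧ a = e.1 ∧
      es = [(some e.2, nodeName (firstPos L₂))] ∧ ∃ r ∈ S, e ∈ r.K := by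
    intro u a es h
    rcases mem_chainDescs.1 h with ⟨L₁, n, e, L₂, h₁, h₂⟩ | h
    · simp only [Prod.mk.injEq, Sum.inl.injEq] at h₂
      exact ⟨L₁, n, e, L₂, h₁, h₂.1, h₂.2.1, h₂.2.2, (heqs e).1 (by simp [h₁])⟩
    · simp at h
  have hroot : ∃ x, (nodeName (firstPos L), x) ∈ chainDescs S z L :=
    exists_chainDescs (L₁ := []) (L₂ := L)
  refine solves_graphOf hnodup ?_ ?_ ?_ ?_ ?_ (nodeName (firstPos L)) hroot ?_ ?_ (ChainInv L)
    ?_ ?_ ?_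
  · intro u a es h
    obtain ⟨L₁, n, e, L₂, h₁, rfl, rfl, rfl, r, hr, he⟩ := hwork u a es h
    exact mem_attrs.2 ⟨r, hr, e.2, he⟩
  · intro u a es h δ
    obtain ⟨L₁, n, e, L₂, h₁, rfl, rfl, rfl, r, hr, he⟩ := hwork u a es h
    simp only [mem_problemValues, hext, false_and, false_or, List.mem_singleton, Prod.mk.injEq,
      exists_and_left, exists_eq, and_true]
    constructor
    · rintro rfl
      exact ⟨r, hr, e.2, he, rfl⟩
    · rintro ⟨r', hr', b, hb, rfl⟩
      rw [Option.some.injEq]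
      exact Finset.card_le_one.1 (huniq e.1) _ (mem_values.2 ⟨r', hr', hb⟩) _
        (mem_values.2 ⟨r, hr, he⟩)
  · intro u a es h δ v w hv hw
    obtain ⟨L₁, n, e, L₂, h₁, rfl, rfl, rfl, -⟩ := hwork u a es h
    simp only [List.mem_singleton, Prod.mk.injEq] at hv hw
    rw [hv.2, hw.2]
  · intro u a es h δ v hv
    obtain ⟨L₁, n, e, L₂, h₁, rfl, rfl, rfl, -⟩ := hwork u a es h
    simp only [List.mem_singleton, Prod.mk.injEq] at hv
    rw [hv.2]
    refine ⟨nodeName_strictMono (firstPos_lt (h₁ ▸ hL)), ?_⟩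
    have := exists_chainDescs (S := S) (z := z) (L₁ := L₁ ++ [(n, e)]) (L₂ := L₂)
    rwa [List.append_assoc, List.singleton_append, ← h₁] at this
  · intro u Z z' h
    rcases mem_chainDescs.1 h with ⟨L₁, n, e, L₂, h₁, h₂⟩ | h
    · simp at h₂
    · simp only [Prod.mk.injEq, Sum.inr.injEq] at h
      rw [h.2.1]
  · intro u x h
    have h₁ : u ∈ (chainDescs S z L).map Prod.fst := List.mem_map.2 ⟨_, h, rfl⟩
    rw [map_fst_chainDescs] at h₁
    obtain ⟨n, hn, rfl⟩ := List.mem_map.1 h₁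
    refine nodeName_strictMono.monotone ?_
    rcases L with - | ⟨⟨n', e⟩, L⟩
    · simpa [firstPos] using hn
    · rw [List.map_cons, List.cons_append, List.pairwise_cons] at hL
      rw [List.map_cons, List.cons_append, List.mem_cons] at hn
      rcases hn with rfl | hn
      · exact le_rfl
      · exact (hL.1 n hn).le
  · intro v x h hne
    have key : ∀ L₁ L₂, L = L₁ ++ L₂ → v = nodeName (firstPos L₂) →
        ∃ u a es δ, (u, Sum.inl (a, es)) ∈ chainDescs S z L ∧ (δ, v) ∈ es := by
      rintro L₁ L₂ h₁ rfl
      obtain rfl | ⟨L₁, ⟨n, e⟩, rfl⟩ := List.eq_nil_or_concat' L₁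
      · exact absurd (by rw [h₁, List.nil_append]) hne
      · exact ⟨_, _, _, some e.2, mem_chainDescs.2 (.inl ⟨L₁, n, e, L₂, by simp [h₁], rfl⟩),
          List.mem_singleton.2 rfl⟩
    rcases mem_chainDescs.1 h with ⟨L₁, n, e, L₂, h₁, h₂⟩ | h
    · exact key L₁ _ h₁ (congrArg Prod.fst h₂)
    · exact key L [] (by simp) (congrArg Prod.fst h)
  · exact ⟨[], L, rfl, rfl, by simp⟩
  · rintro u a es δ v E h hv ⟨L₁, L₂, h₁, rfl, h₂⟩
    rcases L₂ with - | ⟨⟨n, e⟩, L₂⟩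
    · have := desc_unique hnodup h (mem_chainDescs.2 (.inr rfl))
      simp at this
    · have := desc_unique hnodup h (mem_chainDescs.2 (.inl ⟨L₁, n, e, L₂, h₁, rfl⟩))
      simp only [Sum.inl.injEq, Prod.mk.injEq] at this
      obtain ⟨rfl, rfl⟩ := this
      simp only [List.mem_singleton, Prod.mk.injEq] at hv
      obtain ⟨rfl, rfl⟩ := hv
      refine ⟨L₁ ++ [(n, e)], L₂, by simp [h₁], rfl, fun x hx => ?_⟩
      rcases List.mem_append.1 hx with hx | hx
      · exact Finset.mem_insert_of_mem (h₂ x hx)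
      · rw [List.mem_singleton.1 hx]
        exact Finset.mem_insert_self _ _
  · rintro u Z z' E h ⟨L₁, L₂, h₁, rfl, h₂⟩
    rcases L₂ with - | ⟨⟨n, e⟩, L₂⟩
    · have := desc_unique hnodup h (mem_chainDescs.2 (.inr rfl))
      simp only [Sum.inr.injEq, Prod.mk.injEq] at this
      obtain ⟨rfl, rfl⟩ := this
      rw [List.append_nil] at h₁
      subst h₁
      refine ⟨fun r hr y hy => ?_, ?_⟩
      · obtain ⟨p, hp, rfl⟩ := Finset.mem_image.1 hy
        obtain ⟨x, hx, rfl⟩ := List.mem_map.1 ((heqs p).2 ⟨r, hr, hp⟩)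
        exact h₂ x hx
      -- The label is all of `S`, so no rule remains to be refuted.
      · rcases hC with rfl | rfl <;> simp
    · have := desc_unique hnodup h (mem_chainDescs.2 (.inl ⟨L₁, n, e, L₂, h₁, rfl⟩))
      simp at this

theorem card_values_le (S : Finset Rule) (a : ℕ) : (values S a).card ≤ maxValues S := by
  by_cases h : a ∈ attrs S
  · exact Finset.le_sup (f := fun a => (values S a).card) h
  · have : values S a = ∅ := by
      refine Finset.eq_empty_of_forall_notMem fun δ hδ => h ?_
      obtain ⟨r, hr, hδ⟩ := mem_values.1 hδ
      exact mem_attrs.2 ⟨r, hr, δ, hδ⟩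
    simp [this]

/-- The problems `AD` and `AR` have polynomial time algorithms if every attribute has only one
value. -/
theorem polyTimeConstructible_ad {C : Problem} (hC : C = .AD ∨ C = .AR) (d : ℕ) :
    PolyTimeConstructible C 1 d := by
  have hin : Comp [fun i : InputWord 1 d => (Subtype.val i).map GLetter.sym]
      fun i => i.1.map GLetter.sym := .of_mem (by simp)
  refine ⟨_, (hin.chainWord (hin.cons (.sym .semicolon))).exists_machine, ?_⟩
  intro S hS w hw
  obtain ⟨rs, hrs, hK, hz, hw'⟩ := hw.exists_list
  have hne : rs ≠ [] := by
    rintro rfl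
    simpa [← hrs] using hS.1
  have hg := map_sym_intercalate rs hne
  rw [← hw'] at hg
  obtain ⟨L, hL, hLe⟩ := exists_scan_gRules rs
  have heqs : ∀ p, p ∈ L.map Prod.snd ↔ ∃ r ∈ S, p ∈ r.K := by
    intro p
    rw [hLe, ← hrs]
    simp only [List.mem_flatMap, List.mem_toFinset, List.mem_map]
    constructor
    · rintro ⟨x, hx, hp⟩
      exact ⟨x.2, ⟨x, hx, rfl⟩, by rwa [← hK x hx, List.mem_toFinset]⟩
    · rintro ⟨_, ⟨x, hx, rfl⟩, hp⟩
      rw [← hK x hx, List.mem_toFinset] at hp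
      exact ⟨x, hx, hp⟩
  refine ⟨graphOf (chainDescs S w L), ?_, solves_chainDescs hC hL.sorted.1 heqs
    fun a => (card_values_le S a).trans hS.2.1.le⟩
  simp only [hg]
  rw [hL.chainWord S w]
  refine graphWord_graphOf ?_ ?_ ?_
  · rw [map_fst_chainDescs]
    exact List.Nodup.map nodeName_strictMono.injective (hL.sorted.1.imp fun h => h.ne')
  · intro u a es h
    rcases mem_chainDescs.1 h with ⟨L₁, n, e, L₂, h₁, h₂⟩ | h
    · simp only [Prod.mk.injEq, Sum.inl.injEq] at h₂
      rw [h₂.2.2]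
      exact List.nodup_singleton _
    · simp at h
  · intro u Z z h
    rcases mem_chainDescs.1 h with ⟨L₁, n, e, L₂, h₁, h₂⟩ | h
    · simp at h₂
    · simp only [Prod.mk.injEq, Sum.inr.injEq] at h
      rw [h.2.1, h.2.2]
      exact hw

/-! ### The length of the output of a Turing machine -/

section OutputLength

open Turing Function

/-- The number of `push` instructions in a statement. -/
def pushes {K : Type*} {Γ : K → Type*} {Λ σ : Type*} : TM2.Stmt Γ Λ σ → ℕ
  | .push _ _ q => pushes q + 1
  | .peek _ _ q => pushes q
  | .pop _ _ q => pushes q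
  | .load _ q => pushes q
  | .branch _ q₁ q₂ => pushes q₁ + pushes q₂
  | .goto _ => 0
  | .halt => 0

theorem length_stk_stepAux_le {K : Type*} [DecidableEq K] {Γ : K → Type*} {Λ σ : Type*}
    (q : TM2.Stmt Γ Λ σ) (v : σ) (S : ∀ k, List (Γ k)) (k : K) :
    ((TM2.stepAux q v S).stk k).length ≤ (S k).length + pushes q := by
  induction q generalizing v S with
  | push j f q ih =>
    refine (ih _ _).trans ?_
    rcases eq_or_ne k j with rfl | h
    · simp only [update_self, List.length_cons, pushes]
      omega
    · simp only [update_of_ne h, pushes]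
      omega
  | peek j f q ih => exact ih _ _
  | pop j f q ih =>
    refine (ih _ _).trans ?_
    rcases eq_or_ne k j with rfl | h
    · simp [pushes]
    · simp [pushes, update_of_ne h]
  | load f q ih => exact ih _ _
  | branch f q₁ q₂ ih₁ ih₂ =>
    have h₁ := ih₁ v S
    have h₂ := ih₂ v S
    simp only [TM2.stepAux, pushes]
    cases f v <;> simp only [cond_true, cond_false] <;> omega
  | goto f => simp [pushes]
  | halt => simp [pushes]

/-- One machine step executes one statement, and this lengthens a stack by at most the number of its
`push` instructions. -/
theorem length_stk_le_of_iterate {K : Type*} [DecidableEq K] {Γ : K → Type*} {Λ σ : Type*}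
    {m : Λ → TM2.Stmt Γ Λ σ} {b : ℕ} (hb : ∀ l, pushes (m l) ≤ b) (k : K) (n : ℕ)
    (c c' : TM2.Cfg Γ Λ σ) (h : (flip bind (TM2.step m))^[n] (some c) = some c') :
    (c'.stk k).length ≤ (c.stk k).length + b * n := by
  induction n generalizing c with
  | zero =>
    obtain rfl : c = c' := by simpa using h
    simp
  | succ n ih =>
    rw [iterate_succ_apply] at h
    rcases c with ⟨_ | l, v, S⟩
    · have hn : ∀ n, (flip bind (TM2.step m))^[n] none = none := fun n =>
        iterate_fixed rfl n
      have : flip bind (TM2.step m) (some (⟨none, v, S⟩ : TM2.Cfg Γ Λ σ)) = none := rfl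
      rw [this, hn] at h
      simp at h
    · have := ih _ h
      have h₁ := length_stk_stepAux_le (m l) v S k
      have h₂ := hb l
      simp only [mul_add, mul_one]
      omega

/-- A polynomial time Turing machine writes words of polynomial length. -/
theorem exists_length_output_le {α A B : Type} {v : α → List A} {f : α → List B}
    (M : TM2ComputableInPolyTime v id f) :
    ∃ P : Polynomial ℕ, ∀ a, (f a).length ≤ P.eval (v a).length := by
  have := M.tm.ΛFin
  obtain ⟨b, hb⟩ : ∃ b, ∀ l, pushes (M.tm.m l) ≤ b :=
    ⟨Finset.univ.sup fun l => pushes (M.tm.m l), fun l =>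
      Finset.le_sup (f := fun l => pushes (M.tm.m l)) (Finset.mem_univ l)⟩
  -- The term `X` accounts for the initial contents, since the output stack may be the input stack.
  refine ⟨.X + .C b * M.time, fun a => ?_⟩
  have h := M.outputsFun a
  have h₁ := length_stk_le_of_iterate hb M.tm.k₁ h.steps
    (initList M.tm (List.map M.inputAlphabet.invFun (v a)))
    (haltList M.tm (List.map M.outputAlphabet.invFun (f a))) h.evals_in_steps
  have h₂ : ∀ s, ((initList M.tm s).stk M.tm.k₁).length ≤ s.length := by
    intro s
    have : ∀ k, ((initList M.tm s).stk k).length ≤ s.length := by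
      intro k
      by_cases hk : k = M.tm.k₀
      · subst hk
        simp [initList]
      · simp [initList, hk]
    exact this _
  have h₃ : ∀ s, ((haltList M.tm s).stk M.tm.k₁).length = s.length := by
    intro s
    simp [haltList]
  have h₄ := h₂ (List.map M.inputAlphabet.invFun (v a))
  have h₅ := Nat.mul_le_mul_left b h.steps_le_m
  rw [h₃] at h₁
  simp only [List.length_map, id] at h₁ h₄ h₅
  simp only [Polynomial.eval_add, Polynomial.eval_X, Polynomial.eval_mul, Polynomial.eval_C]
  omega

theorem NodeWord.length_pos {G : LabeledGraph} {u : ℕ} {w : List GLetter}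
    (h : NodeWord G u w) : 0 < w.length := by
  unfold NodeWord at h
  split at h
  · obtain ⟨es, -, -, rfl⟩ := h
    simp
  · obtain ⟨z, -, rfl⟩ := h
    simp

/-- The description of each node contains at least its opening mark. -/
theorem GraphWord.card_nodes_le {G : LabeledGraph} {w : List GLetter} (h : GraphWord G w) :
    G.nodes.card ≤ w.length := by
  obtain ⟨l, ws, hl, hG, hws, rfl⟩ := h
  rw [← hG, List.toFinset_card_of_nodup hl]
  clear hl hG
  induction hws with
  | nil => simp
  | cons h _ ih =>
    have := h.length_pos
    simp only [List.length_cons, List.flatten_cons, List.length_append]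
    omega

end OutputLength

/-! ### Complete paths that agree with a tuple of values -/

namespace LabeledGraph

variable {G : LabeledGraph} {C : Problem} {S : Finset Rule}

/-- Along an edge from `u` to `v` the finite set of nodes reachable by a nonempty path shrinks
strictly: it loses `v`, which lies on no cycle. -/
theorem IsDecisionGraph.wellFounded (hG : G.IsDecisionGraph C S) :
    WellFounded (flip G.Adj) := by
  classical
  let R : ℕ → Finset ℕ := fun u => G.nodes.filter fun w => Relation.TransGen G.Adj u w
  refine Subrelation.wf (r := fun v u => (R v).card < (R u).card) ?_
    (measure fun u => (R u).card).wf
  intro v u (h : G.Adj u v)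
  obtain ⟨δ, hδ⟩ := h
  have h : G.Adj u v := ⟨δ, hδ⟩
  refine Finset.card_lt_card ⟨fun w hw => ?_, fun hsub => ?_⟩
  · exact Finset.mem_filter.2 ⟨(Finset.mem_filter.1 hw).1, .head h (Finset.mem_filter.1 hw).2⟩
  · have := hsub (Finset.mem_filter.2 ⟨(hG.edges_nodes _ _ _ hδ).2, .single h⟩)
    exact hG.acyclic v (Finset.mem_filter.1 this).2

/-- For any tuple `t` of values of the attributes, there is a path from any node to a terminal node
that agrees with `t`. -/
theorem IsDecisionGraph.exists_path (hG : G.IsDecisionGraph C S) (t : ℕ → Option ℕ)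
    (ht : ∀ a ∈ attrs S, t a ∈ problemValues C S a) {u : ℕ} (hu : u ∈ G.nodes) :
    ∃ E v, G.Path u E v ∧ G.IsTerminal v ∧ ∀ p ∈ E, p.2 = t p.1 := by
  induction u using hG.wellFounded.induction with
  | _ u ih =>
    by_cases hT : G.IsTerminal u
    · exact ⟨[], u, .nil u, hT, by simp⟩
    · obtain ⟨a, ha, hl, he, -⟩ := hG.working u hu hT
      obtain ⟨v, hv⟩ := (he (t a)).2 (ht a ha)
      obtain ⟨E, w, hE, hw, hp⟩ := ih v ⟨_, hv⟩ (hG.edges_nodes _ _ _ hv).2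
      exact ⟨(a, t a) :: E, w, .cons hl hv hE, hw, by simpa using hp⟩

end LabeledGraph

theorem consistent_of_agree {E : Finset (ℕ × Option ℕ)} {t : ℕ → Option ℕ}
    (h : ∀ p ∈ E, p.2 = t p.1) : Consistent E := fun p hp q hq hpq => by
  rw [h p hp, h q hq, hpq]

/-- If the graph `G` solves one of the problems `AR`, `AD`, `EAR`, `EAD`, then for any tuple `t` of
values, some terminal node is labeled with rules that have exactly the same right-hand sides as
the rules that are true for `t`. -/
theorem LabeledGraph.Solves.exists_terminal {C : Problem}
    (hC : C = .AD ∨ C = .AR ∨ C = .EAD ∨ C = .EAR)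
    {G : LabeledGraph} {S : Finset Rule} (hG : G.Solves C S) (t : ℕ → Option ℕ)
    (ht : ∀ a ∈ attrs S, t a ∈ problemValues C S a) :
    ∃ v ∈ G.nodes, ∃ τ, G.label v = .rules τ ∧
      ∀ σ, σ ∈ decisions τ ↔ ∃ r ∈ S, r.rhs = σ ∧ ∀ p ∈ r.eqs, p.2 = t p.1 := by
  obtain ⟨u, hu, -⟩ := hG.1.root
  obtain ⟨E, v, hE, hv, hp⟩ := hG.1.exists_path t ht hu.1
  obtain ⟨τ, hτS, hτ⟩ := hG.1.terminal v hv
  have hp' : ∀ p ∈ E.toFinset, p.2 = t p.1 := by simpa using hp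
  have hans := hG.2 u E v τ hu hE hv hτ (consistent_of_agree hp')
  refine ⟨v, hv.1, τ, hτ, fun σ => ⟨fun h => ?_, ?_⟩⟩
  · obtain ⟨r, hr, rfl⟩ := Finset.mem_image.1 h
    exact ⟨r, hτS hr, rfl, fun p h => hp' p (hans.1 r hr h)⟩
  · rintro ⟨r, hr, rfl, h⟩
    by_contra hn
    have hrτ : r ∉ τ := fun h => hn (Finset.mem_image_of_mem _ h)
    -- The rule and the path both agree with `t`, so together they are consistent; a solution may
    -- therefore not omit the decision of this rule.
    have hc : Consistent (r.eqs ∪ E.toFinset) :=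
      consistent_of_agree (t := t) fun p h' => (Finset.mem_union.1 h').elim (h p) (hp' p)
    rcases hC with rfl | rfl | rfl | rfl
    · exact hans.2 r (Finset.mem_sdiff.2 ⟨hr, hrτ⟩) hn hc
    · exact hans.2 r (Finset.mem_sdiff.2 ⟨hr, hrτ⟩) hc
    · exact hans.2 r (Finset.mem_sdiff.2 ⟨hr, hrτ⟩) hn hc
    · exact hans.2 r (Finset.mem_sdiff.2 ⟨hr, hrτ⟩) hc

/-! ### Rule systems that require large graphs -/

/-- A linear bound suffices, because the numbers in the large systems are at most `n + k`. -/
theorem length_binary_le (n : ℕ) : (binary n).length ≤ n + 1 := by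
  unfold binary
  split
  · simp
  · simp only [List.length_map, List.length_reverse]
    rw [Nat.size_eq_bits_len, Nat.size_le]
    exact Nat.lt_two_pow_self.trans (Nat.pow_lt_pow_right one_lt_two n.lt_succ_self)

theorem length_intercalate_le {α : Type*} {b : ℕ} (s : α) (ls : List (List α))
    (h : ∀ l ∈ ls, l.length ≤ b) : ([s].intercalate ls).length ≤ ls.length * (b + 1) := by
  induction ls with
  | nil => simp [List.intercalate]
  | cons l ls ih =>
    have h₁ := h l (by simp)
    have h₂ := ih fun l hl => h l (by simp [hl])
    cases ls with
    | nil => simp [List.intercalate]; omega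
    | cons l' ls =>
      simp only [List.intercalate_cons_cons, List.length_append, List.length_cons,
        List.length_nil, add_mul] at h₂ ⊢
      omega

/-- A bound for the size of a rule system. -/
theorem exists_systemWord_length_le {S : Finset Rule} {m d : ℕ}
    (h : ∀ r ∈ S, r.length ≤ d ∧ r.rhs ≤ m ∧ ∀ p ∈ r.K, p.1 ≤ m ∧ p.2 ≤ m) :
    ∃ w, SystemWord S w ∧ w.length ≤ S.card * (d * (2 * m + 7) + m + 3) := by
  let g : Rule → List Letter := fun r =>
    [Letter.and].intercalate (r.K.toList.map eqnWord) ++ [.arrow] ++ binary r.rhs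
  refine ⟨_, ⟨S.toList, S.toList.map g, S.nodup_toList, S.toList_toFinset, ?_, rfl⟩, ?_⟩
  · rw [List.forall₂_map_right_iff, List.forall₂_same]
    exact fun r _ => ⟨r.K.toList, r.K.nodup_toList, r.K.toList_toFinset, rfl⟩
  -- An equation takes at most `2 * m + 6` letters and a separator; the arrow and the right-hand
  -- side take `m + 2`, and the semicolon one more.
  · refine (length_intercalate_le (b := d * (2 * m + 7) + m + 2) _ _ ?_).trans ?_
    · simp only [List.mem_map, Finset.mem_toList, forall_exists_index, and_imp,
        forall_apply_eq_imp_iff₂]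
      intro r hr
      obtain ⟨h₁, h₂, h₃⟩ := h r hr
      have h₄ : ([Letter.and].intercalate (r.K.toList.map eqnWord)).length ≤
          (r.K.toList.map eqnWord).length * (2 * m + 6 + 1) := by
        refine length_intercalate_le _ _ ?_
        simp only [List.mem_map, Finset.mem_toList, forall_exists_index, and_imp,
          forall_apply_eq_imp_iff₂]
        intro p hp
        have := length_binary_le p.1
        have := length_binary_le p.2
        have := h₃ p hp
        simp only [eqnWord, List.length_append, List.length_cons, List.length_nil]
        omega
      rw [List.length_map, Finset.length_toList] at h₄
      have h₅ := length_binary_le r.rhs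
      have h₆ : r.K.card * (2 * m + 6 + 1) ≤ d * (2 * m + 7) := Nat.mul_le_mul_right _ h₁
      simp only [g, List.length_append, List.length_cons, List.length_nil]
      omega
    · simp

/-- The rule `(a_i = δ) → σ`. -/
def unitRule (i δ σ : ℕ) : Rule where
  K := {(i, δ)}
  distinct p hp q hq _ := by
    rw [Finset.mem_singleton.1 hp, Finset.mem_singleton.1 hq]
  rhs := σ

/-- The rule `(a_0 = 0) ∧ ⋯ ∧ (a_{d-1} = 0) → 0`. -/
def zerosRule (d : ℕ) : Rule where
  K := (Finset.range d).image fun i => (i, 0)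
  distinct p hp q hq h := by
    obtain ⟨i, -, rfl⟩ := Finset.mem_image.1 hp
    obtain ⟨j, -, rfl⟩ := Finset.mem_image.1 hq
    exact congrArg (fun i => (i, 0)) h
  rhs := 0

/-- The rules `(a_i = 0) → i + 1` and `(a_i = j) → 0`, for `i < n` and `0 < j < k`, and the rule
`(a_0 = 0) ∧ ⋯ ∧ (a_{d-1} = 0) → 0`. -/
def largeSystem (k d n : ℕ) : Finset Rule :=
  insert (zerosRule d) ((Finset.range n ×ˢ Finset.range k).image fun p =>
    unitRule p.1 p.2 (if p.2 = 0 then p.1 + 1 else 0))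

variable {k d n : ℕ}

theorem mem_largeSystem {r : Rule} : r ∈ largeSystem k d n ↔ r = zerosRule d ∨
    ∃ i < n, ∃ j < k, r = unitRule i j (if j = 0 then i + 1 else 0) := by
  simp only [largeSystem, Finset.mem_insert, Finset.mem_image, Finset.mem_product, Finset.mem_range,
    Prod.exists]
  constructor
  · rintro (h | ⟨i, j, ⟨hi, hj⟩, rfl⟩)
    exacts [.inl h, .inr ⟨i, hi, j, hj, rfl⟩]
  · rintro (h | ⟨i, hi, j, hj, rfl⟩)
    exacts [.inl h, .inr ⟨i, j, ⟨hi, hj⟩, rfl⟩]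

theorem values_largeSystem (hk : 0 < k) (hd : d ≤ n) (a : ℕ) :
    values (largeSystem k d n) a = if a < n then Finset.range k else ∅ := by
  ext δ
  rw [mem_values]
  constructor
  · rintro ⟨r, hr, h⟩
    rcases mem_largeSystem.1 hr with rfl | ⟨i, hi, j, hj, rfl⟩
    · simp only [zerosRule, Finset.mem_image, Finset.mem_range, Prod.mk.injEq] at h
      obtain ⟨i, hi, rfl, rfl⟩ := h
      simp [show i < n by omega, hk]
    · simp only [unitRule, Finset.mem_singleton, Prod.mk.injEq] at h
      obtain ⟨rfl, rfl⟩ := h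
      simp [hi, hj]
  · intro h
    split at h
    · next ha =>
      exact ⟨_, mem_largeSystem.2 (.inr ⟨a, ha, δ, Finset.mem_range.1 h, rfl⟩), by simp [unitRule]⟩
    · simp at h

theorem attrs_largeSystem (hk : 0 < k) (hd : d ≤ n) :
    attrs (largeSystem k d n) = Finset.range n := by
  ext a
  have : a ∈ attrs (largeSystem k d n) ↔ ∃ δ, δ ∈ values (largeSystem k d n) a := by
    simp only [mem_attrs, mem_values]
    exact ⟨fun ⟨r, hr, δ, h⟩ => ⟨δ, r, hr, h⟩, fun ⟨δ, r, hr, h⟩ => ⟨r, hr, δ, h⟩⟩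
  rw [this, Finset.mem_range]
  simp only [values_largeSystem hk hd]
  split
  · next h => simpa [h] using ⟨0, hk⟩
  · next h => simp [h]

theorem length_zerosRule : (zerosRule d).length = d := by
  rw [Rule.length, zerosRule, Finset.card_image_of_injective _ fun i j h => (Prod.mk.inj h).1,
    Finset.card_range]

theorem length_le_of_mem_largeSystem (hd : 0 < d) {r : Rule} (hr : r ∈ largeSystem k d n) :
    r.length ≤ d := by
  rcases mem_largeSystem.1 hr with rfl | ⟨i, hi, j, hj, rfl⟩
  · exact length_zerosRule.le
  · exact (Finset.card_singleton _).trans_le hd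

/-- The unit rules give each of the `n` attributes exactly the values below `k`, and `zerosRule d`
serves only to attain the length `d`; by `d ≤ n` it brings in no further attribute. -/
theorem largeSystem_mem_sigma (hk : 0 < k) (hd : 0 < d) (hn : d ≤ n) :
    largeSystem k d n ∈ Sigma k d := by
  have hz : zerosRule d ∈ largeSystem k d n := mem_largeSystem.2 (.inl rfl)
  refine ⟨⟨_, hz⟩, ?_, ?_⟩
  · refine le_antisymm (Finset.sup_le fun a ha => ?_) ?_
    · rw [values_largeSystem hk hn]
      split <;> simp
    · rw [maxValues, attrs_largeSystem hk hn]
      refine le_trans ?_ (Finset.le_sup (b := 0) (Finset.mem_range.2 (by omega)))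
      rw [values_largeSystem hk hn, if_pos (by omega), Finset.card_range]
  · refine le_antisymm (Finset.sup_le fun r hr => length_le_of_mem_largeSystem hd hr) ?_
    exact length_zerosRule.symm.le.trans (Finset.le_sup (f := Rule.length) hz)

theorem exists_systemWord_largeSystem (hd : 0 < d) (hn : d ≤ n) :
    ∃ w, SystemWord (largeSystem k d n) w ∧
      w.length ≤ (n * k + 1) * (d * (2 * (n + k) + 7) + (n + k) + 3) := by
  obtain ⟨w, hw, h⟩ := exists_systemWord_length_le (S := largeSystem k d n) (m := n + k) (d := d) <| by
    intro r hr
    refine ⟨length_le_of_mem_largeSystem hd hr, ?_⟩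
    rcases mem_largeSystem.1 hr with rfl | ⟨i, hi, j, hj, rfl⟩
    · refine ⟨Nat.zero_le _, fun p hp => ?_⟩
      obtain ⟨i, hi, rfl⟩ := Finset.mem_image.1 hp
      have := Finset.mem_range.1 hi
      exact ⟨by simp only; omega, Nat.zero_le _⟩
    · refine ⟨?_, fun p hp => ?_⟩
      · simp only [unitRule]
        split <;> omega
      · rw [Finset.mem_singleton.1 hp]
        exact ⟨by simp only; omega, by simp only; omega⟩
  refine ⟨w, hw, h.trans (Nat.mul_le_mul_right _ ?_)⟩
  refine (Finset.card_insert_le _ _).trans (Nat.succ_le_succ (Finset.card_image_le.trans ?_))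
  simp

/-- A graph that solves one of the problems `AR`, `AD`, `EAR`, `EAD` for `largeSystem k d n` has at
least `2 ^ n` nodes, if the attributes can have a value `x` that is different from `0`. -/
theorem LabeledGraph.Solves.two_pow_le_card {C : Problem}
    (hC : C = .AD ∨ C = .AR ∨ C = .EAD ∨ C = .EAR) (hk : 0 < k) (hn : d ≤ n)
    {G : LabeledGraph} (hG : G.Solves C (largeSystem k d n)) {x : Option ℕ} (hx : x ≠ some 0)
    (hx' : ∀ a < n, x ∈ problemValues C (largeSystem k d n) a) : 2 ^ n ≤ G.nodes.card := by
  classical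
  have h : ∀ T : Finset ℕ, ∃ v ∈ G.nodes, ∃ τ, G.label v = .rules τ ∧
      ∀ i < n, i + 1 ∈ decisions τ ↔ i ∈ T := by
    intro T
    -- The subset `T` is encoded by the tuple with value `0` on `T` and `x` elsewhere.
    obtain ⟨v, hv, τ, hτ, h⟩ := hG.exists_terminal hC (fun a => if a ∈ T then some 0 else x) <| by
      intro a ha
      rw [attrs_largeSystem hk hn, Finset.mem_range] at ha
      split
      · refine mem_problemValues.2 (.inr ⟨_, mem_largeSystem.2 (.inr ⟨a, ha, 0, hk, rfl⟩), 0, ?_, rfl⟩)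
        simp [unitRule]
      · exact hx' a ha
    refine ⟨v, hv, τ, hτ, fun i hi => (h _).trans ⟨?_, fun hT => ?_⟩⟩
    -- A positive decision `i + 1` can come only from `(a_i = 0) → i + 1`.
    · rintro ⟨r, hr, hri, hp⟩
      rcases mem_largeSystem.1 hr with rfl | ⟨i', hi', j, hj, rfl⟩
      · simp [zerosRule] at hri
      · by_cases hj0 : j = 0
        · subst hj0
          obtain rfl : i' = i := by simpa [unitRule] using hri
          have := hp (i', some 0) (by simp [Rule.eqs, unitRule])
          by_contra hT
          simp only [hT, if_false] at this
          exact hx this.symm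
        · simp [unitRule, hj0] at hri
    · refine ⟨_, mem_largeSystem.2 (.inr ⟨i, hi, 0, hk, rfl⟩), by simp [unitRule], fun p hp => ?_⟩
      obtain rfl : p = (i, some 0) := by simpa [Rule.eqs, unitRule] using hp
      simp [hT]
  choose v hv τ hτ h using h
  -- The label of the node determines the subset `T` of `range n`.
  have hinj : Set.InjOn v ((Finset.range n).powerset : Finset (Finset ℕ)) := by
    intro T hT T' hT' he
    have he' : τ T = τ T' := by
      have := hτ T
      rw [he, hτ T'] at this
      injection this.symm
    rw [Finset.mem_coe, Finset.mem_powerset] at hT hT'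
    ext i
    constructor
    · intro hi
      rwa [← h T' i (Finset.mem_range.1 (hT hi)), ← he', h T i (Finset.mem_range.1 (hT hi))]
    · intro hi
      rwa [← h T i (Finset.mem_range.1 (hT' hi)), he', h T' i (Finset.mem_range.1 (hT' hi))]
  calc 2 ^ n = (Finset.range n).powerset.card := by simp
    _ ≤ G.nodes.card := Finset.card_le_card_of_injOn v (fun T _ => hv T) hinj

-- By additivity the quotient `P(n) / 2 ^ n` has to be studied only for monomials, where it tends to
-- `0`.
open Filter in
theorem eventually_eval_lt_two_pow (P : Polynomial ℕ) : ∀ᶠ n : ℕ in atTop, P.eval n < 2 ^ n := by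
  have h : Tendsto (fun n : ℕ => ((P.eval n : ℕ) : ℝ) / 2 ^ n) atTop (nhds 0) := by
    induction P using Polynomial.induction_on' with
    | add P Q hP hQ => simpa [add_div] using hP.add hQ
    | monomial m c =>
      have := (tendsto_pow_const_div_const_pow_of_one_lt m (one_lt_two (α := ℝ))).const_mul (c : ℝ)
      simpa [mul_div_assoc] using this
  filter_upwards [h.eventually (gt_mem_nhds one_pos)] with n hn
  rw [div_lt_one (by positivity)] at hn
  exact_mod_cast hn

/-- For large `n` the `2 ^ n` nodes forced by `largeSystem k d n` exceed the length of any output: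
the latter is at most `P` of the input size, and the input size is at most `R(n)`. -/
theorem not_polyTimeConstructible {C : Problem}
    (hC : C = .AD ∨ C = .AR ∨ C = .EAD ∨ C = .EAR) (hk : 0 < k) (hd : 0 < d)
    (h : C.Extended ∨ 2 ≤ k) : ¬ PolyTimeConstructible C k d := by
  rintro ⟨f, ⟨M, -⟩, hf⟩
  obtain ⟨P, hP⟩ := exists_length_output_le M
  let R : Polynomial ℕ := (.X * .C k + 1) * (.C d * (2 * (.X + .C k) + 7) + (.X + .C k) + 3)
  obtain ⟨n, hn, hlt⟩ := ((Filter.eventually_ge_atTop d).and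
    (eventually_eval_lt_two_pow (P.comp R))).exists
  obtain ⟨w, hw, hlen⟩ := exists_systemWord_largeSystem (k := k) hd hn
  have hS := largeSystem_mem_sigma hk hd hn
  obtain ⟨G, hGw, hG⟩ := hf _ hS w hw
  -- The value other than `0` is `∗` for extended graphs, and `1` if `k ≥ 2`.
  obtain ⟨x, hx, hx'⟩ : ∃ x, x ≠ some 0 ∧
      ∀ a < n, x ∈ problemValues C (largeSystem k d n) a := by
    rcases h with h | h
    · exact ⟨none, by simp, fun a _ => mem_problemValues.2 (.inl ⟨h, rfl⟩)⟩
    · refine ⟨some 1, by simp, fun a ha => mem_problemValues.2 (.inr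
        ⟨_, mem_largeSystem.2 (.inr ⟨a, ha, 1, h, rfl⟩), 1, ?_, rfl⟩)⟩
      simp [unitRule]
  have h₁ := hG.two_pow_le_card hC hk hn hx hx'
  have h₂ := hGw.card_nodes_le
  have h₃ := hP ⟨w, _, hS, hw⟩
  have h₄ := eval_monotone P hlen
  have h₅ : R.eval n = (n * k + 1) * (d * (2 * (n + k) + 7) + (n + k) + 3) := by
    simp [R]
  rw [Polynomial.eval_comp, h₅] at hlt
  simp only at h₃ h₄
  omega

end DecisionRules

theorem theorem2 :
    (DecisionRules.PDG .SR = {p | 0 < p.1 ∧ 0 < p.2} ∧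
      DecisionRules.PDG .ESR = {p | 0 < p.1 ∧ 0 < p.2}) ∧
    (DecisionRules.PDG .AD = {p | p.1 = 1 ∧ 0 < p.2} ∧
      DecisionRules.PDG .AR = {p | p.1 = 1 ∧ 0 < p.2}) ∧
    (DecisionRules.PDG .EAD = ∅ ∧ DecisionRules.PDG .EAR = ∅) := by
  have hSR : ∀ C : DecisionRules.Problem, C = .SR ∨ C = .ESR → DecisionRules.PDG C = {p | 0 < p.1 ∧ 0 < p.2} := by
    intro C hC
    ext ⟨k, d⟩
    exact ⟨fun h => ⟨h.1, h.2.1⟩, fun h => ⟨h.1, h.2, DecisionRules.polyTimeConstructible_sr hC k d⟩⟩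
  have hAD : ∀ C : DecisionRules.Problem, C = .AD ∨ C = .AR → DecisionRules.PDG C = {p | p.1 = 1 ∧ 0 < p.2} := by
    intro C hC
    ext ⟨k, d⟩
    constructor
    · rintro ⟨hk, hd, h⟩
      refine ⟨?_, hd⟩
      by_contra hk'
      exact DecisionRules.not_polyTimeConstructible (by tauto) hk hd
        (.inr ((Nat.two_le_iff k).2 ⟨hk.ne', hk'⟩)) h
    · rintro ⟨rfl : k = 1, hd⟩
      exact ⟨one_pos, hd, DecisionRules.polyTimeConstructible_ad hC d⟩
  have hEAD : ∀ C : DecisionRules.Problem, C = .EAD ∨ C = .EAR → DecisionRules.PDG C = ∅ := by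
    intro C hC
    refine Set.eq_empty_of_forall_notMem fun p hp => ?_
    refine DecisionRules.not_polyTimeConstructible (by tauto) hp.1 hp.2.1 (.inl ?_) hp.2.2
    rcases hC with rfl | rfl <;> trivial
  exact ⟨⟨hSR _ (.inl rfl), hSR _ (.inr rfl)⟩, ⟨hAD _ (.inl rfl), hAD _ (.inr rfl)⟩,
    hEAD _ (.inl rfl), hEAD _ (.inr rfl)⟩
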